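/- **Corollary 3.2 (Hermite to Charlier functionals).** Let $(X,\nu)$ be a standard Borel space with a $\sigma$-finite measure without atoms. *Gaussian side.* Let $\alpha$ be the Gaussian white noise on $(X,\nu)$, i.e. a linear map $h\mapsto\langle h,\cdot\rangle$ from the real space $L^2(X,\nu)$ to the real random variables (mod 0) on a probability space, with $\mathbb E\,e^{i\langle h,\cdot\rangle}=e^{-\|h\|^2/2}$ for all $h$. Let $L^2(\alpha)$ be the complex Hilbert space of the square integrable random variables that are measurable with respect to the completed $\sigma$-field generated by $\{\langle h,\cdot\rangle\}_h$. *Poisson side.* Let $\mathcal E$ be the set of point configurations on $X$ (at most countable sets of points with positive integer multiplicities), with the $\sigma$-field generated by the counts $\omega\mapsto\#(\omega\cap A)$, $A$ measurable. Let $\mathcal P$ be the law on $\mathcal E$ of the Poisson process $\pi$ with mean measure $\nu$, that is, $\#(\omega\cap A)$ has the Poisson distribution with parameter $\nu(A)$, and the counts in disjoint measurable sets are independent. Put $L^2(\pi)=L^2(\mathcal E,\mathcal P;\mathbb C)$. Sums and products over $x\in\omega$ take multiplicities into account. *The canonical isomorphism.* There is exactly one unitary operator $\Phi:L^2(\alpha)\to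 L^2(\pi)$ such that for every real $h\in L^1(X,\nu)\cap L^2(X,\nu)$ $$\Phi\Big(e^{\langle h,\cdot\rangle-\|h\|^2/2}\Big)(\omega)=\prod_{x\in\omega}(1+h(x))\cdot e^{-\int_X h\,d\nu}.$$ It is called the canonical isomorphism. *The functionals.* For $n\ge 0$ and real $f_1,\dots,f_n\in L^2(X,\nu)$ define the generalized Hermite functional $$\mathfrak H^{(n)}_{f_1,\dots,f_n}=\sum_{g\in\mathfrak S_n,\ g^2=1}\ \prod_{i:\,g(i)=i}\langle f_i,\cdot\rangle\prod_{j<g(j)}\bigl(-(f_j,f_{g(j)})\bigr),\qquad (f,f')=\int_X f f'\,d\nu,$$ and the generalized Charlier functional $$\mathfrak C^{(n)}_{f_1,\dots,f_n}(\omega)=\sum_{g\in\mathfrak S_n}(-1)^{n-c(g)}\prod_{i:\,g(i)=i}\Big(\sum_{x\in\omega}f_i(x)-\int_X f_i\,d\nu\Big)\prod_{\substack{(i_1,\dots,i_k)\in C(g)\\ k\ge2}}\ \sum_{x\in\omega}f_{i_1}(x)\cdots f_{i_k}(x),$$ where $C(g)$ is the set of cycles of $g$ and $c(g)$ is their number,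 fixed points included. For $f\in L^2(X,\nu)\setminus L^1(X,\nu)$ the expression $\sum_{x\in\omega}f(x)-\int f\,d\nu$ stands for its extension by continuity from $L^1\cap L^2$ as a map $L^2(X,\nu)\to L^2(\pi)$. Let $\mathcal H_n\subset L^2(\alpha)$ and $V_n\subset L^2(\pi)$ be the closed complex linear spans of the Hermite, respectively Charlier, functionals of order $n$. *Claim.* All these functionals are square integrable, and for all $n\ge0$ and all real $f_1,\dots,f_n\in L^2(X,\nu)$ $$\Phi\,\mathfrak H^{(n)}_{f_1,\dots,f_n}=\mathfrak C^{(n)}_{f_1,\dots,f_n}.$$ Moreover, $L^2(\alpha)=\bigoplus_{n\ge0}\mathcal H_n$ and $L^2(\pi)=\bigoplus_{n\ge0}V_n$ (orthogonal Hilbert sums; the Wiener and the Poisson chaos decomposition), and $\Phi(\mathcal H_n)=V_n$ for every $n$. -/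

import Mathlib

open MeasureTheory ProbabilityTheory Filter Topology
open scoped ENNReal

noncomputable section

namespace GaussPoisson

/-! ### Gaussian white noise -/

/-- Gaussian white noise on `(X, ν)`: a generalized random process `h ↦ ⟨h, ·⟩ = W h` on the real
Hilbert space `L²(X, ν)`, i.e. a linear map into random variables (mod 0), with the characteristic
functional `E exp (i ⟨h, ·⟩) = exp (-‖h‖² / 2)`. -/
structure IsGaussianWhiteNoise {X Ω : Type*} [MeasurableSpace X] [MeasurableSpace Ω]
    (ν : Measure X) (P : Measure Ω) (W : Lp ℝ 2 ν → Ω → ℝ) : Prop where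
  measurable : ∀ h, Measurable (W h)
  map_add : ∀ g h, W (g + h) =ᵐ[P] fun ω => W g ω + W h ω
  map_smul : ∀ (c : ℝ) (h), W (c • h) =ᵐ[P] fun ω => c * W h ω
  characteristic : ∀ h,
    ∫ ω, Complex.exp (Complex.I * (W h ω : ℂ)) ∂P = ((Real.exp (-(‖h‖ ^ 2) / 2) : ℝ) : ℂ)

/-- The `σ`-field generated by a process indexed by `L²(X, ν)`. -/
abbrev generatedSigmaField {X Ω : Type*} [MeasurableSpace X] {ν : Measure X}
    (W : Lp ℝ 2 ν → Ω → ℝ) : MeasurableSpace Ω :=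
  ⨆ h, MeasurableSpace.comap (W h) inferInstance

/-- The complex Hilbert space `L²(α)` of square integrable functionals of the process: the classes
in `L²(Ω, P)` measurable with respect to the completed `σ`-field generated by the process. -/
abbrev NoiseL2 {X Ω : Type*} [MeasurableSpace X] [MeasurableSpace Ω] {ν : Measure X}
    (P : Measure Ω) (W : Lp ℝ 2 ν → Ω → ℝ) : Submodule ℂ (Lp ℂ 2 P) :=
  lpMeas ℂ ℂ (generatedSigmaField W) 2 P

/-! ### The Poisson process -/

/-- A point configuration: an at most countable set of points with positive integral
multiplicities (`mult x = 0` means that `x` is not in the configuration). -/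
structure Configuration (X : Type*) where
  mult : X → ℕ
  countable_support : (Function.support mult).Countable

namespace Configuration

variable {X : Type*}

/-- The number of points of the configuration in `A`, counted with multiplicity. -/
def count (ω : Configuration X) (A : Set X) : ℝ≥0∞ := ∑' x : A, (ω.mult x : ℝ≥0∞)

/-- The sum of `f x` over the points `x` of the configuration, with multiplicity. -/
def sum (ω : Configuration X) (f : X → ℝ) : ℝ := ∑' x, (ω.mult x : ℝ) * f x

/-- The product of `f x` over the points `x` of the configuration, with multiplicity. -/
def prod (ω : Configuration X) (f : X → ℝ) : ℝ := ∏' x, f x ^ ω.mult x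

/-- The `σ`-field on configurations generated by the counts in measurable sets. -/
instance [MeasurableSpace X] : MeasurableSpace (Configuration X) :=
  ⨆ (A : Set X) (_ : MeasurableSet A),
    MeasurableSpace.comap (fun ω : Configuration X => ω.count A) inferInstance

end Configuration

/-- `Q` is the law, on the space of configurations, of the Poisson process with mean measure `ν`.
(If `ν A = ∞`, then `count A = ∞` almost surely follows, by `σ`-finiteness of `ν`.) -/
structure IsPoissonProcess {X : Type*} [MeasurableSpace X] (ν : Measure X)
    (Q : Measure (Configuration X)) : Prop where
  poisson : ∀ A, MeasurableSet A → ν A ≠ ∞ → ∀ k : ℕ,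
    Q {ω | ω.count A = k} =
      ENNReal.ofReal ((ν A).toReal ^ k / (k.factorial : ℝ) * Real.exp (-(ν A).toReal))
  indep : ∀ (n : ℕ) (A : Fin n → Set X), (∀ i, MeasurableSet (A i)) →
    Pairwise (Function.onFun Disjoint A) →
      iIndepFun (fun i (ω : Configuration X) => ω.count (A i)) Q

/-! ### The canonical isomorphism -/

/-- `Φ : L²(α) → L²(π)` is the canonical isomorphism: the unitary operator which for every
`h ∈ L¹ ∩ L²` sends `exp (⟨h, ·⟩ - ‖h‖² / 2)` to `∏_{x ∈ ω} (1 + h x) · exp (-∫ h dν)`. -/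
def IsCanonicalIsomorphism {X Ω : Type*} [MeasurableSpace X] [MeasurableSpace Ω]
    {ν : Measure X} (P : Measure Ω) (W : Lp ℝ 2 ν → Ω → ℝ) (Q : Measure (Configuration X))
    (Φ : NoiseL2 P W ≃ₗᵢ[ℂ] Lp ℂ 2 Q) : Prop :=
  ∀ h : Lp ℝ 2 ν, Integrable h ν → ∃ F : NoiseL2 P W,
    ((F : Lp ℂ 2 P) =ᵐ[P] fun η => ((Real.exp (W h η - ‖h‖ ^ 2 / 2) : ℝ) : ℂ)) ∧
    (Φ F =ᵐ[Q] fun ω =>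
      ((ω.prod (fun x => 1 + h x) * Real.exp (-∫ x, h x ∂ν) : ℝ) : ℂ))

/-! ### Generalized Hermite functionals -/

/-- The fixed points (cycles of length one) of a permutation of `{1, …, n}`. -/
def fixedPts {n : ℕ} (g : Equiv.Perm (Fin n)) : Finset (Fin n) :=
  Finset.univ.filter fun i => g i = i

/-- The number of cycles of a permutation, the fixed points included. -/
def numCycles {n : ℕ} (g : Equiv.Perm (Fin n)) : ℕ :=
  (fixedPts g).card + g.cycleFactorsFinset.card

/-- The `n`th generalized Hermite functional: the sum over the involutions `g` of `{1, …, n}` of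
`∏_{g i = i} ⟨f i, ·⟩ · ∏_{ {j, g j}, j < g j } (-(f j, f (g j)))`. -/
def hermite {X Ω : Type*} [MeasurableSpace X] {ν : Measure X}
    (W : Lp ℝ 2 ν → Ω → ℝ) {n : ℕ} (f : Fin n → Lp ℝ 2 ν) (η : Ω) : ℝ :=
  ∑ g : Equiv.Perm (Fin n) with g * g = 1,
    (∏ i ∈ fixedPts g, W (f i) η) *
      ∏ j : Fin n with j < g j, (-(inner ℝ (f j) (f (g j))))

/-! ### Generalized Charlier functionals -/

/-- `Σ_{x ∈ ω} f x - ∫ f dν` for a `ν`-integrable `f`. -/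
def centeredSum {X : Type*} [MeasurableSpace X] (ν : Measure X) (f : X → ℝ)
    (ω : Configuration X) : ℝ :=
  ω.sum f - ∫ x, f x ∂ν

/-- `Y` is an extension by continuity of the centered sum to `f ∈ L²(X, ν)`: for some sequence of
functions `g k ∈ L¹ ∩ L²` that converges to `f` in `L²(ν)`, the centered sums of the `g k` converge
to `Y` in `L²(Q)`. -/
def IsCenteredSumLimit {X : Type*} [MeasurableSpace X] (ν : Measure X)
    (Q : Measure (Configuration X)) (f : X → ℝ) (Y : Configuration X → ℝ) : Prop :=
  MemLp Y 2 Q ∧ ∃ g : ℕ → X → ℝ, (∀ k, Integrable (g k) ν ∧ MemLp (g k) 2 ν) ∧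
    Tendsto (fun k => eLpNorm (fun x => g k x - f x) 2 ν) atTop (𝓝 0) ∧
    Tendsto (fun k => eLpNorm (fun ω => centeredSum ν (g k) ω - Y ω) 2 Q) atTop (𝓝 0)

open Classical in
/-- The functional `Σ_{x ∈ ω} f x - ∫ f dν` of the Poisson process for `f ∈ L²(X, ν)`: literally
this expression if `f` is `ν`-integrable, and its extension by `L²`-continuity (determined up to
null sets) otherwise. -/
def poissonLinear {X : Type*} [MeasurableSpace X] (ν : Measure X)
    (Q : Measure (Configuration X)) (f : X → ℝ) : Configuration X → ℝ :=
  if Integrable f ν then centeredSum ν f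
  else if hY : ∃ Y, IsCenteredSumLimit ν Q f Y then hY.choose else 0

/-- The `n`th generalized Charlier functional: the sum over all permutations `g` of `{1, …, n}` of
`(-1)^{n - c(g)} ∏_{g i = i} (Σ_{x ∈ ω} f i x - ∫ f i dν) ·
∏_{cycles (i_1, …, i_k) of g, k ≥ 2} Σ_{x ∈ ω} f i_1 x ⋯ f i_k x`. -/
def charlier {X : Type*} [MeasurableSpace X] {ν : Measure X} (Q : Measure (Configuration X))
    {n : ℕ} (f : Fin n → Lp ℝ 2 ν) (ω : Configuration X) : ℝ :=
  ∑ g : Equiv.Perm (Fin n), (-1) ^ (n - numCycles g) *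
    (∏ i ∈ fixedPts g, poissonLinear ν Q (f i) ω) *
      ∏ c ∈ g.cycleFactorsFinset, ω.sum (fun x => ∏ i ∈ c.support, f i x)

/-! ### Chaos decompositions -/

/-- The `n`th Wiener chaos: the closed complex span of the Hermite functionals of order `n`. -/
def wienerChaos {X Ω : Type*} [MeasurableSpace X] [MeasurableSpace Ω] {ν : Measure X}
    (P : Measure Ω) (W : Lp ℝ 2 ν → Ω → ℝ) (n : ℕ) : Submodule ℂ (NoiseL2 P W) :=
  (Submodule.span ℂ {F : NoiseL2 P W | ∃ f : Fin n → Lp ℝ 2 ν,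
    (F : Lp ℂ 2 P) =ᵐ[P] fun η => ((hermite W f η : ℝ) : ℂ)}).topologicalClosure

/-- The `n`th Poisson chaos: the closed complex span of the Charlier functionals of order `n`. -/
def poissonChaos {X : Type*} [MeasurableSpace X] (ν : Measure X)
    (Q : Measure (Configuration X)) (n : ℕ) : Submodule ℂ (Lp ℂ 2 Q) :=
  (Submodule.span ℂ {G : Lp ℂ 2 Q | ∃ f : Fin n → Lp ℝ 2 ν,
    G =ᵐ[Q] fun ω => ((charlier Q f ω : ℝ) : ℂ)}).topologicalClosure

/-- A Hilbert space is the orthogonal direct sum of the (closed) subspaces `V 0, V 1, …`. -/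
def IsOrthogonalDecomposition {E : Type*} [NormedAddCommGroup E] [InnerProductSpace ℂ E]
    (V : ℕ → Submodule ℂ E) : Prop :=
  (∀ n, IsClosed (V n : Set E)) ∧ (∀ m n, m ≠ n → V m ⟂ V n) ∧
    (⨆ n, V n).topologicalClosure = ⊤

end GaussPoisson

end

noncomputable section

namespace GaussPoisson

/-! ### Sums over permutations of products over cycles -/

section CycleSum

open Classical Equiv Finset

variable {α β A : Type*} [Fintype α] [Fintype β] [CommMonoid A]

/-! Both functionals are Taylor coefficients of exponentials. A sum over permutations of products
over cycles, with weight `w`, has the exponential generating function `exp (∑ w (a ^ k) t ^ k / k)`.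
A weight that sees only powers one and two gives `exp (x t - v t² / 2)`, and its sum runs over
involutions: this is Hermite. A weight built from power sums over a configuration, with signs and a
compensator on fixed points, gives `∏ (1 + t f x) · exp (-t ∫ f)`: this is Charlier. Linear weights
make the cycle sums symmetric and multilinear, so the diagonal case gives all arguments by
polarization (`sum_neg_one_pow_mul_cycleSum`).

The Gaussian exponentials and the Poisson exponentials of `g` and `h` have the same inner product
`exp (g, h)` (`inner_noiseExp`, `inner_poissonVec`). Both families are total. Indeed, a vector
orthogonal to them splits into positive and negative parts whose densities give the generating
variables the same moment generating functions, hence the same joint laws. Equal Gram matrices of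
total families determine exactly one unitary `Φ`.

The Gaussian exponential of `t h` is a norm convergent power series in `t` with the diagonal Hermite
vectors as coefficients. Apply `Φ` and compare with the Charlier generating function: when `h`
vanishes off a set of finite measure, almost every configuration has only finitely many relevant
points, and equality at `t = 1 / (j + 1)` for all `j` identifies the coefficients almost surely
(`ae_canonical_noiseHermiteDiag`). Polarization and truncation extend this to all of `L²`. A cycle
of length at least two only needs sums of `∑ f i x ^ 2`, which are almost surely finite. The linear
terms are the images of first order Hermite vectors, so their extension by continuity exists and is
unique (`ae_canonical_linear`).

Expanding `exp (s t (g, h))` shows that diagonal Hermite vectors of different orders are orthogonal;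
the exponentials are sums of such vectors, so the chaoses span. `Φ` carries the decomposition to the
Poisson side. -/

/-- The product over the classes of a setoid of a weight of the product over the class. -/
def setoidProd (w : A → ℝ) (r : Setoid α) (a : α → A) : ℝ :=
  ∏ q : Quotient r, w (∏ i with Quotient.mk r i = q, a i)

/-- The sum over all permutations of the product over the cycles (fixed points included) of the
weight of the product over the cycle. -/
def cycleSum [DecidableEq α] (w : A → ℝ) (a : α → A) : ℝ :=
  ∑ g : Perm α, setoidProd w (Perm.SameCycle.setoid g) a

/-- A surjection that preserves and reflects the relations induces a bijection of the quotients, and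
each class is the union of its fibres. Conjugation and insertion of a point into a cycle are both
compared in this way. -/
lemma setoidProd_of_surjective (w : A → ℝ) (r : Setoid α) (s : Setoid β) (π : α → β)
    (hπ : Function.Surjective π) (h : ∀ x y, r x y ↔ s (π x) (π y)) (a : α → A) :
    setoidProd w r a = setoidProd w s (fun b => ∏ x with π x = b, a x) := by
  let e : Quotient r → Quotient s := Quotient.map π (fun x y hxy => (h x y).1 hxy)
  have he : Function.Bijective e := by
    constructor
    · intro p q
      induction p using Quotient.inductionOn with | _ x
      induction q using Quotient.inductionOn with | _ y
      intro hxy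
      exact Quotient.sound ((h x y).2 (Quotient.exact hxy))
    · intro q
      induction q using Quotient.inductionOn with | _ y
      obtain ⟨x, rfl⟩ := hπ y
      exact ⟨Quotient.mk r x, rfl⟩
  refine Fintype.prod_bijective e he _ _ fun q => ?_
  congr 1
  rw [← Finset.prod_fiberwise_of_maps_to (s := univ.filter fun i => Quotient.mk r i = q)
    (t := univ.filter fun b => Quotient.mk s b = e q) (g := π)]
  · refine Finset.prod_congr rfl fun b hb => Finset.prod_congr ?_ fun _ _ => rfl
    ext x
    simp only [mem_filter, mem_univ, true_and] at hb ⊢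
    constructor
    · exact fun hx => hx.2
    · rintro rfl
      exact ⟨he.1 hb, rfl⟩
  · intro x hx
    simp only [mem_filter, mem_univ, true_and] at hx ⊢
    rw [← hx]
    rfl

lemma cycleSum_comp_equiv [DecidableEq α] [DecidableEq β] (w : A → ℝ) (e : α ≃ β) (a : β → A) :
    cycleSum w (fun i => a (e i)) = cycleSum w a := by
  refine Fintype.sum_equiv e.permCongr _ _ fun g => ?_
  rw [setoidProd_of_surjective w _ (Perm.SameCycle.setoid (e.permCongr g)) e e.surjective]
  · congr 1
    ext b
    rw [Finset.prod_eq_single (e.symm b)]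
    · simp
    · intro x hx hxb
      simp only [mem_filter, mem_univ, true_and] at hx
      exact absurd (by simp [← hx]) hxb
    · simp
  · intro x y
    change Perm.SameCycle g x y ↔ Perm.SameCycle (e.permCongr g) (e x) (e y)
    unfold Perm.SameCycle
    have : ∀ i : ℤ, ((e.permCongr g) ^ i) (e x) = e ((g ^ i) x) := by
      intro i
      have : (e.permCongr g) ^ i = e.permCongr (g ^ i) :=
        (map_zpow e.permCongrHom g i).symm
      rw [this]
      simp [Equiv.permCongr_apply]
    simp [this]

/-- A relation that holds along one step of `g` holds along the whole orbit, so only single steps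
have to be checked. -/
lemma rel_of_sameCycle {γ : Type*} {g : Perm α} {s : Setoid γ} {π : α → γ} (h : ∀ x, s (π x) (π (g x)))
    {x y : α} (hxy : Perm.SameCycle g x y) : s (π x) (π y) := by
  obtain ⟨n, rfl⟩ := hxy.exists_nat_pow_eq
  induction n with
  | zero => exact s.refl _
  | succ n ih =>
    rw [pow_succ', Perm.mul_apply]
    exact s.trans (ih ⟨n, by simp⟩) (h _)

/-- The permutation on the left inserts `none` into the cycle of `j`, immediately before `j`.
Contracting `none` onto `j` recovers the cycles of `σ`. -/
lemma sameCycle_swap_mul_optionCongr [DecidableEq α] (σ : Perm α) (j : α) (x y : Option α) :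
    Perm.SameCycle (swap none (some j) * σ.optionCongr) x y ↔
      Perm.SameCycle σ (x.getD j) (y.getD j) := by
  set g := swap none (some j) * σ.optionCongr with hg
  have hnone : g none = some j := by simp [hg]
  have hsome : ∀ a, g (some a) = if σ a = j then none else some (σ a) := by
    intro a
    simp only [hg, Perm.mul_apply, optionCongr_apply, Option.map_some]
    split_ifs with h
    · simp [h]
    · rw [swap_apply_of_ne_of_ne] <;> simp [h]
  have step : ∀ x, Perm.SameCycle σ (x.getD j) ((g x).getD j) := by
    intro x
    cases x with
    | none => simpa [hnone] using Perm.SameCycle.refl σ j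
    | some a =>
      rw [hsome]
      have : Perm.SameCycle σ a (σ a) := (Perm.SameCycle.refl σ a).apply_right
      split_ifs with h
      · simpa [h] using this
      · simpa using this
  have step' : ∀ a, Perm.SameCycle g (some a) (some (σ a)) := by
    intro a
    by_cases h : σ a = j
    · have h2 : g (g (some a)) = some (σ a) := by rw [hsome, if_pos h, hnone, h]
      rw [← h2]
      exact (Perm.SameCycle.refl g _).apply_right.apply_right
    · have h2 : g (some a) = some (σ a) := by rw [hsome, if_neg h]
      rw [← h2]
      exact (Perm.SameCycle.refl g _).apply_right
  have hget : ∀ x : Option α, Perm.SameCycle g x (some (x.getD j)) := by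
    intro x
    cases x with
    | none => exact hnone ▸ (Perm.SameCycle.refl g none).apply_right
    | some a => exact Perm.SameCycle.refl g _
  refine ⟨fun h => rel_of_sameCycle (s := Perm.SameCycle.setoid σ) step h, fun h => ?_⟩
  exact (hget x).trans ((rel_of_sameCycle (s := Perm.SameCycle.setoid g) step' h).trans
    (hget y).symm)

lemma sameCycle_optionCongr_some (σ : Perm α) (a b : α) :
    Perm.SameCycle σ.optionCongr (some a) (some b) ↔ Perm.SameCycle σ a b := by
  refine ⟨fun h => ?_, fun h => ?_⟩
  · refine rel_of_sameCycle (g := σ.optionCongr) (s := Perm.SameCycle.setoid σ)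
      (π := fun x : Option α => x.getD a) (fun x => ?_) h
    cases x with
    | none => exact Perm.SameCycle.refl σ a
    | some c => exact (Perm.SameCycle.refl σ c).apply_right
  · refine rel_of_sameCycle (g := σ) (s := Perm.SameCycle.setoid σ.optionCongr) (π := some)
      (fun x => ?_) h
    exact (Perm.SameCycle.refl σ.optionCongr (some x)).apply_right

lemma not_sameCycle_optionCongr_none (σ : Perm α) (a : α) :
    ¬ Perm.SameCycle σ.optionCongr none (some a) := by
  intro h
  have := rel_of_sameCycle (g := σ.optionCongr) (s := ⊥) (π := Option.isSome)
    (fun x => by cases x <;> rfl) h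
  exact absurd (show (none : Option α).isSome = (some a).isSome from this) (by simp)

/-- After `none` is contracted onto `j`, the fibre over `j` carries two factors and every other
fibre one. -/
lemma setoidProd_swap_mul_optionCongr [DecidableEq α] (w : A → ℝ) (σ : Perm α) (j : α) (b : Option α → A) :
    setoidProd w (Perm.SameCycle.setoid (swap none (some j) * σ.optionCongr)) b =
      setoidProd w (Perm.SameCycle.setoid σ)
        (Function.update (fun i => b (some i)) j (b none * b (some j))) := by
  rw [setoidProd_of_surjective w _ (Perm.SameCycle.setoid σ) (fun x : Option α => x.getD j)
    (fun a => ⟨some a, rfl⟩) (sameCycle_swap_mul_optionCongr σ j)]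
  congr 1
  ext i
  rw [Finset.prod_filter, Fintype.prod_option]
  by_cases h : j = i
  · subst h
    simp only [Option.getD_none, Option.getD_some, if_true, Function.update_self]
    exact congrArg _ ((Finset.prod_eq_single j (fun x _ hx => if_neg hx)
      (fun hj => absurd (Finset.mem_univ j) hj)).trans (if_pos rfl))
  · simp only [Option.getD_none, Option.getD_some, if_neg h, one_mul,
      Function.update_of_ne (Ne.symm h)]
    exact (Finset.prod_eq_single i (fun x _ hx => if_neg hx)
      (fun hi => absurd (Finset.mem_univ i) hi)).trans (if_pos rfl)

/-- Here the added point is fixed, so it forms a class of its own and the other classes are those of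
`σ`. -/
lemma setoidProd_optionCongr (w : A → ℝ) (σ : Perm α) (b : Option α → A) :
    setoidProd w (Perm.SameCycle.setoid σ.optionCongr) b =
      w (b none) * setoidProd w (Perm.SameCycle.setoid σ) (fun i => b (some i)) := by
  let r := Perm.SameCycle.setoid σ
  let r' := Perm.SameCycle.setoid σ.optionCongr
  let e : Option (Quotient r) → Quotient r' := fun o => o.elim (Quotient.mk r' none)
    (Quotient.map some fun x y h => (sameCycle_optionCongr_some σ x y).2 h)
  have he : Function.Bijective e := by
    constructor
    · intro p q hpq
      rcases p with _ | p <;> rcases q with _ | q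
      · rfl
      · induction q using Quotient.inductionOn with | _ y
        exact absurd (Quotient.exact hpq) (not_sameCycle_optionCongr_none σ y)
      · induction p using Quotient.inductionOn with | _ y
        exact absurd (Quotient.exact hpq.symm) (not_sameCycle_optionCongr_none σ y)
      · induction p using Quotient.inductionOn with | _ x
        induction q using Quotient.inductionOn with | _ y
        exact congrArg some (Quotient.sound
          ((sameCycle_optionCongr_some σ x y).1 (Quotient.exact hpq)))
    · intro q
      induction q using Quotient.inductionOn with | _ y
      cases y with
      | none => exact ⟨none, rfl⟩
      | some y => exact ⟨some (Quotient.mk r y), rfl⟩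
  unfold setoidProd
  rw [← (Equiv.ofBijective e he).prod_comp, Fintype.prod_option]
  simp only [Equiv.ofBijective_apply]
  congr 1
  · congr 1
    rw [Finset.prod_filter, Fintype.prod_option]
    have h1 : Quotient.mk r' none = e none := rfl
    have h2 : ∀ x : α, ¬ (Quotient.mk r' (some x) = e none) := fun x h =>
      not_sameCycle_optionCongr_none σ x (Quotient.exact h.symm)
    simp only [r'] at h1 h2
    rw [if_pos h1, Finset.prod_eq_one, mul_one]
    intro x _
    rw [if_neg (h2 x)]
  · refine Finset.prod_congr rfl fun q _ => ?_
    congr 1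
    rw [Finset.prod_filter, Finset.prod_filter, Fintype.prod_option]
    have h1 : ¬ (Quotient.mk r' none = e (some q)) := fun h => by
      have := he.1 (show e none = e (some q) from h)
      simp at this
    have h2 : ∀ x : α, (Quotient.mk r' (some x) = e (some q)) ↔ Quotient.mk r x = q := by
      intro x
      have : Quotient.mk r' (some x) = e (some (Quotient.mk r x)) := rfl
      rw [this, he.1.eq_iff, Option.some.injEq]
    simp only [r', r] at h1 h2
    rw [if_neg h1, one_mul]
    refine Finset.prod_congr rfl fun x _ => ?_
    rw [if_congr (h2 x) rfl rfl]

/-- Removal of a point from its cycle. -/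
lemma cycleSum_option [DecidableEq α] (w : A → ℝ) (b : Option α → A) :
    cycleSum w b = w (b none) * cycleSum w (fun i => b (some i)) +
      ∑ j, cycleSum w (Function.update (fun i => b (some i)) j (b none * b (some j))) := by
  unfold cycleSum
  -- Each permutation of `Option α` is uniquely a lifted `σ` followed by a swap of `none` with some
  -- `o`; `o = none` means that the new point is fixed.
  have : ∀ F : Perm (Option α) → ℝ, ∑ g, F g =
      ∑ o : Option α, ∑ σ : Perm α, F (swap none o * σ.optionCongr) := by
    intro F
    rw [← (Equiv.Perm.decomposeOption (α := α)).symm.sum_comp, Fintype.sum_prod_type]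
    rfl
  rw [this, Fintype.sum_option]
  congr 1
  · rw [Finset.mul_sum]
    refine Finset.sum_congr rfl fun σ _ => ?_
    rw [swap_self]
    exact setoidProd_optionCongr w σ b
  · refine Finset.sum_congr rfl fun j _ => Finset.sum_congr rfl fun σ _ => ?_
    exact setoidProd_swap_mul_optionCongr w σ j b

/-- The sum over permutations of `n + 1` points, one of them carrying `x` and the others `a`. -/
lemma cycleSum_elim_succ (w : A → ℝ) (x a : A) (n : ℕ) :
    cycleSum w (fun o : Option (Fin (n + 1)) => o.elim x fun _ => a) =
      w x * cycleSum w (fun _ : Fin (n + 1) => a) +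
        (n + 1) * cycleSum w (fun o : Option (Fin n) => o.elim (x * a) fun _ => a) := by
  rw [cycleSum_option]
  congr 1
  rw [Finset.sum_congr rfl (g := fun _ =>
    cycleSum w (fun o : Option (Fin n) => o.elim (x * a) fun _ => a))]
  · simp
  · intro j _
    rw [← cycleSum_comp_equiv w (finSuccEquiv' j)]
    congr 1
    ext i
    rcases eq_or_ne i j with rfl | h
    · simp
    · obtain ⟨k, rfl⟩ := Fin.exists_succAbove_eq h
      simp

lemma cycleSum_fin_succ (w : A → ℝ) (a : A) (n : ℕ) :
    cycleSum w (fun _ : Fin (n + 1) => a) =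
      cycleSum w (fun o : Option (Fin n) => o.elim a fun _ => a) := by
  rw [← cycleSum_comp_equiv w (finSuccEquiv n)]
  congr 1
  ext i
  refine Fin.cases ?_ (fun k => ?_) i <;> simp

lemma cycleSum_of_isEmpty [DecidableEq α] [IsEmpty α] (w : A → ℝ) (a : α → A) : cycleSum w a = 1 := by
  have : ∀ r : Setoid α, IsEmpty (Quotient r) := fun r =>
    ⟨fun q => by induction q using Quotient.inductionOn with | _ x; exact isEmptyElim x⟩
  simp [cycleSum, setoidProd]

/-- The cycle through the marked point absorbs `p.1` further points and the remaining `p.2` are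
permuted freely; the factorials cancel the number of choices. The exponent `k` is free because each
absorbed point raises the power carried by the mark. -/
lemma cycleSum_elim_eq_sum (w : A → ℝ) (a : A) (n k : ℕ) :
    cycleSum w (fun o : Option (Fin n) => o.elim (a ^ (k + 1)) fun _ => a) / n.factorial =
      ∑ p ∈ antidiagonal n, w (a ^ (k + p.1 + 1)) *
        (cycleSum w (fun _ : Fin p.2 => a) / p.2.factorial) := by
  induction n generalizing k with
  | zero =>
    rw [cycleSum_option]
    simp [cycleSum_of_isEmpty]
  | succ n ih =>
    rw [cycleSum_elim_succ, Finset.Nat.antidiagonal_succ, Finset.sum_cons, Finset.sum_map]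
    simp only [Function.Embedding.prodMap, Function.Embedding.coeFn_mk, Prod.map]
    have := ih (k + 1)
    rw [← pow_succ, Nat.factorial_succ, add_div]
    congr 1
    · simp [mul_div_assoc]
    · push_cast
      rw [mul_div_mul_left _ _ (by positivity), this]
      refine Finset.sum_congr rfl fun p _ => ?_
      rw [show k + 1 + p.1 + 1 = k + (p.1 + 1) + 1 by ring]
      rfl

/-- The exponential generating function of the sums over permutations. -/
def cycleSeries (w : A → ℝ) (a : A) : PowerSeries ℝ :=
  PowerSeries.mk fun n => cycleSum w (fun _ : Fin n => a) / n.factorial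

/-- The exponential formula in differential form: differentiation marks a point, and the cycle
through the mark is split off. -/
lemma derivative_cycleSeries (w : A → ℝ) (a : A) :
    PowerSeries.derivative ℝ (cycleSeries w a) =
      PowerSeries.mk (fun k => w (a ^ (k + 1))) * cycleSeries w a := by
  ext n
  rw [PowerSeries.coeff_derivative, PowerSeries.coeff_mul]
  simp only [cycleSeries, PowerSeries.coeff_mk]
  rw [cycleSum_fin_succ]
  have := cycleSum_elim_eq_sum w a n 0
  simp only [zero_add, pow_one] at this
  rw [← this, Nat.factorial_succ]
  push_cast
  field_simp

end CycleSum

/-- A power series over a field of characteristic zero is determined by its constant coefficient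
and its logarithmic derivative. -/
lemma powerSeries_eq_of_derivative_eq_mul {W F G : PowerSeries ℝ}
    (h0 : PowerSeries.coeff 0 F = PowerSeries.coeff 0 G)
    (hF : PowerSeries.derivative ℝ F = W * F) (hG : PowerSeries.derivative ℝ G = W * G) :
    F = G := by
  ext n
  induction n using Nat.strong_induction_on with
  | _ n ih =>
    cases n with
    | zero => exact h0
    | succ n =>
      have h1 := congrArg (PowerSeries.coeff n) hF
      have h2 := congrArg (PowerSeries.coeff n) hG
      rw [PowerSeries.coeff_derivative, PowerSeries.coeff_mul] at h1 h2
      have : PowerSeries.coeff (n + 1) F * ((n : ℝ) + 1) =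
          PowerSeries.coeff (n + 1) G * ((n : ℝ) + 1) := by
        rw [h1, h2]
        refine Finset.sum_congr rfl fun p hp => ?_
        rw [ih p.2 (by have := Finset.HasAntidiagonal.mem_antidiagonal.1 hp; omega)]
      exact mul_right_cancel₀ (by positivity) this

end GaussPoisson

end

noncomputable section

namespace GaussPoisson

/-! ### Polarization -/

section Polarization

open Classical Equiv Finset

variable {α A : Type*} [Fintype α] [CommRing A] [Algebra ℝ A]

/-- Exactly one class contains `i`. As a function of the entry at `i`, the product is therefore one
linear factor times a constant. -/
lemma exists_setoidProd_update_eq (w : A →ₗ[ℝ] ℝ) (r : Setoid α) (a : α → A) (i : α) :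
    ∃ (p : A) (c : ℝ), ∀ x, setoidProd w r (Function.update a i x) = w (x * p) * c := by
  refine ⟨∏ j ∈ (univ.filter fun j => Quotient.mk r j = Quotient.mk r i).erase i, a j,
    ∏ q ∈ univ.erase (Quotient.mk r i), w (∏ j with Quotient.mk r j = q, a j), fun x => ?_⟩
  unfold setoidProd
  rw [← Finset.mul_prod_erase univ _ (mem_univ (Quotient.mk r i))]
  congr 1
  · rw [← Finset.mul_prod_erase _ _ (show i ∈ univ.filter fun j => Quotient.mk r j = Quotient.mk r i
      by simp), Function.update_self]
    congr 2
    exact Finset.prod_congr rfl fun j hj => Function.update_of_ne (Finset.ne_of_mem_erase hj) _ _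
  · refine Finset.prod_congr rfl fun q hq => ?_
    congr 1
    refine Finset.prod_congr rfl fun j hj => Function.update_of_ne ?_ _ _
    rintro rfl
    exact Finset.ne_of_mem_erase hq (Finset.mem_filter.1 hj).2.symm

/-- For a linear weight the sum over permutations is multilinear. -/
def cycleSumMultilinear [DecidableEq α] (w : A →ₗ[ℝ] ℝ) : MultilinearMap ℝ (fun _ : α => A) ℝ :=
  MultilinearMap.mk' (cycleSum w)
    (fun a i x y => by
      simp only [cycleSum]
      rw [← Finset.sum_add_distrib]
      refine Finset.sum_congr rfl fun g _ => ?_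
      obtain ⟨p, c, h⟩ := exists_setoidProd_update_eq w (Perm.SameCycle.setoid g) a i
      -- The second equation is projected away; `convert` and `congr!` only match the decidability
      -- instances inside `Function.update`.
      convert congrArg₂ (fun u v : ℝ => u) (h (x + y)) (h x) using 1
      · congr!
      · have hx := h x
        have hy := h y
        rw [add_mul, map_add, add_mul, ← hx, ← hy]
        congr!)
    (fun a i t x => by
      simp only [cycleSum]
      rw [Finset.smul_sum]
      refine Finset.sum_congr rfl fun g _ => ?_
      obtain ⟨p, c, h⟩ := exists_setoidProd_update_eq w (Perm.SameCycle.setoid g) a i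
      convert congrArg₂ (fun u v : ℝ => u) (h (t • x)) (h x) using 1
      · congr!
      · rw [smul_mul_assoc, map_smul, smul_mul_assoc, ← h x]
        congr!)

/-- Inclusion-exclusion: the admissible `R` are the subsets of the complement of the range of `φ`,
and their signed count vanishes unless this complement is empty. -/
lemma sum_finset_neg_one_pow_card_of_forall_mem_compl (n : ℕ) (φ : Fin n → Fin n) :
    ∑ R : Finset (Fin n), (if ∀ k, φ k ∈ Rᶜ then (-1 : ℝ) ^ #R else 0) =
      if Function.Bijective φ then 1 else 0 := by
  have h1 : ∀ R : Finset (Fin n), (∀ k, φ k ∈ Rᶜ) ↔ R ∈ ((univ.image φ)ᶜ).powerset := by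
    intro R
    rw [Finset.mem_powerset, Finset.subset_iff]
    simp only [mem_compl, mem_image, mem_univ, true_and]
    constructor
    · rintro h x hx ⟨k, rfl⟩
      exact h k hx
    · exact fun h k hk => h hk ⟨k, rfl⟩
  simp only [h1]
  rw [← Finset.sum_filter, Finset.filter_mem_eq_inter, Finset.univ_inter]
  have h2 := Finset.sum_powerset_neg_one_pow_card (x := (univ.image φ)ᶜ)
  have h3 := congrArg (fun z : ℤ => (z : ℝ)) h2
  simp only [Int.cast_sum, Int.cast_pow, Int.cast_neg, Int.cast_one] at h3
  rw [h3]
  have h4 : (univ.image φ)ᶜ = ∅ ↔ Function.Bijective φ := by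
    rw [Finset.compl_eq_empty_iff, ← Finite.surjective_iff_bijective, Finset.eq_univ_iff_forall]
    simp [Function.Surjective]
  simp only [h4]
  split_ifs <;> simp

/-- Polarization of the sum over permutations. -/
lemma sum_neg_one_pow_mul_cycleSum (n : ℕ) (w : A →ₗ[ℝ] ℝ) (a : Fin n → A) :
    ∑ R : Finset (Fin n), (-1 : ℝ) ^ #R * cycleSum w (fun _ : Fin n => ∑ i ∈ Rᶜ, a i) =
      n.factorial * cycleSum w a := by
  have h1 : ∀ R : Finset (Fin n), cycleSum w (fun _ : Fin n => ∑ i ∈ Rᶜ, a i) =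
      ∑ φ : Fin n → Fin n, if ∀ k, φ k ∈ Rᶜ then cycleSum w (fun k => a (φ k)) else 0 := by
    intro R
    have := (cycleSumMultilinear (α := Fin n) w).map_sum_finset (fun _ i => a i) (fun _ => Rᶜ)
    rw [← Finset.sum_filter]
    refine this.trans (Finset.sum_congr ?_ fun _ _ => rfl)
    ext φ
    simp
  simp only [h1, Finset.mul_sum]
  rw [Finset.sum_comm]
  -- Only bijective `φ` survive the signed sum. Each is a relabelling, so it contributes the same
  -- cycle sum, and there are `n!` of them.
  have h2 : ∀ φ : Fin n → Fin n, ∑ R : Finset (Fin n), (-1 : ℝ) ^ #R *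
      (if ∀ k, φ k ∈ Rᶜ then cycleSum w (fun k => a (φ k)) else 0) =
      if Function.Bijective φ then cycleSum w a else 0 := by
    intro φ
    have := sum_finset_neg_one_pow_card_of_forall_mem_compl n φ
    trans (if Function.Bijective φ then 1 else 0) * cycleSum w (fun k => a (φ k))
    · rw [← this, Finset.sum_mul]
      refine Finset.sum_congr rfl fun R _ => ?_
      split_ifs <;> simp
    · split_ifs with h
      · rw [one_mul]
        exact cycleSum_comp_equiv w (Equiv.ofBijective φ h) a
      · simp
  simp only [h2]
  rw [← Finset.sum_filter, Finset.sum_const, nsmul_eq_mul]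
  congr 2
  rw [← Fintype.card_subtype]
  rw [Fintype.card_congr (β := Perm (Fin n))
    ⟨fun f => Equiv.ofBijective f.1 f.2, fun g => ⟨g, g.bijective⟩, fun f => rfl,
      fun g => by ext; rfl⟩, Fintype.card_perm, Fintype.card_fin]

end Polarization

/-! ### Cycle factors -/

section CycleFactors

open Classical Equiv Finset

variable {n : ℕ} {A : Type*} [CommMonoid A]

/-- The orbits of `g` are the singletons of its fixed points and the supports of its cycle factors;
an orbit of the second kind corresponds to `cycleOf` of any representative. -/
lemma setoidProd_sameCycle (w : A → ℝ) (g : Perm (Fin n)) (a : Fin n → A) :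
    setoidProd w (Perm.SameCycle.setoid g) a =
      (∏ i ∈ fixedPts g, w (a i)) *
        ∏ c ∈ g.cycleFactorsFinset, w (∏ i ∈ c.support, a i) := by
  let r := Perm.SameCycle.setoid g
  have hr : ∀ x y, Quotient.mk r x = Quotient.mk r y ↔ Perm.SameCycle g x y :=
    fun x y => Quotient.eq
  unfold setoidProd
  rw [← Finset.prod_filter_mul_prod_filter_not univ
    (fun q : Quotient r => ∃ i ∈ fixedPts g, Quotient.mk r i = q)]
  have hfix : ∀ i ∈ fixedPts g, ∀ x, Quotient.mk r x = Quotient.mk r i ↔ x = i := by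
    intro i hi x
    simp only [fixedPts, mem_filter, mem_univ, true_and] at hi
    rw [hr]
    constructor
    · intro h
      obtain ⟨m, hm⟩ := h.symm
      rw [← hm]
      exact (Perm.zpow_apply_eq_self_of_apply_eq_self hi m)
    · rintro rfl; exact Perm.SameCycle.refl g x
  congr 1
  · symm
    refine Finset.prod_bij (fun i _ => Quotient.mk r i) (fun i hi => ?_) (fun i hi j hj hij => ?_)
      (fun q hq => ?_) (fun i hi => ?_)
    · simpa using ⟨i, hi, rfl⟩
    · exact (hfix j hj i).1 hij
    · simpa using hq
    · congr 1
      have : (univ.filter fun x => Quotient.mk r x = Quotient.mk r i) = {i} := by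
        ext x; simp [hfix i hi x]
      rw [this, Finset.prod_singleton]
  · have hout : ∀ q : Quotient r, q ∈ univ.filter (fun q => ¬∃ i ∈ fixedPts g, Quotient.mk r i = q) →
        g q.out ≠ q.out := by
      intro q hq hfixq
      simp only [mem_filter, mem_univ, true_and, not_exists, not_and] at hq
      exact hq q.out (by simpa [fixedPts] using hfixq) (Quotient.out_eq q)
    refine Finset.prod_bij (fun q _ => g.cycleOf q.out) (fun q hq => ?_)
      (fun q hq q' hq' h => ?_) (fun c hc => ?_) (fun q hq => ?_)
    · exact Perm.cycleOf_mem_cycleFactorsFinset_iff.2 (Perm.mem_support.2 (hout q hq))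
    · have := (Perm.sameCycle_iff_cycleOf_eq_of_mem_support (Perm.mem_support.2 (hout q hq))
        (Perm.mem_support.2 (hout q' hq'))).2 h
      rw [← Quotient.out_eq q, ← Quotient.out_eq q']
      exact Quotient.sound this
    · obtain ⟨x, hx⟩ := (Perm.mem_cycleFactorsFinset_iff.1 hc).1.nonempty_support
      refine ⟨Quotient.mk r x, ?_, ?_⟩
      · simp only [mem_filter, mem_univ, true_and, not_exists, not_and]
        intro i hi h
        have hxi := (hfix i hi x).1 h.symm
        subst hxi
        have := Perm.mem_cycleFactorsFinset_support_le hc hx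
        simp only [fixedPts, mem_filter, mem_univ, true_and] at hi
        exact Perm.mem_support.1 this hi
      · rw [Perm.cycle_is_cycleOf hx hc]
        exact ((hr _ _).1 (Quotient.out_eq (Quotient.mk r x))).cycleOf_eq
    · congr 1
      refine Finset.prod_congr ?_ fun _ _ => rfl
      ext x
      rw [Perm.mem_support_cycleOf_iff' (hout q hq), mem_filter, ← hr, Quotient.out_eq]
      simp only [mem_univ, true_and]
      exact eq_comm

lemma cycleSum_eq_sum_fixedPts (w : A → ℝ) (a : Fin n → A) :
    cycleSum w a = ∑ g : Perm (Fin n), (∏ i ∈ fixedPts g, w (a i)) *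
      ∏ c ∈ g.cycleFactorsFinset, w (∏ i ∈ c.support, a i) :=
  Finset.sum_congr rfl fun g _ => setoidProd_sameCycle w g a

lemma two_le_card_support_of_mem_cycleFactorsFinset {g c : Perm (Fin n)}
    (hc : c ∈ g.cycleFactorsFinset) : 2 ≤ #c.support :=
  (Perm.mem_cycleFactorsFinset_iff.1 hc).1.two_le_card_support

/-- The lengths minus one sum to the size of the support minus the number of nontrivial cycles.
Adding the fixed points to both terms gives `n - numCycles g`. -/
lemma prod_neg_one_pow_card_support_sub_one (g : Perm (Fin n)) :
    ∏ c ∈ g.cycleFactorsFinset, (-1 : ℝ) ^ (#c.support - 1) = (-1) ^ (n - numCycles g) := by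
  rw [Finset.prod_pow_eq_pow_sum]
  congr 1
  have h1 : ∑ c ∈ g.cycleFactorsFinset, #c.support = #g.support := by
    rw [← Perm.sum_cycleType, Perm.cycleType_def]
    rfl
  have h2 : #(fixedPts g) + #g.support = n := by
    have := Finset.card_filter_add_card_filter_not (s := (univ : Finset (Fin n)))
      (fun i => g i = i)
    simpa [fixedPts, Perm.support] using this
  have h3 : ∑ c ∈ g.cycleFactorsFinset, (#c.support - 1) + #g.cycleFactorsFinset =
      #g.support := by
    rw [← h1, Finset.card_eq_sum_ones, ← Finset.sum_add_distrib]
    refine Finset.sum_congr rfl fun c hc => ?_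
    have := two_le_card_support_of_mem_cycleFactorsFinset hc
    omega
  unfold numCycles
  omega

/-- The sign of the permutation is distributed over its cycles and absorbed into the weight, which
brings the Charlier sum into the form of a cycle sum. -/
lemma cycleSum_eq_of_sign (w : A → ℝ) (a : Fin n → A) (L : Fin n → ℝ) (S : Finset (Fin n) → ℝ)
    (hL : ∀ i, w (a i) = L i)
    (hS : ∀ B : Finset (Fin n), 2 ≤ #B → w (∏ i ∈ B, a i) = (-1) ^ (#B - 1) * S B) :
    cycleSum w a = ∑ g : Perm (Fin n), (-1) ^ (n - numCycles g) * (∏ i ∈ fixedPts g, L i) *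
      ∏ c ∈ g.cycleFactorsFinset, S c.support := by
  rw [cycleSum_eq_sum_fixedPts]
  refine Finset.sum_congr rfl fun g _ => ?_
  rw [Finset.prod_congr rfl fun i _ => hL i, Finset.prod_congr rfl fun c hc =>
    hS _ (two_le_card_support_of_mem_cycleFactorsFinset hc), Finset.prod_mul_distrib,
    prod_neg_one_pow_card_support_sub_one]
  ring

/-- Every nontrivial cycle of an involution is a transposition, indexed once by its smaller element.
-/
lemma prod_cycleFactorsFinset_of_mul_self_eq_one {g : Perm (Fin n)} (hg : g * g = 1)
    (F : Finset (Fin n) → ℝ) :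
    ∏ c ∈ g.cycleFactorsFinset, F c.support = ∏ j : Fin n with j < g j, F {j, g j} := by
  have hgg : ∀ x, g (g x) = x := fun x => by
    rw [← Perm.mul_apply, hg, Perm.one_apply]
  have hsame : ∀ x y, Perm.SameCycle g x y ↔ y = x ∨ y = g x := by
    intro x y
    constructor
    · rintro h
      obtain ⟨m, rfl⟩ := h.exists_nat_pow_eq
      clear h
      induction m with
      | zero => simp
      | succ m ih =>
        rw [pow_succ', Perm.mul_apply]
        rcases ih with h | h <;> rw [h]
        · exact Or.inr rfl
        · exact Or.inl (hgg x)
    · rintro (rfl | rfl)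
      · exact Perm.SameCycle.refl g y
      · exact (Perm.SameCycle.refl g x).apply_right
  have hsupp : ∀ x, g x ≠ x → (g.cycleOf x).support = {x, g x} := by
    intro x hx
    ext y
    rw [Perm.mem_support_cycleOf_iff' hx, hsame]
    simp
  symm
  refine Finset.prod_bij (fun j _ => g.cycleOf j) (fun j hj => ?_) (fun j hj k hk h => ?_)
    (fun c hc => ?_) (fun j hj => ?_)
  · simp only [mem_filter, mem_univ, true_and] at hj
    exact Perm.cycleOf_mem_cycleFactorsFinset_iff.2 (Perm.mem_support.2 hj.ne')
  · simp only [mem_filter, mem_univ, true_and] at hj hk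
    have := (Perm.sameCycle_iff_cycleOf_eq_of_mem_support (Perm.mem_support.2 hj.ne')
      (Perm.mem_support.2 hk.ne')).2 h
    rcases (hsame j k).1 this with h | h
    · exact h.symm
    · rw [h, hgg] at hk
      exact absurd hj (not_lt.2 hk.le)
  · obtain ⟨x, hx⟩ := (Perm.mem_cycleFactorsFinset_iff.1 hc).1.nonempty_support
    have hx' : g x ≠ x := Perm.mem_support.1 (Perm.mem_cycleFactorsFinset_support_le hc hx)
    rcases lt_or_gt_of_ne hx' with h | h
    · refine ⟨g x, by simpa [hgg] using h, ?_⟩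
      rw [Perm.cycle_is_cycleOf hx hc]
      exact ((hsame (g x) x).2 (Or.inr (hgg x).symm)).cycleOf_eq
    · exact ⟨x, by simpa using h, (Perm.cycle_is_cycleOf hx hc).symm⟩
  · simp only [mem_filter, mem_univ, true_and] at hj
    rw [hsupp j hj.ne']

/-- A weight that kills products of three or more factors kills every permutation with a cycle of
that length. Only involutions remain. -/
lemma cycleSum_eq_of_involutions (w : A → ℝ) (a : Fin n → A) (L : Fin n → ℝ)
    (G : Fin n → Fin n → ℝ) (hL : ∀ i, w (a i) = L i)
    (hG : ∀ i j, i ≠ j → w (a i * a j) = -G i j)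
    (h3 : ∀ B : Finset (Fin n), 3 ≤ #B → w (∏ i ∈ B, a i) = 0) :
    cycleSum w a = ∑ g : Perm (Fin n) with g * g = 1, (∏ i ∈ fixedPts g, L i) *
      ∏ j : Fin n with j < g j, (-G j (g j)) := by
  rw [cycleSum_eq_sum_fixedPts, ← Finset.sum_filter_add_sum_filter_not univ
    (fun g : Perm (Fin n) => g * g = 1)]
  rw [Finset.sum_eq_zero (s := univ.filter fun g : Perm (Fin n) => ¬ g * g = 1), add_zero]
  · refine Finset.sum_congr rfl fun g hg => ?_
    simp only [mem_filter, mem_univ, true_and] at hg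
    rw [Finset.prod_congr rfl fun i _ => hL i,
      prod_cycleFactorsFinset_of_mul_self_eq_one hg (fun B => w (∏ i ∈ B, a i))]
    congr 1
    refine Finset.prod_congr rfl fun j hj => ?_
    simp only [mem_filter, mem_univ, true_and] at hj
    rw [Finset.prod_pair hj.ne, hG _ _ hj.ne]
  · intro g hg
    simp only [mem_filter, mem_univ, true_and] at hg
    obtain ⟨x, hx⟩ : ∃ x, g (g x) ≠ x := by
      by_contra! h
      exact hg (Perm.ext h)
    have hx1 : g x ≠ x := fun h => hx (by rw [h, h])
    refine mul_eq_zero_of_right _ (Finset.prod_eq_zero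
      (Perm.cycleOf_mem_cycleFactorsFinset_iff.2 (Perm.mem_support.2 hx1)) (h3 _ ?_))
    have hsub : ({x, g x, g (g x)} : Finset (Fin n)) ⊆ (g.cycleOf x).support := by
      intro y hy
      rw [Perm.mem_support_cycleOf_iff' hx1]
      simp only [mem_insert, mem_singleton] at hy
      rcases hy with rfl | rfl | rfl
      · exact Perm.SameCycle.refl g _
      · exact (Perm.SameCycle.refl g x).apply_right
      · exact (Perm.SameCycle.refl g x).apply_right.apply_right
    refine le_trans (le_of_eq ?_) (Finset.card_le_card hsub)
    rw [Finset.card_eq_three.2 ⟨x, g x, g (g x), hx1.symm, hx.symm, fun h => hx1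
      (g.injective h).symm, rfl⟩]

end CycleFactors

end GaussPoisson

end

noncomputable section

namespace GaussPoisson

/-! ### Everywhere convergent power series -/

section PowerSeries

/-- The power series `C` converges everywhere, with sum `G`. -/
def SumsTo (C : PowerSeries ℝ) (G : ℝ → ℝ) : Prop :=
  ∀ t, HasSum (fun n => PowerSeries.coeff n C * t ^ n) (G t)

lemma hasSum_of_eq {f g : ℕ → ℝ} {a b : ℝ} (h : HasSum f a) (hfg : ∀ n, g n = f n) (hab : b = a) :
    HasSum g b := by
  rw [funext hfg, hab]
  exact h

/-- Summability of real series is absolute, so the Cauchy product applies at every `t`. -/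
lemma SumsTo.mul {C D : PowerSeries ℝ} {G H : ℝ → ℝ} (hC : SumsTo C G) (hD : SumsTo D H) :
    SumsTo (C * D) (fun t => G t * H t) := by
  intro t
  have h1 := (hC t).summable.norm
  have h2 := (hD t).summable.norm
  have h3 := summable_norm_sum_mul_antidiagonal_of_summable_norm h1 h2
  have h4 := tsum_mul_tsum_eq_tsum_sum_antidiagonal_of_summable_norm h1 h2
  rw [(hC t).tsum_eq, (hD t).tsum_eq] at h4
  have h5 := h3.of_norm.hasSum
  rw [← h4] at h5
  refine hasSum_of_eq h5 (fun n => ?_) rfl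
  rw [PowerSeries.coeff_mul, Finset.sum_mul]
  refine Finset.sum_congr rfl fun p hp => ?_
  rw [← Finset.HasAntidiagonal.mem_antidiagonal.1 hp, pow_add]
  ring

lemma sumsTo_one : SumsTo 1 (fun _ => 1) := by
  intro t
  convert hasSum_single (f := fun n => PowerSeries.coeff n (1 : PowerSeries ℝ) * t ^ n) 0 ?_ using 1
  · simp
  · intro n hn
    simp [PowerSeries.coeff_one, hn]

lemma SumsTo.pow {C : PowerSeries ℝ} {G : ℝ → ℝ} (hC : SumsTo C G) (m : ℕ) :
    SumsTo (C ^ m) (fun t => G t ^ m) := by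
  induction m with
  | zero => simpa using sumsTo_one
  | succ m ih =>
    simp only [pow_succ]
    exact ih.mul hC

lemma SumsTo.prod {ι : Type*} (Z : Finset ι) {C : ι → PowerSeries ℝ} {G : ι → ℝ → ℝ}
    (hC : ∀ i, SumsTo (C i) (G i)) : SumsTo (∏ i ∈ Z, C i) (fun t => ∏ i ∈ Z, G i t) := by
  classical
  induction Z using Finset.induction_on with
  | empty => simpa using sumsTo_one
  | insert i Z hi ih =>
    simp only [Finset.prod_insert hi]
    exact (hC i).mul ih

/-- The exponential series of `t ↦ exp (c t)`. -/
def expSeries (c : ℝ) : PowerSeries ℝ := PowerSeries.mk fun n => c ^ n / n.factorial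

lemma sumsTo_expSeries (c : ℝ) : SumsTo (expSeries c) (fun t => Real.exp (c * t)) := by
  intro t
  have := NormedSpace.expSeries_div_hasSum_exp (c * t)
  rw [← Real.exp_eq_exp_ℝ] at this
  refine hasSum_of_eq this (fun n => ?_) rfl
  rw [expSeries, PowerSeries.coeff_mk, mul_pow]
  ring

lemma derivative_expSeries (c : ℝ) :
    PowerSeries.derivative ℝ (expSeries c) = PowerSeries.C c * expSeries c := by
  ext n
  rw [PowerSeries.coeff_derivative, PowerSeries.coeff_C_mul]
  simp only [expSeries, PowerSeries.coeff_mk, Nat.factorial_succ]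
  push_cast
  field_simp
  ring

/-- The power series of `t ↦ exp (y t² / 2)`. -/
def quadExpSeries (y : ℝ) : PowerSeries ℝ :=
  PowerSeries.mk fun n => if Even n then (y / 2) ^ (n / 2) / (n / 2).factorial else 0

lemma sumsTo_quadExpSeries (y : ℝ) :
    SumsTo (quadExpSeries y) (fun t => Real.exp (y * t ^ 2 / 2)) := by
  intro t
  have h := NormedSpace.expSeries_div_hasSum_exp (y * t ^ 2 / 2)
  rw [← Real.exp_eq_exp_ℝ] at h
  have hinj : Function.Injective (fun n : ℕ => 2 * n) := fun a b hab => by simpa using hab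
  rw [← hinj.hasSum_iff]
  · refine hasSum_of_eq h (fun n => ?_) rfl
    simp only [quadExpSeries, PowerSeries.coeff_mk, Function.comp]
    rw [if_pos (even_two_mul n), Nat.mul_div_cancel_left _ two_pos, pow_mul, div_pow, div_pow,
      mul_pow]
    ring
  · intro n hn
    simp only [quadExpSeries, PowerSeries.coeff_mk]
    rw [if_neg, zero_mul]
    rintro ⟨k, rfl⟩
    exact hn ⟨k, by ring⟩

lemma derivative_quadExpSeries (y : ℝ) :
    PowerSeries.derivative ℝ (quadExpSeries y) =
      (PowerSeries.C y * PowerSeries.X) * quadExpSeries y := by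
  ext n
  rw [PowerSeries.coeff_derivative, mul_assoc, PowerSeries.coeff_C_mul]
  cases n with
  | zero => simp [quadExpSeries]
  | succ n =>
    rw [PowerSeries.coeff_succ_X_mul]
    simp only [quadExpSeries, PowerSeries.coeff_mk]
    by_cases h : Even n
    · obtain ⟨k, rfl⟩ := h
      rw [if_pos (by grind), if_pos (by grind), show (k + k + 1 + 1) / 2 = k + 1 by omega,
        show (k + k) / 2 = k by omega, Nat.factorial_succ]
      push_cast
      field_simp
      ring
    · rw [if_neg (by grind), if_neg h]
      simp

lemma coeff_zero_expSeries (c : ℝ) : PowerSeries.coeff 0 (expSeries c) = 1 := by simp [expSeries]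

lemma coeff_zero_quadExpSeries (c : ℝ) : PowerSeries.coeff 0 (quadExpSeries c) = 1 := by
  simp [quadExpSeries]

lemma coeff_zero_cycleSeries {A : Type*} [CommMonoid A] (w : A → ℝ) (a : A) :
    PowerSeries.coeff 0 (cycleSeries w a) = 1 := by
  simp [cycleSeries, cycleSum_of_isEmpty]

lemma derivative_mul_of_derivative_eq {F G V W : PowerSeries ℝ}
    (hF : PowerSeries.derivative ℝ F = V * F) (hG : PowerSeries.derivative ℝ G = W * G) :
    PowerSeries.derivative ℝ (F * G) = (V + W) * (F * G) := by
  rw [Derivation.leibniz, hF, hG, smul_eq_mul, smul_eq_mul]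
  ring

end PowerSeries

/-! ### Hermite functionals of numbers -/

section HermiteSum

open Finset

/-- The Hermite functional as a function of the values of the process and the inner products. -/
def hermiteSum {n : ℕ} (L : Fin n → ℝ) (G : Fin n → Fin n → ℝ) : ℝ :=
  ∑ g : Equiv.Perm (Fin n) with g * g = 1, (∏ i ∈ fixedPts g, L i) *
    ∏ j : Fin n with j < g j, (-G j (g j))

/-- The coefficients of `exp (x t - v t² / 2)`. -/
def hermiteCoeff (x v : ℝ) (n : ℕ) : ℝ :=
  PowerSeries.coeff n (expSeries x * quadExpSeries (-v))

/-- The weight reads off the first two coefficients of a polynomial, so on powers of the variable it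
is `x`, `-v`, then zero. The generating series has logarithmic derivative `x - v t`, as does `exp (x
t - v t² / 2)`. -/
lemma hermiteSum_const (x v : ℝ) (n : ℕ) :
    hermiteSum (fun _ : Fin n => x) (fun _ _ => v) / n.factorial = hermiteCoeff x v n := by
  let w : Polynomial ℝ → ℝ := fun p => x * p.coeff 1 - v * p.coeff 2
  have hw : ∀ k, w (Polynomial.X ^ k) = x * (if 1 = k then 1 else 0) -
      v * (if 2 = k then 1 else 0) := fun k => by
    simp only [w, Polynomial.coeff_X_pow]
  have h1 : cycleSum w (fun _ : Fin n => Polynomial.X) =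
      hermiteSum (fun _ : Fin n => x) (fun _ _ => v) := by
    refine cycleSum_eq_of_involutions w _ (fun _ => x) (fun _ _ => v) (fun i => ?_)
      (fun i j _ => ?_) (fun B hB => ?_)
    · simpa using hw 1
    · simpa [pow_two] using hw 2
    · rw [Finset.prod_const, hw, if_neg (by omega), if_neg (by omega)]
      simp
  have h2 : cycleSeries w Polynomial.X = expSeries x * quadExpSeries (-v) := by
    refine powerSeries_eq_of_derivative_eq_mul (W := PowerSeries.C x +
      PowerSeries.C (-v) * PowerSeries.X) ?_ ?_ ?_
    · rw [coeff_zero_cycleSeries, PowerSeries.coeff_mul, Finset.Nat.antidiagonal_zero,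
        Finset.sum_singleton, coeff_zero_expSeries,
        coeff_zero_quadExpSeries, one_mul]
    · rw [derivative_cycleSeries]
      congr 1
      ext k
      rw [PowerSeries.coeff_mk, hw, map_add, PowerSeries.coeff_C_mul, PowerSeries.coeff_C,
        PowerSeries.coeff_X]
      rcases k with _ | _ | k <;> simp
    · exact derivative_mul_of_derivative_eq (derivative_expSeries x) (derivative_quadExpSeries _)
  rw [hermiteCoeff, ← h2, cycleSeries, PowerSeries.coeff_mk, h1]

lemma hasSum_hermiteCoeff (x v t : ℝ) :
    HasSum (fun n => hermiteCoeff x v n * t ^ n) (Real.exp (x * t - v * t ^ 2 / 2)) := by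
  have := ((sumsTo_expSeries x).mul (sumsTo_quadExpSeries (-v))) t
  refine hasSum_of_eq this (fun n => rfl) ?_
  simp only [← Real.exp_add]
  congr 1
  ring

/-- The coefficients of `exp (|x| t + v t² / 2)`. -/
def hermiteBound (x v : ℝ) (n : ℕ) : ℝ :=
  PowerSeries.coeff n (expSeries |x| * quadExpSeries v)

lemma hasSum_hermiteBound (x v t : ℝ) :
    HasSum (fun n => hermiteBound x v n * t ^ n) (Real.exp (|x| * t + v * t ^ 2 / 2)) := by
  have := ((sumsTo_expSeries |x|).mul (sumsTo_quadExpSeries v)) t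
  exact hasSum_of_eq this (fun n => rfl) (Real.exp_add _ _)

/-- Taking absolute values in each factor of the Cauchy product turns the series into one with
nonnegative coefficients. -/
lemma abs_hermiteCoeff_le {x v : ℝ} (hv : 0 ≤ v) (n : ℕ) :
    |hermiteCoeff x v n| ≤ hermiteBound x v n := by
  rw [hermiteCoeff, hermiteBound, PowerSeries.coeff_mul, PowerSeries.coeff_mul]
  refine (Finset.abs_sum_le_sum_abs _ _).trans (Finset.sum_le_sum fun p _ => ?_)
  rw [abs_mul]
  refine mul_le_mul (le_of_eq ?_) (le_of_eq ?_) (abs_nonneg _) ?_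
  · simp [expSeries, abs_div, abs_pow]
  · simp only [quadExpSeries, PowerSeries.coeff_mk]
    split_ifs
    · rw [abs_div, abs_pow, abs_div, abs_neg, abs_of_nonneg hv]
      simp
    · simp
  · simp only [expSeries, PowerSeries.coeff_mk]
    positivity

/-- The weight on polynomials that gives the Hermite functional. -/
def hermiteWeight {n : ℕ} (L : Fin n → ℝ) (G : Fin n → Fin n → ℝ) :
    MvPolynomial (Fin n) ℝ →ₗ[ℝ] ℝ :=
  ∑ i, L i • ((MvPolynomial.lcoeff ℝ 0) ∘ₗ (MvPolynomial.pderiv i).toLinearMap) -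
    ∑ i, ∑ j, (G i j / 2) • ((MvPolynomial.lcoeff ℝ 0) ∘ₗ (MvPolynomial.pderiv i).toLinearMap ∘ₗ
      (MvPolynomial.pderiv j).toLinearMap)

lemma hermiteWeight_apply {n : ℕ} (L : Fin n → ℝ) (G : Fin n → Fin n → ℝ)
    (p : MvPolynomial (Fin n) ℝ) : hermiteWeight L G p =
      ∑ i, L i * (MvPolynomial.pderiv i p).coeff 0 -
        ∑ i, ∑ j, G i j / 2 * (MvPolynomial.pderiv i (MvPolynomial.pderiv j p)).coeff 0 := by
  simp [hermiteWeight]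

lemma pderiv_X_eq_C {n : ℕ} (i j : Fin n) :
    MvPolynomial.pderiv i (MvPolynomial.X j : MvPolynomial (Fin n) ℝ) =
      MvPolynomial.C ((1 : Matrix (Fin n) (Fin n) ℝ) j i) := by
  rw [MvPolynomial.pderiv_X, Pi.single_apply, Matrix.one_apply]
  split_ifs <;> simp_all

lemma hermiteWeight_X {n : ℕ} (L : Fin n → ℝ) (G : Fin n → Fin n → ℝ) (i : Fin n) :
    hermiteWeight L G (MvPolynomial.X i) = L i := by
  simp only [hermiteWeight_apply, pderiv_X_eq_C, MvPolynomial.pderiv_C, MvPolynomial.coeff_zero,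
    MvPolynomial.coeff_C, if_true, mul_zero, Finset.sum_const_zero, sub_zero]
  simp [Matrix.one_apply]

/-- The mixed second derivative is counted in both orders; symmetry of `G` and the factor one half
combine the two. -/
lemma hermiteWeight_X_mul_X {n : ℕ} (L : Fin n → ℝ) (G : Fin n → Fin n → ℝ)
    (hG : ∀ i j, G i j = G j i) (i j : Fin n) :
    hermiteWeight L G (MvPolynomial.X i * MvPolynomial.X j) = -G i j := by
  have h1 : ∀ x, MvPolynomial.pderiv x (MvPolynomial.X i * MvPolynomial.X j :
      MvPolynomial (Fin n) ℝ) = MvPolynomial.C ((1 : Matrix (Fin n) (Fin n) ℝ) j x) * MvPolynomial.X i +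
      MvPolynomial.C ((1 : Matrix (Fin n) (Fin n) ℝ) i x) * MvPolynomial.X j := by
    intro x
    rw [Derivation.leibniz, pderiv_X_eq_C, pderiv_X_eq_C, smul_eq_mul, smul_eq_mul]
    ring
  have h2 : ∀ y x, (MvPolynomial.pderiv y (MvPolynomial.pderiv x
      (MvPolynomial.X i * MvPolynomial.X j : MvPolynomial (Fin n) ℝ))).coeff 0 =
      (1 : Matrix (Fin n) (Fin n) ℝ) j x * (1 : Matrix (Fin n) (Fin n) ℝ) i y +
        (1 : Matrix (Fin n) (Fin n) ℝ) i x * (1 : Matrix (Fin n) (Fin n) ℝ) j y := by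
    intro y x
    rw [h1, map_add, MvPolynomial.pderiv_C_mul, MvPolynomial.pderiv_C_mul, pderiv_X_eq_C,
      pderiv_X_eq_C]
    simp
  have h3 : ∀ x, (MvPolynomial.pderiv x
      (MvPolynomial.X i * MvPolynomial.X j : MvPolynomial (Fin n) ℝ)).coeff 0 = 0 := by
    intro x
    rw [h1, MvPolynomial.coeff_add, MvPolynomial.coeff_C_mul, MvPolynomial.coeff_C_mul,
      MvPolynomial.coeff_zero_X, MvPolynomial.coeff_zero_X]
    simp
  rw [hermiteWeight_apply]
  simp only [h2, h3, mul_zero, Finset.sum_const_zero, zero_sub, mul_add, Finset.sum_add_distrib]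
  have h4 : ∀ a b : Fin n, ∑ y, ∑ x, G y x / 2 * ((1 : Matrix (Fin n) (Fin n) ℝ) a x * (1 : Matrix (Fin n) (Fin n) ℝ) b y) =
      G b a / 2 := by
    intro a b
    rw [Finset.sum_eq_single b, Finset.sum_eq_single a] <;> simp +contextual [Matrix.one_apply, eq_comm]
  rw [h4, h4, hG j i]
  ring

/-- The weight only involves derivatives at zero of order one and two, which vanish on forms of
degree at least three. -/
lemma hermiteWeight_of_isHomogeneous {n : ℕ} (L : Fin n → ℝ) (G : Fin n → Fin n → ℝ) {k : ℕ}
    (hk : 3 ≤ k) {p : MvPolynomial (Fin n) ℝ} (hp : p.IsHomogeneous k) :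
    hermiteWeight L G p = 0 := by
  rw [hermiteWeight_apply]
  have h0 : ∀ {q : MvPolynomial (Fin n) ℝ} {m : ℕ}, q.IsHomogeneous m → m ≠ 0 → q.coeff 0 = 0 :=
    fun hq hm => hq.coeff_eq_zero (by simpa using hm.symm)
  rw [Finset.sum_eq_zero, Finset.sum_eq_zero, sub_zero]
  · intro i _
    refine Finset.sum_eq_zero fun j _ => ?_
    rw [h0 (hp.pderiv.pderiv) (by omega), mul_zero]
  · intro i _
    rw [h0 hp.pderiv (by omega), mul_zero]

/-- Polarization of the Hermite functional. -/
lemma sum_neg_one_pow_mul_hermiteSum {n : ℕ} (L : Fin n → ℝ) (G : Fin n → Fin n → ℝ)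
    (hG : ∀ i j, G i j = G j i) :
    ∑ R : Finset (Fin n), (-1 : ℝ) ^ #R * hermiteSum (fun _ : Fin n => ∑ i ∈ Rᶜ, L i)
      (fun _ _ => ∑ i ∈ Rᶜ, ∑ j ∈ Rᶜ, G i j) = n.factorial * hermiteSum L G := by
  have h := sum_neg_one_pow_mul_cycleSum n (hermiteWeight L G) MvPolynomial.X
  have hX : ∀ i : Fin n, (MvPolynomial.X i : MvPolynomial (Fin n) ℝ).IsHomogeneous 1 :=
    fun i => MvPolynomial.isHomogeneous_X ℝ i
  have h0 : cycleSum (hermiteWeight L G) MvPolynomial.X = hermiteSum L G := by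
    refine cycleSum_eq_of_involutions (hermiteWeight L G) MvPolynomial.X L G
      (fun i => hermiteWeight_X L G i) (fun i j _ => hermiteWeight_X_mul_X L G hG i j)
      (fun B hB => hermiteWeight_of_isHomogeneous L G hB ?_)
    simpa using MvPolynomial.IsHomogeneous.prod B MvPolynomial.X (fun _ => 1) (fun i _ => hX i)
  · rw [← h0, ← h]
    refine Finset.sum_congr rfl fun R _ => ?_
    congr 1
    symm
    refine cycleSum_eq_of_involutions (hermiteWeight L G)
      (fun _ => ∑ i ∈ Rᶜ, MvPolynomial.X i) (fun _ => ∑ i ∈ Rᶜ, L i)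
      (fun _ _ => ∑ i ∈ Rᶜ, ∑ j ∈ Rᶜ, G i j) (fun i => ?_) (fun i j _ => ?_) (fun B hB => ?_)
    · simp [map_sum, hermiteWeight_X]
    · rw [Finset.sum_mul_sum, map_sum, ← Finset.sum_neg_distrib]
      refine Finset.sum_congr rfl fun i _ => ?_
      rw [map_sum, ← Finset.sum_neg_distrib]
      exact Finset.sum_congr rfl fun j _ => hermiteWeight_X_mul_X L G hG i j
    · refine hermiteWeight_of_isHomogeneous L G hB ?_
      have := MvPolynomial.IsHomogeneous.prod B (fun _ => ∑ i ∈ Rᶜ, (MvPolynomial.X i :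
        MvPolynomial (Fin n) ℝ)) (fun _ => 1)
        (fun _ _ => MvPolynomial.IsHomogeneous.sum _ _ _ fun i _ => hX i)
      simpa using this

end HermiteSum

/-! ### Charlier functionals of finite configurations -/

section CharlierSum

open Finset

/-- The Charlier functional as a function of the linear terms and of the sums over the
configuration. -/
def charlierSum {n : ℕ} (L : Fin n → ℝ) (S : Finset (Fin n) → ℝ) : ℝ :=
  ∑ g : Equiv.Perm (Fin n), (-1) ^ (n - numCycles g) * (∏ i ∈ fixedPts g, L i) *
    ∏ c ∈ g.cycleFactorsFinset, S c.support

variable {X : Type*} (Z : Finset X) (m : X → ℕ)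

/-- The weight that gives the Charlier functional of the finite configuration `m` on `Z`. -/
def charlierWeight : (X → ℝ) × TrivSqZeroExt ℝ ℝ →ₗ[ℝ] ℝ :=
  -(∑ z ∈ Z, (m z : ℝ) • (LinearMap.proj z ∘ₗ LinearMap.fst ℝ _ _)) -
    TrivSqZeroExt.sndHom ℝ ℝ ∘ₗ LinearMap.snd ℝ _ _

lemma charlierWeight_apply (p : (X → ℝ) × TrivSqZeroExt ℝ ℝ) :
    charlierWeight Z m p = -(∑ z ∈ Z, m z * p.1 z) - p.2.snd := by
  simp [charlierWeight]

/-- The compensators are put in the square-zero part so that they act on fixed points and disappear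
from longer cycles. -/
lemma snd_prod_inr {ι : Type*} (B : Finset ι) (c : ι → ℝ) (hB : 2 ≤ #B) :
    (∏ i ∈ B, (TrivSqZeroExt.inr (c i) : TrivSqZeroExt ℝ ℝ)) = 0 := by
  classical
  obtain ⟨i, hi, j, hj, hij⟩ := Finset.one_lt_card.1 hB
  rw [← Finset.mul_prod_erase B _ hi,
    ← Finset.mul_prod_erase (B.erase i) _ (Finset.mem_erase.2 ⟨hij.symm, hj⟩), ← mul_assoc,
    TrivSqZeroExt.inr_mul_inr, zero_mul]

/-- With `-f` in the algebra and one more minus sign in the weight, a product over `B` acquires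
`(-1) ^ (#B - 1)`, the sign of a cycle of that length. -/
lemma charlierSum_eq_cycleSum {n : ℕ} (f : Fin n → X → ℝ) (c : Fin n → ℝ) :
    charlierSum (fun i => ∑ z ∈ Z, m z * f i z - c i) (fun B => ∑ z ∈ Z, m z * ∏ i ∈ B, f i z) =
      cycleSum (charlierWeight Z m) (fun i => (-f i, TrivSqZeroExt.inr (c i))) := by
  symm
  refine cycleSum_eq_of_sign (charlierWeight Z m) (fun i => (-f i, TrivSqZeroExt.inr (c i)))
    (fun i => ∑ z ∈ Z, m z * f i z - c i) (fun B => ∑ z ∈ Z, m z * ∏ i ∈ B, f i z)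
    (fun i => ?_) (fun B hB => ?_)
  · simp [charlierWeight_apply]
  · rw [charlierWeight_apply, Prod.snd_prod, snd_prod_inr B c hB]
    obtain ⟨k, hk⟩ : ∃ k, #B = k + 1 := ⟨#B - 1, by omega⟩
    simp only [Prod.fst_prod, Finset.prod_apply, Pi.neg_apply, Finset.prod_neg, hk]
    rw [TrivSqZeroExt.snd_zero, sub_zero, Nat.add_sub_cancel, Finset.mul_sum,
      ← Finset.sum_neg_distrib]
    refine Finset.sum_congr rfl fun z _ => ?_
    ring

/-- Polarization of the Charlier functional. -/
lemma sum_neg_one_pow_mul_charlierSum {n : ℕ} (f : Fin n → X → ℝ) (c : Fin n → ℝ) :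
    ∑ R : Finset (Fin n), (-1 : ℝ) ^ #R * charlierSum
      (fun _ : Fin n => ∑ z ∈ Z, m z * (∑ i ∈ Rᶜ, f i z) - ∑ i ∈ Rᶜ, c i)
      (fun B => ∑ z ∈ Z, m z * ∏ _i ∈ B, (∑ i ∈ Rᶜ, f i z)) =
    n.factorial * charlierSum (fun i => ∑ z ∈ Z, m z * f i z - c i)
      (fun B => ∑ z ∈ Z, m z * ∏ i ∈ B, f i z) := by
  rw [charlierSum_eq_cycleSum, ← sum_neg_one_pow_mul_cycleSum]
  refine Finset.sum_congr rfl fun R _ => ?_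
  congr 1
  rw [charlierSum_eq_cycleSum Z m (fun _ z => ∑ i ∈ Rᶜ, f i z) (fun _ => ∑ i ∈ Rᶜ, c i)]
  congr 1
  ext _ : 1
  refine Prod.ext ?_ ?_
  · ext z
    simp [Prod.fst_sum, Finset.sum_apply]
  · rw [Prod.snd_sum]
    exact map_sum (TrivSqZeroExt.inrHom ℝ ℝ) c Rᶜ

/-- The generating function of the Charlier functionals of a finite configuration. -/
lemma hasSum_charlierSum (f : X → ℝ) (c t : ℝ) :
    HasSum (fun n : ℕ => charlierSum (fun _ : Fin n => ∑ z ∈ Z, m z * f z - c)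
      (fun B => ∑ z ∈ Z, m z * ∏ _i ∈ B, f z) / n.factorial * t ^ n)
      ((∏ z ∈ Z, (1 + t * f z) ^ m z) * Real.exp (-(t * c))) := by
  classical
  let a : (X → ℝ) × TrivSqZeroExt ℝ ℝ := (-f, TrivSqZeroExt.inr c)
  -- `lin r` is `1 + r t` and `geo r` is its formal inverse, so the logarithmic derivative of `lin
  -- r` is `r` times `geo r`.
  let lin : ℝ → PowerSeries ℝ := fun r => 1 + PowerSeries.C r * PowerSeries.X
  let geo : ℝ → PowerSeries ℝ := fun r => PowerSeries.mk fun k => (-r) ^ k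
  have hlin : ∀ r, SumsTo (lin r) (fun t => 1 + t * r) := by
    intro r t
    have h : HasSum (fun n => PowerSeries.coeff n (lin r) * t ^ n)
        (∑ n ∈ Finset.range 2, PowerSeries.coeff n (lin r) * t ^ n) :=
      hasSum_sum_of_ne_finset_zero fun n hn => ?_
    · refine hasSum_of_eq h (fun _ => rfl) ?_
      simp [Finset.sum_range_succ, lin, PowerSeries.coeff_one, PowerSeries.coeff_X, mul_comm]
    · have hn2 : 1 < n := by simpa using hn
      simp [lin, PowerSeries.coeff_one, PowerSeries.coeff_X, show n ≠ 0 by omega,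
        show n ≠ 1 by omega]
  have hgeo : ∀ r, geo r * lin r = 1 := by
    intro r
    ext k
    simp only [lin, mul_add, mul_one, map_add]
    rw [mul_comm (PowerSeries.C r), ← mul_assoc]
    cases k with
    | zero => simp [geo]
    | succ k =>
      rw [PowerSeries.coeff_mul_C, PowerSeries.coeff_succ_mul_X]
      simp only [geo, PowerSeries.coeff_mk, PowerSeries.coeff_one]
      rw [if_neg (by omega)]
      ring
  have hder : ∀ r, PowerSeries.derivative ℝ (lin r) = (PowerSeries.C r * geo r) * lin r := by
    intro r
    rw [mul_assoc, hgeo, mul_one]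
    simp only [lin, map_add, Derivation.leibniz, PowerSeries.derivative_X, smul_eq_mul, mul_one,
      PowerSeries.derivative_C, mul_zero, add_zero, Derivation.map_one_eq_zero, zero_add]
  have hderpow : ∀ r (k : ℕ), PowerSeries.derivative ℝ (lin r ^ k) =
      (k * (PowerSeries.C r * geo r)) * lin r ^ k := by
    intro r k
    induction k with
    | zero => simp
    | succ k ih =>
      rw [pow_succ, derivative_mul_of_derivative_eq ih (hder r)]
      push_cast
      ring
  have hderprod : PowerSeries.derivative ℝ (∏ z ∈ Z, lin (f z) ^ m z) =
      (∑ z ∈ Z, m z * (PowerSeries.C (f z) * geo (f z))) * ∏ z ∈ Z, lin (f z) ^ m z := by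
    induction Z using Finset.induction_on with
    | empty => simp
    | insert z Z hz ih =>
      rw [Finset.prod_insert hz, Finset.sum_insert hz]
      exact derivative_mul_of_derivative_eq (hderpow _ _) ih
  -- Both sides have constant term one and logarithmic derivative `∑ m z f z / (1 + t f z) - c`.
  have h2 : cycleSeries (charlierWeight Z m) a =
      (∏ z ∈ Z, lin (f z) ^ m z) * expSeries (-c) := by
    refine powerSeries_eq_of_derivative_eq_mul
      (W := (∑ z ∈ Z, m z * (PowerSeries.C (f z) * geo (f z))) + PowerSeries.C (-c)) ?_ ?_ ?_
    · rw [coeff_zero_cycleSeries, PowerSeries.coeff_mul, Finset.Nat.antidiagonal_zero,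
        Finset.sum_singleton, coeff_zero_expSeries]
      simp [lin]
    · rw [derivative_cycleSeries]
      congr 1
      ext k
      rw [PowerSeries.coeff_mk, charlierWeight_apply, map_add, map_sum]
      have h3 : ∀ z, PowerSeries.coeff k ((m z : PowerSeries ℝ) *
          (PowerSeries.C (f z) * geo (f z))) = m z * (f z * (-f z) ^ k) := by
        intro z
        rw [← map_natCast (PowerSeries.C (R := ℝ)), PowerSeries.coeff_C_mul,
          PowerSeries.coeff_C_mul, PowerSeries.coeff_mk]
      simp only [h3, a, Prod.pow_fst, Prod.pow_snd, Pi.pow_apply, Pi.neg_apply]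
      rw [sub_eq_add_neg, ← Finset.sum_neg_distrib]
      congr 1
      · refine Finset.sum_congr rfl fun z _ => ?_
        ring
      · rw [PowerSeries.coeff_C]
        cases k with
        | zero => simp
        | succ k => simp [pow_succ, mul_assoc]
    · exact derivative_mul_of_derivative_eq hderprod (derivative_expSeries _)
  have h3 := ((SumsTo.prod Z fun z => (hlin (f z)).pow (m z)).mul (sumsTo_expSeries (-c))) t
  rw [← h2] at h3
  convert h3 using 2 with n
  · rw [charlierSum_eq_cycleSum Z m (fun _ : Fin n => f) (fun _ => c), cycleSeries,
      PowerSeries.coeff_mk]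
  · ring_nf

end CharlierSum

end GaussPoisson

end

noncomputable section

namespace GaussPoisson

/-! ### Unitary operators from total families with equal Gram matrices -/

section Unitary

variable {ι H₁ H₂ : Type*} [NormedAddCommGroup H₁] [InnerProductSpace ℂ H₁]
  [NormedAddCommGroup H₂] [InnerProductSpace ℂ H₂]

lemma inner_linearCombination_congr {e₁ : ι → H₁} {e₂ : ι → H₂}
    (h : ∀ i j, inner ℂ (e₁ i) (e₁ j) = inner ℂ (e₂ i) (e₂ j)) (c d : ι →₀ ℂ) :
    inner ℂ (Finsupp.linearCombination ℂ e₁ c) (Finsupp.linearCombination ℂ e₁ d) =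
      inner ℂ (Finsupp.linearCombination ℂ e₂ c) (Finsupp.linearCombination ℂ e₂ d) := by
  simp only [Finsupp.linearCombination_apply, Finsupp.sum, sum_inner, inner_sum, inner_smul_left,
    inner_smul_right, h]

/-- Equal Gram matrices make corresponding linear combinations equal in norm. The correspondence is
then well defined and isometric between dense subspaces, and extends by completeness. -/
lemma exists_unitary [CompleteSpace H₁] [CompleteSpace H₂] {e₁ : ι → H₁} {e₂ : ι → H₂}
    (h : ∀ i j, inner ℂ (e₁ i) (e₁ j) = inner ℂ (e₂ i) (e₂ j))
    (h₁ : (Submodule.span ℂ (Set.range e₁)).topologicalClosure = ⊤)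
    (h₂ : (Submodule.span ℂ (Set.range e₂)).topologicalClosure = ⊤) :
    ∃ Φ : H₁ ≃ₗᵢ[ℂ] H₂, ∀ i, Φ (e₁ i) = e₂ i := by
  have dense₁ : DenseRange (Finsupp.linearCombination ℂ e₁) := by
    rw [DenseRange, ← LinearMap.coe_range, Finsupp.range_linearCombination]
    exact Submodule.dense_iff_topologicalClosure_eq_top.2 h₁
  have dense₂ : DenseRange (Finsupp.linearCombination ℂ e₂) := by
    rw [DenseRange, ← LinearMap.coe_range, Finsupp.range_linearCombination]
    exact Submodule.dense_iff_topologicalClosure_eq_top.2 h₂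
  have hnorm : ∀ c, ‖Finsupp.linearCombination ℂ e₂ (LinearEquiv.refl ℂ (ι →₀ ℂ) c)‖ =
      ‖Finsupp.linearCombination ℂ e₁ c‖ := by
    intro c
    rw [LinearEquiv.refl_apply, norm_eq_sqrt_re_inner (𝕜 := ℂ), norm_eq_sqrt_re_inner (𝕜 := ℂ),
      inner_linearCombination_congr h]
  refine ⟨(LinearEquiv.refl ℂ (ι →₀ ℂ)).extendOfIsometry _ _ dense₁ dense₂ hnorm, fun i => ?_⟩
  have := LinearEquiv.extendOfIsometry_eq (LinearEquiv.refl ℂ (ι →₀ ℂ)) _ _ dense₁ dense₂ hnorm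
    (Finsupp.single i 1)
  simpa using this

lemma unitary_ext {e₁ : ι → H₁}
    (h₁ : (Submodule.span ℂ (Set.range e₁)).topologicalClosure = ⊤) {Φ Ψ : H₁ ≃ₗᵢ[ℂ] H₂}
    (h : ∀ i, Φ (e₁ i) = Ψ (e₁ i)) : Φ = Ψ := by
  have hd := Submodule.dense_iff_topologicalClosure_eq_top.2 h₁
  ext x
  refine congrFun (Continuous.ext_on hd Φ.continuous Ψ.continuous fun y hy => ?_) x
  exact LinearMap.eqOn_span (f := (Φ.toLinearEquiv : H₁ →ₗ[ℂ] H₂))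
    (g := (Ψ.toLinearEquiv : H₁ →ₗ[ℂ] H₂)) (by rintro _ ⟨i, rfl⟩; exact h i) hy

end Unitary

/-! ### Uniqueness of coefficients -/

/-- The identity theorem for analytic functions. Only the points `1 / (k + 1)` are used: for random
series, convergence at countably many points holds outside one null set. -/
lemma coeff_eq_of_hasSum {a b : ℕ → ℂ} {G : ℝ → ℂ}
    (ha : ∀ k : ℕ, HasSum (fun n => a n * (((1 : ℝ) / (k + 1) : ℝ) : ℂ) ^ n) (G (1 / (k + 1))))
    (hb : ∀ k : ℕ, HasSum (fun n => b n * (((1 : ℝ) / (k + 1) : ℝ) : ℂ) ^ n) (G (1 / (k + 1)))) :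
    a = b := by
  let c : ℕ → ℂ := fun n => a n - b n
  have hc : ∀ k : ℕ, HasSum (fun n => c n * (((1 : ℝ) / (k + 1) : ℝ) : ℂ) ^ n) 0 := fun k => by
    simpa [c, sub_mul] using (ha k).sub (hb k)
  let p := FormalMultilinearSeries.ofScalars ℂ c
  -- Convergence at `1`, the case `k = 0`, bounds the coefficients and makes the radius at least
  -- one.
  have hbdd : ∃ C, ∀ n, ‖c n‖ * (1 : ℝ) ^ n ≤ C := by
    have := (hc 0).summable.norm.tendsto_atTop_zero.bddAbove_range
    obtain ⟨C, hC⟩ := this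
    exact ⟨C, fun n => by simpa using hC ⟨n, rfl⟩⟩
  have hrad : 1 ≤ p.radius := by
    obtain ⟨C, hC⟩ := hbdd
    refine p.le_radius_of_bound (r := 1) C fun n => ?_
    rw [FormalMultilinearSeries.ofScalars_norm]
    simpa using hC n
  have hp : HasFPowerSeriesAt p.sum p 0 :=
    (p.hasFPowerSeriesOnBall (lt_of_lt_of_le one_pos hrad)).hasFPowerSeriesAt
  have hzero : ∀ k : ℕ, p.sum (((1 : ℝ) / (k + 1) : ℝ) : ℂ) = 0 := by
    intro k
    rw [← (hc k).tsum_eq, FormalMultilinearSeries.sum]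
    refine tsum_congr fun n => ?_
    simp [p, mul_comm]
  have hfreq : ∃ᶠ z in 𝓝[≠] (0 : ℂ), p.sum z = 0 := by
    have htend : Tendsto (fun k : ℕ => (((1 : ℝ) / (k + 1) : ℝ) : ℂ)) atTop (𝓝[≠] 0) := by
      rw [tendsto_nhdsWithin_iff]
      refine ⟨?_, Eventually.of_forall fun k => ?_⟩
      · have := (Complex.continuous_ofReal.tendsto 0).comp
          (tendsto_one_div_add_atTop_nhds_zero_nat (𝕜 := ℝ))
        simpa [Function.comp_def] using this
      · have : ((1 : ℝ) / (k + 1) : ℝ) ≠ 0 := by positivity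
        exact Complex.ofReal_ne_zero.2 this
    exact htend.frequently (Frequently.of_forall hzero)
  have hp0 : p = 0 := by
    by_contra hne
    have := hp.locally_ne_zero hne
    exact (hfreq.and_eventually this).exists.elim fun z hz => hz.2 hz.1
  have hc0 : c = 0 := by
    simpa [p] using hp0
  ext n
  exact sub_eq_zero.1 (congrFun hc0 n)

/-! ### Exponentials are total -/

section Determining

variable {Ω I : Type*} [MeasurableSpace Ω] {P : Measure Ω}

/-- The finite-dimensional laws determine the law of the whole family, by uniqueness of projective
limits, and every set of the generated `σ`-field is a preimage under the family. -/
lemma measure_eq_of_map_restrict_eq {μ₁ μ₂ : Measure Ω} [IsFiniteMeasure μ₁] [IsFiniteMeasure μ₂]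
    {Y : I → Ω → ℝ} (hY : ∀ i, Measurable (Y i))
    (h : ∀ J : Finset I, μ₁.map (fun ω (i : J) => Y i ω) = μ₂.map (fun ω (i : J) => Y i ω))
    {S : Set Ω} (hS : MeasurableSet[⨆ i, MeasurableSpace.comap (Y i) inferInstance] S) :
    μ₁ S = μ₂ S := by
  have hYm : Measurable (fun ω i => Y i ω) := measurable_pi_lambda _ hY
  have hmap : μ₁.map (fun ω i => Y i ω) = μ₂.map (fun ω i => Y i ω) := by
    have key : ∀ (μ : Measure Ω) (J : Finset I), (μ.map (fun ω i => Y i ω)).map J.restrict =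
        μ.map (fun ω (i : J) => Y i ω) := fun μ J =>
      Measure.map_map (Finset.measurable_restrict J) hYm
    exact IsProjectiveLimit.unique (P := fun J : Finset I => μ₂.map (fun ω (i : J) => Y i ω))
      (fun J => (key μ₁ J).trans (h J)) (fun J => key μ₂ J)
  have hcomap : (⨆ i, MeasurableSpace.comap (Y i) inferInstance) =
      MeasurableSpace.comap (fun ω i => Y i ω) MeasurableSpace.pi := by
    rw [MeasurableSpace.pi, MeasurableSpace.comap_iSup]
    refine iSup_congr fun i => ?_
    rw [MeasurableSpace.comap_comp]
    rfl
  rw [hcomap] at hS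
  obtain ⟨T, hT, rfl⟩ := hS
  rw [← Measure.map_apply hYm hT, ← Measure.map_apply hYm hT, hmap]

/-- Since all exponential moments are finite, equality on the real line extends analytically to the
complex moment generating function, which determines the law. -/
lemma map_eq_of_mgf_eq {μ₁ μ₂ : Measure Ω} [IsFiniteMeasure μ₁]
    [IsFiniteMeasure μ₂] {Y : Ω → ℝ} (hY : Measurable Y)
    (h₁ : ∀ t, Integrable (fun ω => Real.exp (t * Y ω)) μ₁)
    (h : mgf Y μ₁ = mgf Y μ₂) : μ₁.map Y = μ₂.map Y := by
  have huniv : integrableExpSet Y μ₁ = Set.univ := Set.eq_univ_of_forall h₁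
  have h0 : μ₁ = 0 ↔ μ₂ = 0 := by
    have := congrFun h 0
    rw [mgf_zero', mgf_zero'] at this
    rw [← Measure.measure_univ_eq_zero, ← Measure.measure_univ_eq_zero,
      ← measureReal_eq_zero_iff, ← measureReal_eq_zero_iff, this]
  refine Measure.ext_of_complexMGF_eq hY.aemeasurable hY.aemeasurable ?_
  ext z
  refine eqOn_complexMGF_of_mgf' h h0 ?_
  simp [huniv]

/-- The positive and negative parts of `g` are regarded as densities. Orthogonality to exponentials
equates the moment generating functions of all linear combinations, and the Cramér–Wold argument
equates the joint laws. -/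
lemma setIntegral_eq_zero_of_integral_mul_exp_eq_zero {g : Ω → ℝ} [IsFiniteMeasure P]
    (hg : MemLp g 2 P) {Y : I → Ω → ℝ} (hY : ∀ i, Measurable (Y i))
    (hexp : ∀ (J : Finset I) (θ : J → ℝ), MemLp (fun ω => Real.exp (∑ i, θ i * Y i ω)) 2 P)
    (h0 : ∀ (J : Finset I) (θ : J → ℝ), ∫ ω, g ω * Real.exp (∑ i, θ i * Y i ω) ∂P = 0)
    {S : Set Ω}
    (hS : MeasurableSet[⨆ i, MeasurableSpace.comap (Y i) inferInstance] S) :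
    ∫ ω in S, g ω ∂P = 0 := by
  have hSm : MeasurableSet S := iSup_le (fun i => (hY i).comap_le) S hS
  have hg1 : Integrable g P := hg.integrable one_le_two
  -- `ENNReal.ofReal` truncates at zero: `ρ g` has the positive part of `g` as density, `ρ (-g)` the
  -- negative part.
  let ρ : (Ω → ℝ) → Measure Ω := fun f => P.withDensity fun ω => ENNReal.ofReal (f ω)
  have hfin : ∀ f : Ω → ℝ, MemLp f 2 P → IsFiniteMeasure (ρ f) := fun f hf =>
    isFiniteMeasure_withDensity_ofReal (hf.integrable one_le_two).2
  have hfin₁ := hfin g hg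
  have hfin₂ := hfin (-g) hg.neg
  have hint : ∀ f : Ω → ℝ, MemLp f 2 P → ∀ E : Ω → ℝ, MemLp E 2 P → Integrable E (ρ f) ∧
      Integrable (fun ω => max (f ω) 0 * E ω) P ∧ ∫ ω, E ω ∂(ρ f) = ∫ ω, max (f ω) 0 * E ω ∂P := by
    intro f hf E hE
    have hm : AEMeasurable (fun ω => ENNReal.ofReal (f ω)) P := hf.1.aemeasurable.ennreal_ofReal
    have ht : ∀ᵐ ω ∂P, ENNReal.ofReal (f ω) < ∞ := ae_of_all _ fun _ => ENNReal.ofReal_lt_top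
    have hI : Integrable (fun ω => max (f ω) 0 * E ω) P := by
      have hmax : MemLp (fun ω => max (f ω) 0) 2 P := hf.pos_part
      exact hmax.integrable_mul hE
    refine ⟨?_, hI, ?_⟩
    · rw [integrable_withDensity_iff_integrable_smul₀' hm ht]
      simpa only [ENNReal.toReal_ofReal', smul_eq_mul] using hI
    · rw [integral_withDensity_eq_integral_toReal_smul₀ hm ht]
      simp only [ENNReal.toReal_ofReal', smul_eq_mul]
  have hlin : ∀ (J : Finset I) (θ : J → ℝ),
      (ρ g).map (fun ω => ∑ i, θ i * Y i ω) = (ρ (-g)).map (fun ω => ∑ i, θ i * Y i ω) := by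
    intro J θ
    have hmem : ∀ t : ℝ, MemLp (fun ω => Real.exp (t * ∑ i, θ i * Y i ω)) 2 P := fun t => by
      simpa only [Finset.mul_sum, ← mul_assoc] using hexp J (fun i => t * θ i)
    refine map_eq_of_mgf_eq (by fun_prop) (fun t => (hint g hg _ (hmem t)).1) ?_
    ext t
    simp only [mgf]
    obtain ⟨-, h1, h2⟩ := hint g hg _ (hmem t)
    obtain ⟨-, h3, h4⟩ := hint (-g) hg.neg _ (hmem t)
    rw [h2, h4, ← sub_eq_zero, ← integral_sub h1 h3]
    have := h0 J (fun i => t * θ i)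
    simp only [mul_assoc, ← Finset.mul_sum] at this
    refine Eq.trans ?_ this
    refine integral_congr_ae (ae_of_all _ fun ω => ?_)
    simp only [Pi.neg_apply]
    rw [← sub_mul]
    congr 1
    rcases le_total (g ω) 0 with h | h
    · rw [max_eq_right h, max_eq_left (by linarith)]; ring
    · rw [max_eq_left h, max_eq_right (by linarith)]; ring
  have hjoint : ∀ J : Finset I, (ρ g).map (fun ω (i : J) => Y i ω) =
      (ρ (-g)).map (fun ω (i : J) => Y i ω) := by
    intro J
    classical
    have hZ : Measurable (fun ω (i : J) => Y i ω) := measurable_pi_lambda _ fun i => hY i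
    refine Measure.ext_of_charFunDual ?_
    ext L
    rw [charFunDual_eq_charFun_map_one, charFunDual_eq_charFun_map_one,
      Measure.map_map L.continuous.measurable hZ, Measure.map_map L.continuous.measurable hZ]
    have hL : (⇑L ∘ fun ω (i : J) => Y i ω) =
        fun ω => ∑ i : J, L (fun j => if i = j then 1 else 0) * Y i ω := by
      ext ω
      have := LinearMap.pi_apply_eq_sum_univ (L : (J → ℝ) →ₗ[ℝ] ℝ) (fun i : J => Y i ω)
      simp only [ContinuousLinearMap.coe_coe, smul_eq_mul] at this
      simp only [Function.comp_apply, this, mul_comm]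
    rw [hL, hlin]
  have hS' := measure_eq_of_map_restrict_eq hY hjoint hS
  simp only [ρ, withDensity_apply _ hSm] at hS'
  rw [integral_eq_lintegral_pos_part_sub_lintegral_neg_part hg1.integrableOn, hS']
  simp

/-- A square integrable function orthogonal to the exponentials of all linear combinations of the
`Y i` has integral zero over the sets of the `σ`-field generated by the `Y i`. -/
lemma setIntegral_complex_eq_zero_of_integral_mul_exp_eq_zero {F : Ω → ℂ} [IsFiniteMeasure P]
    (hF : MemLp F 2 P) {Y : I → Ω → ℝ} (hY : ∀ i, Measurable (Y i))
    (hexp : ∀ (J : Finset I) (θ : J → ℝ), MemLp (fun ω => Real.exp (∑ i, θ i * Y i ω)) 2 P)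
    (h0 : ∀ (J : Finset I) (θ : J → ℝ),
      ∫ ω, F ω * ((Real.exp (∑ i, θ i * Y i ω) : ℝ) : ℂ) ∂P = 0)
    {S : Set Ω} (hS : MeasurableSet[⨆ i, MeasurableSpace.comap (Y i) inferInstance] S) :
    ∫ ω in S, F ω ∂P = 0 := by
  have hF1 : IntegrableOn F S P := (hF.integrable one_le_two).integrableOn
  have hint : ∀ (J : Finset I) (θ : J → ℝ),
      Integrable (fun ω => F ω * ((Real.exp (∑ i, θ i * Y i ω) : ℝ) : ℂ)) P := fun J θ =>
    hF.integrable_mul (hexp J θ).ofReal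
  apply Complex.ext
  · rw [← RCLike.re_eq_complex_re, ← integral_re hF1]
    refine setIntegral_eq_zero_of_integral_mul_exp_eq_zero hF.re hY hexp (fun J θ => ?_) hS
    have := congrArg Complex.re (h0 J θ)
    rw [← RCLike.re_eq_complex_re, ← integral_re (hint J θ)] at this
    simpa only [RCLike.re_eq_complex_re, Complex.re_mul_ofReal, map_zero] using this
  · rw [← RCLike.im_eq_complex_im, ← integral_im hF1]
    refine setIntegral_eq_zero_of_integral_mul_exp_eq_zero hF.im hY hexp (fun J θ => ?_) hS
    have := congrArg Complex.im (h0 J θ)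
    rw [← RCLike.im_eq_complex_im, ← integral_im (hint J θ)] at this
    simpa only [RCLike.im_eq_complex_im, Complex.im_mul_ofReal, map_zero] using this

end Determining

end GaussPoisson

end

noncomputable section

namespace GaussPoisson

/-- The squared distance of `u g` and `u f` is a continuous expression in `g` that vanishes at `g =
f`. No linearity of `u` enters. -/
lemma continuous_of_inner_eq {V H : Type*} [NormedAddCommGroup V] [InnerProductSpace ℝ V]
    [NormedAddCommGroup H] [InnerProductSpace ℂ H] {u : V → H} {κ : ℝ → ℝ} (hκ : Continuous κ)
    (h : ∀ f g, inner ℂ (u f) (u g) = ((κ (inner ℝ f g) : ℝ) : ℂ)) : Continuous u := by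
  rw [continuous_iff_continuousAt]
  intro f
  rw [ContinuousAt, tendsto_iff_norm_sub_tendsto_zero]
  have key : ∀ g, ‖u g - u f‖ = Real.sqrt (κ (inner ℝ g g) - 2 * κ (inner ℝ g f) +
      κ (inner ℝ f f)) := by
    intro g
    rw [norm_eq_sqrt_re_inner (𝕜 := ℂ), inner_sub_sub_self]
    congr 1
    simp only [h, real_inner_comm g f, ← Complex.ofReal_sub, ← Complex.ofReal_add]
    simp only [RCLike.re_eq_complex_re, Complex.ofReal_re]
    ring
  simp only [key]
  have : ContinuousAt (fun g => Real.sqrt (κ (inner ℝ g g) - 2 * κ (inner ℝ g f) +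
      κ (inner ℝ f f))) f := by
    refine Continuous.continuousAt ?_
    fun_prop
  have h2 := this.tendsto
  rwa [show κ (inner ℝ f f) - 2 * κ (inner ℝ f f) + κ (inner ℝ f f) = 0 by ring,
    Real.sqrt_zero] at h2

/-- The inner product in `L²` of the classes of two real functions. -/
lemma inner_eq_integral_of_ae_eq {Ω : Type*} [MeasurableSpace Ω] {P : Measure Ω} {F G : Lp ℂ 2 P}
    {u v : Ω → ℝ} (hF : F =ᵐ[P] fun ω => (u ω : ℂ)) (hG : G =ᵐ[P] fun ω => (v ω : ℂ)) :
    inner ℂ F G = ((∫ ω, u ω * v ω ∂P : ℝ) : ℂ) := by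
  rw [L2.inner_def, ← integral_complex_ofReal]
  refine integral_congr_ae ?_
  filter_upwards [hF, hG] with ω h1 h2
  rw [h1, h2]
  simp [mul_comm]

/-! ### The Gaussian side -/

section Gauss

lemma measurable_generatedSigmaField {X Ω : Type*} [MeasurableSpace X] {ν : Measure X}
    (W : Lp ℝ 2 ν → Ω → ℝ) (h : Lp ℝ 2 ν) : Measurable[generatedSigmaField W] (W h) :=
  measurable_iff_comap_le.2 (le_iSup (fun h => MeasurableSpace.comap (W h) inferInstance) h)

variable {X Ω : Type*} [MeasurableSpace X] [MeasurableSpace Ω] {ν : Measure X} {P : Measure Ω}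
  {W : Lp ℝ 2 ν → Ω → ℝ}

lemma generatedSigmaField_le (hW : IsGaussianWhiteNoise ν P W) :
    generatedSigmaField W ≤ ‹MeasurableSpace Ω› :=
  iSup_le fun h => (hW.measurable h).comap_le

lemma IsGaussianWhiteNoise.map_sum (hW : IsGaussianWhiteNoise ν P W) {ι : Type*} (s : Finset ι)
    (f : ι → Lp ℝ 2 ν) : W (∑ i ∈ s, f i) =ᵐ[P] fun ω => ∑ i ∈ s, W (f i) ω := by
  classical
  induction s using Finset.induction_on with
  | empty =>
    have := hW.map_smul 0 0
    simp only [zero_smul] at this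
    filter_upwards [this] with ω h
    simpa using h
  | insert i s hi ih =>
    rw [Finset.sum_insert hi]
    filter_upwards [ih, hW.map_add (f i) (∑ i ∈ s, f i)] with ω h1 h2
    rw [h2, h1, Finset.sum_insert hi]

/-- The characteristic functional at `t • h` is the characteristic function of `W h` at `t`. -/
lemma IsGaussianWhiteNoise.map_eq_gaussianReal [IsProbabilityMeasure P]
    (hW : IsGaussianWhiteNoise ν P W) (h : Lp ℝ 2 ν) :
    P.map (W h) = gaussianReal 0 (‖h‖₊ ^ 2) := by
  have : IsProbabilityMeasure (P.map (W h)) :=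
    Measure.isProbabilityMeasure_map (hW.measurable h).aemeasurable
  refine Measure.ext_of_charFun ?_
  ext t
  rw [charFun_gaussianReal, charFun_apply_real, integral_map (hW.measurable h).aemeasurable
    (by fun_prop)]
  have h1 := hW.characteristic (t • h)
  rw [integral_congr_ae (g := fun ω => Complex.exp (t * W h ω * Complex.I))] at h1
  · rw [h1, norm_smul, Complex.ofReal_exp]
    congr 1
    push_cast
    rw [mul_pow, ← Complex.ofReal_pow, Real.norm_eq_abs, sq_abs]
    push_cast
    ring
  · filter_upwards [hW.map_smul t h] with ω hω
    rw [hω]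
    congr 1
    push_cast
    ring

lemma IsGaussianWhiteNoise.mgf_eq [IsProbabilityMeasure P] (hW : IsGaussianWhiteNoise ν P W)
    (h : Lp ℝ 2 ν) (t : ℝ) : ∫ ω, Real.exp (t * W h ω) ∂P = Real.exp (t ^ 2 * ‖h‖ ^ 2 / 2) := by
  have := mgf_gaussianReal (hW.map_eq_gaussianReal h) t
  rw [mgf] at this
  rw [this]
  congr 1
  push_cast
  ring

lemma IsGaussianWhiteNoise.integrable_exp [IsProbabilityMeasure P]
    (hW : IsGaussianWhiteNoise ν P W) (h : Lp ℝ 2 ν) (t : ℝ) :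
    Integrable (fun ω => Real.exp (t * W h ω)) P := by
  have := integrable_exp_mul_gaussianReal (μ := 0) (v := ‖h‖₊ ^ 2) t
  rw [← hW.map_eq_gaussianReal h] at this
  exact (integrable_map_measure (by fun_prop) (hW.measurable h).aemeasurable).1 this

lemma IsGaussianWhiteNoise.memLp_exp [IsProbabilityMeasure P]
    (hW : IsGaussianWhiteNoise ν P W) (h : Lp ℝ 2 ν) (t : ℝ) :
    MemLp (fun ω => Real.exp (t * W h ω)) 2 P := by
  have hm := hW.measurable h
  rw [memLp_two_iff_integrable_sq (by fun_prop)]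
  refine (hW.integrable_exp h (2 * t)).congr (ae_of_all _ fun ω => ?_)
  simp only
  rw [← Real.exp_nat_mul]
  congr 1
  push_cast
  ring

/-- The class in `L²(α)` of a real functional of the process. -/
def toNoise (u : Ω → ℝ) (hm : Measurable[generatedSigmaField W] u) (hu : MemLp u 2 P) :
    NoiseL2 P W :=
  ⟨hu.ofReal.toLp (fun ω => (u ω : ℂ)), by
    rw [mem_lpMeas_iff_aestronglyMeasurable]
    refine AEStronglyMeasurable.congr ?_ (MemLp.coeFn_toLp hu.ofReal).symm
    exact (Complex.measurable_ofReal.comp hm).stronglyMeasurable.aestronglyMeasurable⟩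

lemma coe_toNoise (u : Ω → ℝ) (hm : Measurable[generatedSigmaField W] u) (hu : MemLp u 2 P) :
    (toNoise u hm hu : Lp ℂ 2 P) =ᵐ[P] fun ω => (u ω : ℂ) :=
  MemLp.coeFn_toLp hu.ofReal

lemma IsGaussianWhiteNoise.memLp_exp_sub [IsProbabilityMeasure P]
    (hW : IsGaussianWhiteNoise ν P W) (h : Lp ℝ 2 ν) :
    MemLp (fun ω => Real.exp (W h ω - ‖h‖ ^ 2 / 2)) 2 P := by
  refine ((hW.memLp_exp h 1).const_mul (Real.exp (-‖h‖ ^ 2 / 2))).ae_eq (ae_of_all _ fun ω => ?_)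
  simp only
  rw [← Real.exp_add]
  congr 1
  ring

/-- The exponential functional `exp (⟨h, ·⟩ - ‖h‖² / 2)`. -/
def noiseExp [IsProbabilityMeasure P] (hW : IsGaussianWhiteNoise ν P W) (h : Lp ℝ 2 ν) :
    NoiseL2 P W :=
  toNoise (fun ω => Real.exp (W h ω - ‖h‖ ^ 2 / 2))
    (Real.measurable_exp.comp ((measurable_generatedSigmaField W h).sub_const _))
    (hW.memLp_exp_sub h)

lemma coe_noiseExp [IsProbabilityMeasure P] (hW : IsGaussianWhiteNoise ν P W) (h : Lp ℝ 2 ν) :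
    (noiseExp hW h : Lp ℂ 2 P) =ᵐ[P] fun ω => ((Real.exp (W h ω - ‖h‖ ^ 2 / 2) : ℝ) : ℂ) :=
  coe_toNoise _ _ _

/-- The product is a constant times `exp (W (g + h))`; the cross term of `‖g + h‖²` is what survives
the normalization. -/
lemma inner_noiseExp [IsProbabilityMeasure P] (hW : IsGaussianWhiteNoise ν P W)
    (g h : Lp ℝ 2 ν) :
    inner ℂ (noiseExp hW g) (noiseExp hW h) = ((Real.exp (inner ℝ g h) : ℝ) : ℂ) := by
  rw [Submodule.coe_inner, inner_eq_integral_of_ae_eq (coe_noiseExp hW g) (coe_noiseExp hW h)]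
  congr 1
  have h1 : (fun ω => Real.exp (W g ω - ‖g‖ ^ 2 / 2) * Real.exp (W h ω - ‖h‖ ^ 2 / 2)) =ᵐ[P]
      fun ω => Real.exp (-(‖g‖ ^ 2 / 2) - ‖h‖ ^ 2 / 2) * Real.exp (1 * W (g + h) ω) := by
    filter_upwards [hW.map_add g h] with ω hω
    rw [hω, ← Real.exp_add, ← Real.exp_add]
    congr 1
    ring
  rw [integral_congr_ae h1, integral_const_mul, hW.mgf_eq, ← Real.exp_add]
  congr 1
  rw [norm_add_sq_real]
  ring

lemma continuous_noiseExp [IsProbabilityMeasure P] (hW : IsGaussianWhiteNoise ν P W) :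
    Continuous (noiseExp hW) :=
  continuous_of_inner_eq Real.continuous_exp (inner_noiseExp hW)

lemma completeSpace_noiseL2 (hW : IsGaussianWhiteNoise ν P W) : CompleteSpace (NoiseL2 P W) := by
  have : Fact (generatedSigmaField W ≤ ‹MeasurableSpace Ω›) := ⟨generatedSigmaField_le hW⟩
  infer_instance

/-- A linear combination of the variables `W h` is almost surely again of this form, so
orthogonality to the exponentials is the hypothesis of the determining lemma. The vector has
integral zero over each generated set and is measurable for the completed `σ`-field, hence it
vanishes. -/
lemma span_noiseExp_topologicalClosure [IsProbabilityMeasure P]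
    (hW : IsGaussianWhiteNoise ν P W) :
    (Submodule.span ℂ (Set.range (noiseExp hW))).topologicalClosure = ⊤ := by
  have := completeSpace_noiseL2 hW
  rw [Submodule.topologicalClosure_eq_top_iff, Submodule.eq_bot_iff]
  intro F hF
  have hF0 : ∀ h, ∫ ω, (F : Lp ℂ 2 P) ω * ((Real.exp (W h ω - ‖h‖ ^ 2 / 2) : ℝ) : ℂ) ∂P = 0 := by
    intro h
    have h1 := Submodule.inner_right_of_mem_orthogonal
      (Submodule.subset_span (Set.mem_range_self h)) hF
    rw [Submodule.coe_inner, L2.inner_def] at h1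
    rw [← h1]
    refine integral_congr_ae ?_
    filter_upwards [coe_noiseExp hW h] with ω hω
    rw [hω, RCLike.inner_apply, Complex.conj_ofReal]
  have hlin : ∀ (J : Finset (Lp ℝ 2 ν)) (θ : J → ℝ),
      (fun ω => Real.exp (∑ i, θ i * W i ω)) =ᵐ[P]
        fun ω => Real.exp (1 * W (∑ i : J, θ i • (i : Lp ℝ 2 ν)) ω) := by
    intro J θ
    have h2 : ∀ᵐ ω ∂P, ∀ i : J, W (θ i • (i : Lp ℝ 2 ν)) ω = θ i * W i ω :=
      ae_all_iff.2 fun i => hW.map_smul _ _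
    filter_upwards [hW.map_sum Finset.univ (fun i : J => θ i • (i : Lp ℝ 2 ν)), h2] with ω h3 h4
    rw [h3, one_mul]
    simp only [h4]
  have hset : ∀ S, MeasurableSet[generatedSigmaField W] S → ∫ ω in S, (F : Lp ℂ 2 P) ω ∂P = 0 := by
    intro S hS
    refine setIntegral_complex_eq_zero_of_integral_mul_exp_eq_zero (Lp.memLp _) hW.measurable
      (fun J θ => (hW.memLp_exp _ 1).ae_eq (hlin J θ).symm) (fun J θ => ?_) hS
    have h5 := hF0 (∑ i : J, θ i • (i : Lp ℝ 2 ν))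
    set h := ∑ i : J, θ i • (i : Lp ℝ 2 ν) with hh
    have h6 : (fun ω => (F : Lp ℂ 2 P) ω * ((Real.exp (∑ i, θ i * W i ω) : ℝ) : ℂ)) =ᵐ[P]
        fun ω => ((Real.exp (‖h‖ ^ 2 / 2) : ℝ) : ℂ) *
          ((F : Lp ℂ 2 P) ω * ((Real.exp (W h ω - ‖h‖ ^ 2 / 2) : ℝ) : ℂ)) := by
      filter_upwards [hlin J θ] with ω hω
      have h7 : Real.exp (∑ i, θ i * W i ω) =
          Real.exp (‖h‖ ^ 2 / 2) * Real.exp (W h ω - ‖h‖ ^ 2 / 2) := by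
        rw [hω, ← Real.exp_add]
        congr 1
        ring
      rw [h7]
      push_cast
      ring
    rw [integral_congr_ae h6, integral_const_mul, h5, mul_zero]
  have hzero : (F : Lp ℂ 2 P) =ᵐ[P] (0 : Ω → ℂ) := by
    have hle := generatedSigmaField_le hW
    have : IsFiniteMeasure (P.trim hle) := isFiniteMeasure_trim hle
    refine ae_eq_of_forall_setIntegral_eq_of_sigmaFinite' hle
      (fun s _ _ => ((Lp.memLp _).integrable one_le_two).integrableOn)
      (fun s _ _ => (integrable_zero _ _ _).integrableOn) (fun s hs _ => ?_)
      (lpMeas.aestronglyMeasurable F) ?_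
    · rw [hset s hs]
      simp
    · exact (stronglyMeasurable_zero :
        StronglyMeasurable[generatedSigmaField W] (0 : Ω → ℂ)).aestronglyMeasurable
  exact Subtype.ext ((Lp.eq_zero_iff_ae_eq_zero).2 hzero)

end Gauss

end GaussPoisson

end

noncomputable section

namespace GaussPoisson

/-! ### The Hermite functionals as vectors -/

lemma measurable_hermiteCoeff (v : ℝ) (n : ℕ) : Measurable fun x => hermiteCoeff x v n := by
  simp only [hermiteCoeff, PowerSeries.coeff_mul, expSeries, PowerSeries.coeff_mk]
  fun_prop

lemma hermiteBound_nonneg {v : ℝ} (hv : 0 ≤ v) (x : ℝ) (n : ℕ) : 0 ≤ hermiteBound x v n :=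
  (abs_nonneg _).trans (abs_hermiteCoeff_le hv n)

/-- A Cauchy estimate: a term of the majorant series at `2 |t|` is at most the full sum, and halving
the radius gains `(1 / 2) ^ n`. Finally `exp |y| ≤ exp y + exp (-y)` gives a bound that is square
integrable at `x = W h`. -/
lemma abs_hermiteCoeff_mul_pow_le {v : ℝ} (hv : 0 ≤ v) (x t : ℝ) (n : ℕ) :
    |hermiteCoeff x v n * t ^ n| ≤
      (1 / 2) ^ n * (Real.exp (2 * v * t ^ 2) *
        (Real.exp (2 * |t| * x) + Real.exp (-(2 * |t|) * x))) := by
  have h1 : hermiteBound x v n * (2 * |t|) ^ n ≤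
      Real.exp (|x| * (2 * |t|) + v * (2 * |t|) ^ 2 / 2) := by
    refine le_hasSum (hasSum_hermiteBound x v (2 * |t|)) n fun k _ => ?_
    have := hermiteBound_nonneg hv x k
    positivity
  have h2 : Real.exp (|x| * (2 * |t|) + v * (2 * |t|) ^ 2 / 2) ≤ Real.exp (2 * v * t ^ 2) *
      (Real.exp (2 * |t| * x) + Real.exp (-(2 * |t|) * x)) := by
    rw [Real.exp_add, mul_comm]
    refine mul_le_mul (le_of_eq ?_) ?_ (Real.exp_pos _).le (Real.exp_pos _).le
    · rw [mul_pow, sq_abs]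
      congr 1
      ring
    · rcases abs_cases x with ⟨h, _⟩ | ⟨h, _⟩ <;> rw [h]
      · rw [mul_comm x]
        exact le_add_of_nonneg_right (Real.exp_pos _).le
      · rw [show -x * (2 * |t|) = -(2 * |t|) * x by ring]
        exact le_add_of_nonneg_left (Real.exp_pos _).le
  rw [abs_mul, abs_pow]
  calc |hermiteCoeff x v n| * |t| ^ n ≤ hermiteBound x v n * |t| ^ n := by
        gcongr
        exact abs_hermiteCoeff_le hv n
    _ = (1 / 2) ^ n * (hermiteBound x v n * (2 * |t|) ^ n) := by
        rw [mul_pow, one_div, inv_pow]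
        field_simp
    _ ≤ _ := by
        exact mul_le_mul_of_nonneg_left (h1.trans h2) (by positivity)

/-- A normally convergent series in `L²` converges almost everywhere. -/
lemma ae_hasSum_of_summable_norm {Ω : Type*} [MeasurableSpace Ω] {P : Measure Ω}
    {f : ℕ → Lp ℂ 2 P} {F : Lp ℂ 2 P} (hf : Summable fun n => ‖f n‖) (hF : HasSum f F) :
    ∀ᵐ ω ∂P, HasSum (fun n => f n ω) (F ω) := by
  rw [← hF.tsum_eq]
  exact Lp.hasSum_coeFn_tsum (tsum_enorm_ne_top_iff_summable_norm.2 hf)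

lemma hermite_eq_hermiteSum {X Ω : Type*} [MeasurableSpace X] {ν : Measure X}
    {W : Lp ℝ 2 ν → Ω → ℝ} {n : ℕ} (f : Fin n → Lp ℝ 2 ν) (η : Ω) :
    hermite W f η = hermiteSum (fun i => W (f i) η) (fun i j => inner ℝ (f i) (f j)) := rfl

lemma hasSum_coe_submodule {E : Type*} [NormedAddCommGroup E] [NormedSpace ℂ E]
    (S : Submodule ℂ E) {f : ℕ → S} {F : S} (h : HasSum f F) :
    HasSum (fun n => (f n : E)) (F : E) :=
  h.mapL S.subtypeL

/-! ### Inner products and series in `NoiseL2`, read in the ambient `Lp` -/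

section NoiseInner

variable {X Ω : Type*} [MeasurableSpace X] [MeasurableSpace Ω] {ν : Measure X} {P : Measure Ω}
  {W : Lp ℝ 2 ν → Ω → ℝ}

lemma noise_inner_smul_right (x y : NoiseL2 P W) (c : ℂ) :
    inner ℂ x (c • y) = c * inner ℂ x y := by
  rw [Submodule.coe_inner, Submodule.coe_inner]
  exact inner_smul_right (x : Lp ℂ 2 P) (y : Lp ℂ 2 P) c

lemma noise_inner_smul_left (x y : NoiseL2 P W) (c : ℂ) :
    inner ℂ (c • x) y = starRingEnd ℂ c * inner ℂ x y := by
  rw [Submodule.coe_inner, Submodule.coe_inner]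
  exact inner_smul_left (x : Lp ℂ 2 P) (y : Lp ℂ 2 P) c

lemma noise_inner_conj_symm (x y : NoiseL2 P W) :
    starRingEnd ℂ (inner ℂ y x) = inner ℂ x y := by
  rw [Submodule.coe_inner, Submodule.coe_inner]
  exact inner_conj_symm (x : Lp ℂ 2 P) (y : Lp ℂ 2 P)

lemma noise_hasSum_coe {f : ℕ → NoiseL2 P W} {F : NoiseL2 P W} (h : HasSum f F) :
    HasSum (fun n => (f n : Lp ℂ 2 P)) (F : Lp ℂ 2 P) :=
  hasSum_coe_submodule (NoiseL2 P W) h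

lemma noise_hasSum_inner {f : ℕ → NoiseL2 P W} {F : NoiseL2 P W} (h : HasSum f F)
    (x : NoiseL2 P W) : HasSum (fun n => inner ℂ x (f n)) (inner ℂ x F) := by
  simp only [Submodule.coe_inner]
  exact (noise_hasSum_coe h).mapL (innerSL ℂ (x : Lp ℂ 2 P))

lemma ae_hasSum_noise {f : ℕ → NoiseL2 P W} {F : NoiseL2 P W} (hf : Summable fun n => ‖f n‖)
    (hF : HasSum f F) : ∀ᵐ ω ∂P, HasSum (fun n => (f n : Lp ℂ 2 P) ω) ((F : Lp ℂ 2 P) ω) :=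
  ae_hasSum_of_summable_norm (f := fun n => (f n : Lp ℂ 2 P)) hf (noise_hasSum_coe hF)

lemma noise_summable_of_norm [CompleteSpace (NoiseL2 P W)] {f : ℕ → NoiseL2 P W}
    (hf : Summable fun n => ‖f n‖) : Summable f :=
  Summable.of_norm hf

end NoiseInner

/-! ### Diagonal Hermite vectors, polarization and the Wiener chaos -/

section Hermite

variable {X Ω : Type*} [MeasurableSpace X] [MeasurableSpace Ω] {ν : Measure X} {P : Measure Ω}
  {W : Lp ℝ 2 ν → Ω → ℝ} [IsProbabilityMeasure P]

lemma IsGaussianWhiteNoise.memLp_hermiteDom (hW : IsGaussianWhiteNoise ν P W) (h : Lp ℝ 2 ν)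
    (v t : ℝ) : MemLp (fun ω => Real.exp (2 * v * t ^ 2) *
      (Real.exp (2 * |t| * W h ω) + Real.exp (-(2 * |t|) * W h ω))) 2 P :=
  ((hW.memLp_exp h _).add (hW.memLp_exp h _)).const_mul _

lemma IsGaussianWhiteNoise.memLp_hermiteCoeff (hW : IsGaussianWhiteNoise ν P W) (h : Lp ℝ 2 ν)
    (n : ℕ) : MemLp (fun ω => hermiteCoeff (W h ω) (‖h‖ ^ 2) n) 2 P := by
  refine MemLp.mono (hW.memLp_hermiteDom h (‖h‖ ^ 2) 1)
    ((measurable_hermiteCoeff _ n).comp (hW.measurable h)).aestronglyMeasurable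
    (ae_of_all _ fun ω => ?_)
  have h1 := abs_hermiteCoeff_mul_pow_le (sq_nonneg ‖h‖) (W h ω) 1 n
  rw [one_pow, mul_one] at h1
  rw [Real.norm_eq_abs]
  refine h1.trans ((mul_le_of_le_one_left (by positivity) ?_).trans (le_abs_self _))
  exact pow_le_one₀ (by norm_num) (by norm_num)

/-- The diagonal Hermite functional of order `n`, divided by `n!`. -/
def noiseHermiteDiag (hW : IsGaussianWhiteNoise ν P W) (n : ℕ) (h : Lp ℝ 2 ν) : NoiseL2 P W :=
  toNoise (fun ω => hermiteCoeff (W h ω) (‖h‖ ^ 2) n)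
    ((measurable_hermiteCoeff _ n).comp (measurable_generatedSigmaField W h))
    (hW.memLp_hermiteCoeff h n)

lemma coe_noiseHermiteDiag (hW : IsGaussianWhiteNoise ν P W) (n : ℕ) (h : Lp ℝ 2 ν) :
    (noiseHermiteDiag hW n h : Lp ℂ 2 P) =ᵐ[P]
      fun ω => ((hermiteCoeff (W h ω) (‖h‖ ^ 2) n : ℝ) : ℂ) :=
  coe_toNoise _ _ _

lemma summable_norm_smul_noiseHermiteDiag (hW : IsGaussianWhiteNoise ν P W) (h : Lp ℝ 2 ν)
    (t : ℝ) : Summable fun n : ℕ => ‖((t : ℂ) ^ n) • noiseHermiteDiag hW n h‖ := by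
  have hD := hW.memLp_hermiteDom h (‖h‖ ^ 2) t
  refine Summable.of_nonneg_of_le (fun n => norm_nonneg _)
    (f := fun n : ℕ => (1 / 2 : ℝ) ^ n * ‖hD.toLp _‖) (fun n => ?_)
    ((summable_geometric_of_lt_one (by norm_num) (by norm_num)).mul_right _)
  rw [Submodule.coe_norm]
  refine Lp.norm_le_mul_norm_of_ae_le_mul ?_
  filter_upwards [Lp.coeFn_smul ((t : ℂ) ^ n) (noiseHermiteDiag hW n h : Lp ℂ 2 P),
    coe_noiseHermiteDiag hW n h, hD.coeFn_toLp] with ω h1 h2 h3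
  rw [Submodule.coe_smul, h1, Pi.smul_apply, h2, h3]
  have h4 := abs_hermiteCoeff_mul_pow_le (sq_nonneg ‖h‖) (W h ω) t n
  rw [smul_eq_mul, ← Complex.ofReal_pow, ← Complex.ofReal_mul, Complex.norm_real,
    Real.norm_eq_abs, mul_comm]
  refine h4.trans ?_
  gcongr
  exact le_abs_self _

lemma coe_smul_noiseHermiteDiag (hW : IsGaussianWhiteNoise ν P W) (h : Lp ℝ 2 ν) (t : ℝ) (n : ℕ) :
    (((t : ℂ) ^ n) • noiseHermiteDiag hW n h : NoiseL2 P W).1 =ᵐ[P] fun ω =>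
      ((hermiteCoeff (W h ω) (‖h‖ ^ 2) n * t ^ n : ℝ) : ℂ) := by
  filter_upwards [Lp.coeFn_smul ((t : ℂ) ^ n) (noiseHermiteDiag hW n h : Lp ℂ 2 P),
    coe_noiseHermiteDiag hW n h] with ω h1 h2
  rw [Submodule.coe_smul, h1, Pi.smul_apply, h2, smul_eq_mul]
  push_cast
  ring

lemma hasSum_ofReal_hermiteCoeff (hW : IsGaussianWhiteNoise ν P W) (h : Lp ℝ 2 ν) (t : ℝ) :
    ∀ᵐ ω ∂P, HasSum (fun n : ℕ => ((hermiteCoeff (W h ω) (‖h‖ ^ 2) n * t ^ n : ℝ) : ℂ))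
      ((noiseExp hW (t • h) : Lp ℂ 2 P) ω) := by
  filter_upwards [coe_noiseExp hW (t • h), hW.map_smul t h] with ω h5 h6
  rw [h5, h6]
  have h7 := (Complex.ofRealCLM.hasSum (hasSum_hermiteCoeff (W h ω) (‖h‖ ^ 2) t))
  have h8 : t * W h ω - ‖t • h‖ ^ 2 / 2 = W h ω * t - ‖h‖ ^ 2 * t ^ 2 / 2 := by
    rw [norm_smul, mul_pow, Real.norm_eq_abs, sq_abs]
    ring
  rw [h8]
  exact h7

/-- The exponential functionals are the generating functions of the Hermite functionals. -/
lemma hasSum_noiseHermiteDiag (hW : IsGaussianWhiteNoise ν P W) (h : Lp ℝ 2 ν) (t : ℝ) :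
    HasSum (fun n : ℕ => ((t : ℂ) ^ n) • noiseHermiteDiag hW n h) (noiseExp hW (t • h)) := by
  have := completeSpace_noiseL2 hW
  have hsum := summable_norm_smul_noiseHermiteDiag hW h t
  -- Normal convergence provides a sum `F` which is also the almost sure pointwise sum, and the
  -- latter is known from the scalar generating function.
  obtain ⟨F, hS⟩ := noise_summable_of_norm hsum
  suffices key : noiseExp hW (t • h) = F by
    rw [key]
    exact hS
  refine Subtype.ext (Lp.ext ?_)
  have h1 := ae_hasSum_noise hsum hS
  have h2 := ae_all_iff.2 fun n : ℕ => coe_smul_noiseHermiteDiag hW h t n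
  filter_upwards [h1, h2, hasSum_ofReal_hermiteCoeff hW h t] with ω h3 h4 h5
  simp only [h4] at h3
  exact h5.unique h3

lemma hasSum_ofReal_exp_mul (a : ℝ) (t : ℝ) :
    HasSum (fun n : ℕ => ((a ^ n / n.factorial : ℝ) : ℂ) * (t : ℂ) ^ n)
      ((Real.exp (t * a) : ℝ) : ℂ) := by
  have h := Complex.ofRealCLM.hasSum (sumsTo_expSeries a t)
  rw [mul_comm t a]
  convert h using 1
  · ext n
    simp [expSeries]
  · rfl

/-- These are the coefficients in `t` of the inner product `exp (t (g, h))` of the exponentials of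
`g` and `t • h`. -/
lemma inner_noiseExp_noiseHermiteDiag (hW : IsGaussianWhiteNoise ν P W) (m : ℕ)
    (g h : Lp ℝ 2 ν) : inner ℂ (noiseExp hW g) (noiseHermiteDiag hW m h) =
      ((inner ℝ g h ^ m / m.factorial : ℝ) : ℂ) := by
  refine congrFun (coeff_eq_of_hasSum (a := fun m => inner ℂ (noiseExp hW g)
    (noiseHermiteDiag hW m h)) (b := fun m => ((inner ℝ g h ^ m / m.factorial : ℝ) : ℂ)) (G := fun t => ((Real.exp (t * inner ℝ g h) : ℝ) : ℂ))
    (fun k => ?_) (fun k => ?_)) m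
  · have h1 := noise_hasSum_inner (hasSum_noiseHermiteDiag hW h (1 / (k + 1))) (noiseExp hW g)
    simp only [noise_inner_smul_right, inner_noiseExp, real_inner_smul_right] at h1
    simp only [mul_comm (inner ℂ _ _)]
    exact h1
  · exact hasSum_ofReal_exp_mul _ _

/-- Expanding in the other argument as well leaves a single monomial of degree `m`, which gives the
orthogonality of different orders. -/
lemma inner_noiseHermiteDiag (hW : IsGaussianWhiteNoise ν P W) (n m : ℕ) (g h : Lp ℝ 2 ν) :
    inner ℂ (noiseHermiteDiag hW n g) (noiseHermiteDiag hW m h) =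
      ((if n = m then inner ℝ g h ^ n / n.factorial else 0 : ℝ) : ℂ) := by
  rw [← noise_inner_conj_symm (noiseHermiteDiag hW n g)]
  refine (congrArg (starRingEnd ℂ) (congrFun (coeff_eq_of_hasSum
    (a := fun n => inner ℂ (noiseHermiteDiag hW m h) (noiseHermiteDiag hW n g))
    (b := fun n => ((if n = m then inner ℝ g h ^ n / n.factorial else 0 : ℝ) : ℂ))
    (G := fun t => (((t * inner ℝ g h) ^ m / m.factorial : ℝ) : ℂ))
    (fun k => ?_) (fun k => ?_)) n)).trans (Complex.conj_ofReal _)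
  · have h1 := noise_hasSum_inner (hasSum_noiseHermiteDiag hW g (1 / (k + 1)))
      (noiseHermiteDiag hW m h)
    have h2 : inner ℂ (noiseHermiteDiag hW m h) (noiseExp hW ((1 / ((k : ℝ) + 1)) • g)) =
        (((1 / ((k : ℝ) + 1) * inner ℝ g h) ^ m / m.factorial : ℝ) : ℂ) := by
      rw [← noise_inner_conj_symm, inner_noiseExp_noiseHermiteDiag, Complex.conj_ofReal,
        real_inner_smul_left]
    rw [h2] at h1
    simp only [noise_inner_smul_right] at h1
    simp only [mul_comm (inner ℂ _ _)]
    exact h1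
  · convert hasSum_single (f := fun n : ℕ =>
      ((if n = m then inner ℝ g h ^ n / n.factorial else 0 : ℝ) : ℂ) *
        (((1 : ℝ) / (k + 1) : ℝ) : ℂ) ^ n) m (fun n hn => by simp [hn]) using 1
    rw [if_pos rfl, ← Complex.ofReal_pow, ← Complex.ofReal_mul]
    congr 1
    ring

lemma continuous_noiseHermiteDiag (hW : IsGaussianWhiteNoise ν P W) (n : ℕ) :
    Continuous (noiseHermiteDiag hW n) := by
  refine continuous_of_inner_eq (κ := fun x => x ^ n / n.factorial) (by fun_prop) fun f g => ?_
  rw [inner_noiseHermiteDiag, if_pos rfl]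

/-- The generalized Hermite functional as a vector. -/
def noiseHermite (hW : IsGaussianWhiteNoise ν P W) {n : ℕ} (f : Fin n → Lp ℝ 2 ν) :
    NoiseL2 P W :=
  ∑ R : Finset (Fin n), ((-1 : ℂ) ^ R.card) • noiseHermiteDiag hW n (∑ i ∈ Rᶜ, f i)

/-- The sum over `R` that defines the vector is the polarization formula; the `n!` there cancels the
one in the diagonal vectors. -/
lemma coe_noiseHermite (hW : IsGaussianWhiteNoise ν P W) {n : ℕ} (f : Fin n → Lp ℝ 2 ν) :
    (noiseHermite hW f : Lp ℂ 2 P) =ᵐ[P] fun η => ((hermite W f η : ℝ) : ℂ) := by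
  have h1 : (noiseHermite hW f : Lp ℂ 2 P) = ∑ R : Finset (Fin n), ((-1 : ℂ) ^ R.card) •
      (noiseHermiteDiag hW n (∑ i ∈ Rᶜ, f i) : Lp ℂ 2 P) := by
    simp [noiseHermite]
  have h2 : ∀ᵐ ω ∂P, ∀ R : Finset (Fin n), (((-1 : ℂ) ^ R.card) •
      (noiseHermiteDiag hW n (∑ i ∈ Rᶜ, f i) : Lp ℂ 2 P) : Lp ℂ 2 P) ω =
      (((-1) ^ R.card * hermiteCoeff (W (∑ i ∈ Rᶜ, f i) ω) (‖∑ i ∈ Rᶜ, f i‖ ^ 2) n : ℝ) : ℂ) := by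
    rw [ae_all_iff]
    intro R
    filter_upwards [Lp.coeFn_smul ((-1 : ℂ) ^ R.card)
      (noiseHermiteDiag hW n (∑ i ∈ Rᶜ, f i) : Lp ℂ 2 P),
      coe_noiseHermiteDiag hW n (∑ i ∈ Rᶜ, f i)] with ω h1 h2
    rw [h1, Pi.smul_apply, h2, smul_eq_mul]
    push_cast
    ring
  have h3 : ∀ᵐ ω ∂P, ∀ R : Finset (Fin n), W (∑ i ∈ Rᶜ, f i) ω = ∑ i ∈ Rᶜ, W (f i) ω :=
    ae_all_iff.2 fun R => hW.map_sum _ _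
  rw [h1]
  filter_upwards [Lp.coeFn_fun_finsetSum Finset.univ (fun R : Finset (Fin n) =>
    (((-1 : ℂ) ^ R.card) • (noiseHermiteDiag hW n (∑ i ∈ Rᶜ, f i) : Lp ℂ 2 P) : Lp ℂ 2 P)),
    h2, h3] with ω h4 h5 h6
  rw [h4]
  simp only [h5]
  rw [← Complex.ofReal_sum]
  congr 1
  have h7 := sum_neg_one_pow_mul_hermiteSum (fun i => W (f i) ω)
    (fun i j => inner ℝ (f i) (f j)) (fun i j => real_inner_comm _ _)
  rw [← hermite_eq_hermiteSum] at h7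
  have hn : (n.factorial : ℝ) ≠ 0 := by positivity
  rw [← mul_right_inj' hn, ← h7, Finset.mul_sum]
  refine Finset.sum_congr rfl fun R _ => ?_
  rw [h6, ← hermiteSum_const, ← real_inner_self_eq_norm_sq, sum_inner]
  simp only [inner_sum]
  field_simp

lemma continuous_noiseHermite (hW : IsGaussianWhiteNoise ν P W) (n : ℕ) :
    Continuous fun f : Fin n → Lp ℝ 2 ν => noiseHermite hW f := by
  unfold noiseHermite
  refine continuous_finsetSum _ fun R _ => ?_
  have h1 : Continuous fun f : Fin n → Lp ℝ 2 ν => noiseHermiteDiag hW n (∑ i ∈ Rᶜ, f i) :=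
    (continuous_noiseHermiteDiag hW n).comp (by fun_prop)
  exact h1.const_smul ((-1 : ℂ) ^ R.card)

lemma inner_noiseHermite_of_ne (hW : IsGaussianWhiteNoise ν P W) {n m : ℕ} (hnm : n ≠ m)
    (f : Fin n → Lp ℝ 2 ν) (g : Fin m → Lp ℝ 2 ν) :
    inner ℂ (noiseHermite hW f) (noiseHermite hW g) = 0 := by
  simp only [noiseHermite, sum_inner, inner_sum]
  simp only [noise_inner_smul_left, noise_inner_smul_right,
    inner_noiseHermiteDiag, if_neg hnm, Complex.ofReal_zero, mul_zero, Finset.sum_const_zero]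

lemma wienerChaos_eq (hW : IsGaussianWhiteNoise ν P W) (n : ℕ) : wienerChaos P W n =
    (Submodule.span ℂ (Set.range fun f : Fin n → Lp ℝ 2 ν =>
      noiseHermite hW f)).topologicalClosure := by
  unfold wienerChaos
  congr 2
  ext F
  refine ⟨fun ⟨f, hf⟩ => ⟨f, Subtype.ext (Lp.ext ?_)⟩, fun ⟨f, hf⟩ => ⟨f, ?_⟩⟩
  · exact (coe_noiseHermite hW f).trans hf.symm
  · rw [← hf]
    exact coe_noiseHermite hW f

lemma noiseHermiteDiag_mem_wienerChaos (hW : IsGaussianWhiteNoise ν P W) (n : ℕ)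
    (h : Lp ℝ 2 ν) : noiseHermiteDiag hW n h ∈ wienerChaos P W n := by
  have h1 : noiseHermite hW (fun _ : Fin n => h) =
      (n.factorial : ℂ) • noiseHermiteDiag hW n h := by
    refine Subtype.ext (Lp.ext ?_)
    rw [Submodule.coe_smul]
    filter_upwards [coe_noiseHermite hW (fun _ : Fin n => h), coe_noiseHermiteDiag hW n h,
      Lp.coeFn_smul (n.factorial : ℂ) (noiseHermiteDiag hW n h : Lp ℂ 2 P)] with ω h2 h3 h4
    rw [h2, h4, Pi.smul_apply, h3, hermite_eq_hermiteSum, ← hermiteSum_const,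
      real_inner_self_eq_norm_sq, smul_eq_mul, ← Complex.ofReal_natCast, ← Complex.ofReal_mul]
    congr 1
    field_simp
  have h2 : noiseHermiteDiag hW n h =
      (n.factorial : ℂ)⁻¹ • noiseHermite hW (fun _ : Fin n => h) := by
    rw [h1, smul_smul, inv_mul_cancel₀, one_smul]
    exact_mod_cast n.factorial_ne_zero
  rw [h2, wienerChaos_eq hW]
  exact Submodule.smul_mem _ _ (Submodule.le_topologicalClosure _
    (Submodule.subset_span ⟨_, rfl⟩))

/-- The Wiener chaos decomposition. -/
lemma isOrthogonalDecomposition_wienerChaos (hW : IsGaussianWhiteNoise ν P W) :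
    IsOrthogonalDecomposition (wienerChaos P W) := by
  refine ⟨fun n => Submodule.isClosed_topologicalClosure _, fun m n hmn => ?_, ?_⟩
  · rw [wienerChaos_eq hW, wienerChaos_eq hW]
    rw [Submodule.isOrtho_iff_le, Submodule.orthogonal_closure]
    refine Submodule.topologicalClosure_minimal _ ?_ (Submodule.isClosed_orthogonal _)
    rw [← Submodule.isOrtho_iff_le, Submodule.isOrtho_span]
    rintro _ ⟨f, rfl⟩ _ ⟨g, rfl⟩
    exact inner_noiseHermite_of_ne hW hmn f g
  · rw [eq_top_iff, ← span_noiseExp_topologicalClosure hW]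
    refine Submodule.topologicalClosure_minimal _ (Submodule.span_le.2 ?_)
      (Submodule.isClosed_topologicalClosure _)
    rintro _ ⟨h, rfl⟩
    -- At `t = 1` each exponential is a limit of sums of chaos vectors, and the exponentials are
    -- total.
    have h1 := hasSum_noiseHermiteDiag hW h 1
    rw [one_smul] at h1
    refine (Submodule.isClosed_topologicalClosure _).mem_of_tendsto h1
      (Eventually.of_forall fun s => ?_)
    refine Submodule.le_topologicalClosure _ (Submodule.sum_mem _ fun n _ => ?_)
    exact Submodule.smul_mem _ _ (Submodule.mem_iSup_of_mem n
      (noiseHermiteDiag_mem_wienerChaos hW n h))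

end Hermite

end GaussPoisson

end

noncomputable section

namespace GaussPoisson

/-! ### First moments of the Poisson process -/

namespace Configuration

section

variable {X : Type*} [MeasurableSpace X]

/-- A configuration as a counting measure. -/
def toMeasure (ω : Configuration X) : Measure X :=
  Measure.sum fun x => (ω.mult x : ℝ≥0∞) • Measure.dirac x

lemma toMeasure_apply (ω : Configuration X) {A : Set X} (hA : MeasurableSet A) :
    ω.toMeasure A = ω.count A := by
  rw [toMeasure, Measure.sum_apply _ hA, count, tsum_subtype A fun x => (ω.mult x : ℝ≥0∞)]
  refine tsum_congr fun x => ?_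
  rw [Measure.smul_apply, Measure.dirac_apply' _ hA, smul_eq_mul]
  by_cases hx : x ∈ A <;> simp [hx]

lemma measurable_count {A : Set X} (hA : MeasurableSet A) :
    Measurable fun ω : Configuration X => ω.count A :=
  measurable_iff_comap_le.2 (le_iSup₂ (f := fun (A : Set X) (_ : MeasurableSet A) =>
    MeasurableSpace.comap (fun ω : Configuration X => ω.count A) inferInstance) A hA)

lemma measurable_toMeasure : Measurable (toMeasure : Configuration X → Measure X) := by
  refine Measure.measurable_of_measurable_coe _ fun A hA => ?_
  simp only [toMeasure_apply _ hA]
  exact measurable_count hA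

lemma lintegral_toMeasure (ω : Configuration X) {g : X → ℝ≥0∞} (hg : Measurable g) :
    ∫⁻ x, g x ∂ω.toMeasure = ∑' x, (ω.mult x : ℝ≥0∞) * g x := by
  rw [toMeasure, lintegral_sum_measure]
  refine tsum_congr fun x => ?_
  rw [lintegral_smul_measure, lintegral_dirac' _ hg, smul_eq_mul]

end

variable {X : Type*}

lemma finite_support_inter (ω : Configuration X) {S : Set X} (hS : ω.count S ≠ ∞) :
    (S ∩ Function.support ω.mult).Finite := by
  have h1 := ENNReal.finite_const_le_of_tsum_ne_top hS one_ne_zero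
  refine (h1.image Subtype.val).subset ?_
  rintro x ⟨hx, hm⟩
  refine ⟨⟨x, hx⟩, ?_, rfl⟩
  have : 1 ≤ ω.mult x := Nat.one_le_iff_ne_zero.2 hm
  exact_mod_cast this

/-- The number of points in `A`, as a natural number (zero if there are infinitely many). -/
def natCount (ω : Configuration X) (A : Set X) : ℕ := ⌊(ω.count A).toReal⌋₊

open Classical in
lemma count_eq_sum (ω : Configuration X) {Z : Finset X} {A : Set X}
    (hZ : ∀ x ∈ A, ω.mult x ≠ 0 → x ∈ Z) :
    ω.count A = ((∑ z ∈ Z with z ∈ A, ω.mult z : ℕ) : ℝ≥0∞) := by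
  rw [count, tsum_subtype A fun x => (ω.mult x : ℝ≥0∞), tsum_eq_sum (s := Z)]
  · rw [Finset.sum_filter]
    push_cast
    refine Finset.sum_congr rfl fun x _ => ?_
    by_cases hx : x ∈ A <;> simp [hx]
  · intro x hx
    by_cases hA : x ∈ A
    · rw [Set.indicator_of_mem hA]
      by_contra h0
      exact hx (hZ x hA fun h => h0 (by simp [h]))
    · rw [Set.indicator_of_notMem hA]

open Classical in
lemma natCount_eq_sum (ω : Configuration X) {Z : Finset X} {A : Set X}
    (hZ : ∀ x ∈ A, ω.mult x ≠ 0 → x ∈ Z) :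
    ω.natCount A = ∑ z ∈ Z with z ∈ A, ω.mult z := by
  rw [natCount, count_eq_sum ω hZ, ENNReal.toReal_natCast, Nat.floor_natCast]

lemma coe_natCount (ω : Configuration X) {A : Set X} (hA : ω.count A ≠ ∞) :
    (ω.natCount A : ℝ≥0∞) = ω.count A := by
  have hZ : ∀ x ∈ A, ω.mult x ≠ 0 → x ∈ (ω.finite_support_inter hA).toFinset := by
    intro x hx hm
    simpa using ⟨hx, hm⟩
  rw [natCount_eq_sum ω hZ, count_eq_sum ω hZ]

lemma measurable_natCount [MeasurableSpace X] {A : Set X} (hA : MeasurableSet A) :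
    Measurable fun ω : Configuration X => ω.natCount A :=
  Nat.measurable_floor.comp (measurable_count hA).ennreal_toReal

lemma sum_eq_finsetSum (ω : Configuration X) {Z : Finset X} {f : X → ℝ}
    (hZ : ∀ x, f x ≠ 0 → ω.mult x ≠ 0 → x ∈ Z) : ω.sum f = ∑ z ∈ Z, (ω.mult z : ℝ) * f z := by
  rw [sum, tsum_eq_sum]
  intro x hx
  by_contra h0
  exact hx (hZ x (fun h => h0 (by simp [h])) fun h => h0 (by simp [h]))

lemma prod_eq_finsetProd (ω : Configuration X) {Z : Finset X} {f : X → ℝ}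
    (hZ : ∀ x, f x ≠ 0 → ω.mult x ≠ 0 → x ∈ Z) :
    ω.prod (fun x => 1 + f x) = ∏ z ∈ Z, (1 + f z) ^ ω.mult z := by
  rw [prod, tprod_eq_prod]
  intro x hx
  by_contra h0
  refine hx (hZ x (fun h => h0 (by simp [h])) fun h => h0 (by simp [h]))

lemma sum_congr (ω : Configuration X) {f g : X → ℝ} (h : ∀ x, ω.mult x ≠ 0 → f x = g x) :
    ω.sum f = ω.sum g := by
  refine tsum_congr fun x => ?_
  by_cases hx : ω.mult x = 0
  · simp [hx]
  · rw [h x hx]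

lemma prod_congr (ω : Configuration X) {f g : X → ℝ} (h : ∀ x, ω.mult x ≠ 0 → f x = g x) :
    ω.prod f = ω.prod g := by
  refine tprod_congr fun x => ?_
  by_cases hx : ω.mult x = 0
  · simp [hx]
  · rw [h x hx]

end Configuration

section Poisson

open GaussPoisson.Configuration

variable {X : Type*} [MeasurableSpace X] {ν : Measure X} {Q : Measure (Configuration X)}
  [IsProbabilityMeasure Q]

lemma hasSum_poisson_ofReal {a : ℝ} (ha : 0 ≤ a) :
    HasSum (fun k : ℕ => ENNReal.ofReal (a ^ k / (k.factorial : ℝ) * Real.exp (-a))) 1 := by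
  have h := hasSum_one_poissonMeasure a.toNNReal
  rw [Real.coe_toNNReal a ha] at h
  have h2 := ENNReal.summable.hasSum
    (f := fun k : ℕ => ENNReal.ofReal (a ^ k / (k.factorial : ℝ) * Real.exp (-a)))
  convert h2 using 1
  rw [← ENNReal.ofReal_tsum_of_nonneg (fun k => by positivity)]
  · rw [← ENNReal.ofReal_one, ← h.tsum_eq]
    congr 1
    refine tsum_congr fun k => ?_
    ring
  · refine h.summable.congr fun k => ?_
    ring

/-- The Poisson probabilities of the finite values already sum to one. -/
lemma IsPoissonProcess.ae_count_ne_top (hQ : IsPoissonProcess ν Q) {A : Set X}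
    (hA : MeasurableSet A) (hν : ν A ≠ ∞) : ∀ᵐ ω ∂Q, ω.count A ≠ ∞ := by
  have h1 : Q (⋃ k : ℕ, {ω | ω.count A = k}) = 1 := by
    rw [measure_iUnion]
    · simp only [hQ.poisson A hA hν]
      exact (hasSum_poisson_ofReal ENNReal.toReal_nonneg).tsum_eq
    · intro i j hij
      refine Set.disjoint_left.2 fun ω hi hj => hij ?_
      have : (i : ℝ≥0∞) = j := hi.symm.trans hj
      exact_mod_cast this
    · intro k
      exact measurable_count hA (measurableSet_singleton _)
  have h2 : ∀ᵐ ω ∂Q, ω ∈ ⋃ k : ℕ, {ω : Configuration X | ω.count A = k} := by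
    rw [← prob_compl_eq_zero_iff] at h1
    · exact h1
    · exact MeasurableSet.iUnion fun k => measurable_count hA (measurableSet_singleton _)
  filter_upwards [h2] with ω hω
  obtain ⟨k, hk⟩ := Set.mem_iUnion.1 hω
  rw [show ω.count A = k from hk]
  exact ENNReal.natCast_ne_top k

lemma IsPoissonProcess.map_natCount (hQ : IsPoissonProcess ν Q) {A : Set X}
    (hA : MeasurableSet A) (hν : ν A ≠ ∞) :
    Q.map (fun ω => ω.natCount A) = poissonMeasure (ν A).toNNReal := by
  refine Measure.ext_of_singleton fun k => ?_
  rw [Measure.map_apply (measurable_natCount hA) (measurableSet_singleton _),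
    poissonMeasure_singleton]
  have h1 : (fun ω : Configuration X => ω.natCount A) ⁻¹' {k} =ᵐ[Q] {ω | ω.count A = k} := by
    filter_upwards [hQ.ae_count_ne_top hA hν] with ω hω
    refine propext ⟨fun h => ?_, fun h => ?_⟩
    · have h' : ω.natCount A = k := h
      change ω.count A = k
      rw [← coe_natCount ω hω, h']
    · have h' : ω.count A = k := h
      change ω.natCount A = k
      rw [natCount, h', ENNReal.toReal_natCast, Nat.floor_natCast]
  rw [measure_congr h1, hQ.poisson A hA hν k]
  congr 1
  rw [ENNReal.coe_toNNReal_eq_toReal]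
  ring

lemma hasSum_exp_mul_pow (a x : ℝ) :
    HasSum (fun k : ℕ => Real.exp (-a) * a ^ k / k.factorial * x ^ k)
      (Real.exp (a * (x - 1))) := by
  have h := (NormedSpace.expSeries_div_hasSum_exp (a * x)).mul_left (Real.exp (-a))
  rw [← Real.exp_eq_exp_ℝ, ← Real.exp_add] at h
  refine hasSum_of_eq h (fun k => ?_) (by ring_nf)
  rw [mul_pow]
  ring

lemma IsPoissonProcess.integral_pow_natCount (hQ : IsPoissonProcess ν Q) {A : Set X}
    (hA : MeasurableSet A) (hν : ν A ≠ ∞) (c : ℝ) :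
    ∫ ω, (1 + c) ^ ω.natCount A ∂Q = Real.exp ((ν A).toReal * c) := by
  have h1 : ∫ k : ℕ, (1 + c) ^ k ∂(Q.map fun ω => ω.natCount A) =
      ∫ ω, (1 + c) ^ ω.natCount A ∂Q :=
    integral_map (measurable_natCount hA).aemeasurable (by fun_prop)
  rw [← h1, hQ.map_natCount hA hν, integral_poissonMeasure]
  have h2 := (hasSum_exp_mul_pow (ν A).toReal (1 + c)).tsum_eq
  rw [add_sub_cancel_left] at h2
  rw [← h2]
  rfl

lemma IsPoissonProcess.lintegral_count_of_ne_top (hQ : IsPoissonProcess ν Q) {A : Set X}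
    (hA : MeasurableSet A) (hν : ν A ≠ ∞) : ∫⁻ ω, ω.count A ∂Q = ν A := by
  have h1 : ∫⁻ ω, ω.count A ∂Q = ∫⁻ k : ℕ, (k : ℝ≥0∞) ∂(Q.map fun ω => ω.natCount A) := by
    rw [lintegral_map (by fun_prop) (measurable_natCount hA)]
    refine lintegral_congr_ae ?_
    filter_upwards [hQ.ae_count_ne_top hA hν] with ω hω
    rw [coe_natCount ω hω]
  rw [h1, hQ.map_natCount hA hν, lintegral_countable']
  simp only [poissonMeasure_singleton]
  -- The term at zero vanishes; after the shift the factor `k + 1` cancels in the factorial, leaving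
  -- `ν A` times the total mass.
  rw [tsum_eq_zero_add' ENNReal.summable]
  simp only [Nat.cast_zero, zero_mul, zero_add]
  have h2 : ∀ k : ℕ, ((k + 1 : ℕ) : ℝ≥0∞) * ENNReal.ofReal (Real.exp (-((ν A).toNNReal : ℝ)) *
      ((ν A).toNNReal : ℝ) ^ (k + 1) / (k + 1).factorial) =
      ν A * ENNReal.ofReal ((ν A).toReal ^ k / (k.factorial : ℝ) * Real.exp (-(ν A).toReal)) := by
    intro k
    conv_rhs => rw [← ENNReal.ofReal_toReal hν]
    rw [← ENNReal.ofReal_natCast, ← ENNReal.ofReal_mul (by positivity),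
      ← ENNReal.ofReal_mul (by positivity), ENNReal.coe_toNNReal_eq_toReal,
      ENNReal.ofReal_toReal hν]
    congr 1
    rw [Nat.factorial_succ]
    push_cast
    rw [pow_succ']
    field_simp
  simp only [h2]
  rw [ENNReal.tsum_mul_left, (hasSum_poisson_ofReal ENNReal.toReal_nonneg).tsum_eq, mul_one]

variable [SigmaFinite ν]

/-- The mean measure of the Poisson process. -/
lemma IsPoissonProcess.bind_toMeasure (hQ : IsPoissonProcess ν Q) : Q.bind toMeasure = ν := by
  rw [Measure.ext_iff_of_iUnion_eq_univ (iUnion_spanningSets ν)]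
  intro k
  ext A hA
  have hm := hA.inter (measurableSet_spanningSets ν k)
  rw [Measure.restrict_apply hA, Measure.restrict_apply hA,
    Measure.bind_apply hm measurable_toMeasure.aemeasurable]
  simp only [toMeasure_apply _ hm]
  exact hQ.lintegral_count_of_ne_top hm
    (measure_ne_top_of_subset Set.inter_subset_right (measure_spanningSets_lt_top ν k).ne)

/-- Campbell's formula, from the identification of the mean of the random counting measure with `ν`.
Null sets and sums over configurations are controlled through it. -/
lemma IsPoissonProcess.lintegral_tsum (hQ : IsPoissonProcess ν Q) {g : X → ℝ≥0∞}
    (hg : Measurable g) :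
    ∫⁻ ω : Configuration X, ∑' x, (ω.mult x : ℝ≥0∞) * g x ∂Q = ∫⁻ x, g x ∂ν := by
  conv_rhs => rw [← hQ.bind_toMeasure]
  rw [Measure.lintegral_bind measurable_toMeasure.aemeasurable hg.aemeasurable]
  simp only [lintegral_toMeasure _ hg]

lemma measurable_tsum_mult {g : X → ℝ≥0∞} (hg : Measurable g) :
    Measurable fun ω : Configuration X => ∑' x, (ω.mult x : ℝ≥0∞) * g x := by
  simp only [← lintegral_toMeasure _ hg]
  exact (Measure.measurable_lintegral hg).comp measurable_toMeasure

/-- Almost surely, all points of the configuration avoid a given null set. -/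
lemma IsPoissonProcess.ae_forall_mult (hQ : IsPoissonProcess ν Q) {p : X → Prop}
    (hp : ∀ᵐ x ∂ν, p x) : ∀ᵐ ω ∂Q, ∀ x, ω.mult x ≠ 0 → p x := by
  obtain ⟨T, hpT, hT, hT0⟩ := exists_measurable_superset_of_null (ae_iff.1 hp)
  have hm : Measurable (T.indicator (1 : X → ℝ≥0∞)) := measurable_one.indicator hT
  have h1 := hQ.lintegral_tsum hm
  rw [lintegral_indicator_one hT, hT0, lintegral_eq_zero_iff (measurable_tsum_mult hm)] at h1
  filter_upwards [h1] with ω hω x hx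
  by_contra hpx
  have h2 := ENNReal.tsum_eq_zero.1 hω x
  rw [Set.indicator_of_mem (hpT hpx)] at h2
  simp [hx] at h2

lemma IsPoissonProcess.ae_summable (hQ : IsPoissonProcess ν Q) {f : X → ℝ} (hf : Measurable f)
    (hi : Integrable f ν) : ∀ᵐ ω ∂Q, Summable fun x => (ω.mult x : ℝ) * |f x| := by
  have hm : Measurable fun x => ‖f x‖ₑ := hf.enorm
  have h1 := hQ.lintegral_tsum hm
  have h2 : ∫⁻ ω : Configuration X, ∑' x, (ω.mult x : ℝ≥0∞) * ‖f x‖ₑ ∂Q ≠ ∞ := by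
    rw [h1]
    exact hi.2.ne
  filter_upwards [ae_lt_top (measurable_tsum_mult hm) h2] with ω hω
  refine (ENNReal.summable_toReal hω.ne).congr fun x => ?_
  simp

lemma IsPoissonProcess.ae_count_spanningSets (hQ : IsPoissonProcess ν Q) :
    ∀ᵐ ω ∂Q, ∀ k, ω.count (spanningSets ν k) ≠ ∞ :=
  ae_all_iff.2 fun k => hQ.ae_count_ne_top (measurableSet_spanningSets ν k)
    (measure_spanningSets_lt_top ν k).ne

end Poisson

end GaussPoisson

end

noncomputable section

namespace GaussPoisson

/-! ### Multiplicative functionals of the Poisson process -/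

/-- Induction through `(1 + u) ^ (m + 1) - 1 = (1 + u) * ((1 + u) ^ m - 1) + u`. It supplies
majorants for infinite products with multiplicities. -/
lemma abs_one_add_pow_sub_one_le {u b : ℝ} (hu : |u| ≤ b) (m : ℕ) :
    |(1 + u) ^ m - 1| ≤ (1 + b) ^ m - 1 := by
  have hb : 0 ≤ b := (abs_nonneg u).trans hu
  induction m with
  | zero => simp
  | succ m ih =>
    have h1 : (1 + u) ^ (m + 1) - 1 = (1 + u) * ((1 + u) ^ m - 1) + u := by ring
    have h2 : (1 + b) ^ (m + 1) - 1 = (1 + b) * ((1 + b) ^ m - 1) + b := by ring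
    have h3 : |1 + u| ≤ 1 + b := by
      refine (abs_add_le _ _).trans ?_
      rw [abs_one]
      gcongr
    rw [h1, h2]
    refine (abs_add_le _ _).trans (add_le_add ?_ hu)
    rw [abs_mul]
    exact mul_le_mul h3 ih (abs_nonneg _) (by positivity)

lemma one_add_pow_sub_one_le {b : ℝ} (hb : 0 ≤ b) (m : ℕ) :
    (1 + b) ^ m - 1 ≤ m * b * Real.exp (m * b) := by
  have h1 : (1 + b) ^ m ≤ Real.exp (m * b) := by
    rw [Real.exp_nat_mul]
    refine pow_le_pow_left₀ (by positivity) ?_ _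
    rw [add_comm]
    exact Real.add_one_le_exp b
  have h2 := Real.add_one_le_exp (-(m * b))
  have h3 : Real.exp (m * b) * Real.exp (-(m * b)) = 1 := by
    rw [← Real.exp_add, add_neg_cancel, Real.exp_zero]
  nlinarith [Real.exp_pos (m * b)]

namespace Configuration

variable {X : Type*}

/-- Each `m b` is at most the total sum, so `m b exp (m b)` is at most a fixed multiple of `m b`. -/
lemma summable_one_add_pow_sub_one (ω : Configuration X) {b : X → ℝ} (hb : ∀ x, 0 ≤ b x)
    (hs : Summable fun x => (ω.mult x : ℝ) * b x) :
    Summable fun x => (1 + b x) ^ ω.mult x - 1 := by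
  have h0 : ∀ x, 0 ≤ (ω.mult x : ℝ) * b x := fun x => mul_nonneg (Nat.cast_nonneg _) (hb x)
  refine Summable.of_nonneg_of_le (fun x => ?_) (fun x => ?_)
    (hs.mul_right (Real.exp (∑' x, (ω.mult x : ℝ) * b x)))
  · exact (abs_nonneg _).trans (abs_one_add_pow_sub_one_le (abs_of_nonneg (hb x)).le (ω.mult x))
  · refine (one_add_pow_sub_one_le (hb x) _).trans ?_
    have h1 : (ω.mult x : ℝ) * b x ≤ ∑' x, (ω.mult x : ℝ) * b x :=
      hs.le_tsum x fun j _ => h0 j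
    exact mul_le_mul_of_nonneg_left (Real.exp_le_exp.2 h1) (h0 x)

lemma tendsto_prod (ω : Configuration X) {u : X → ℝ} {v : ℕ → X → ℝ} {b : X → ℝ}
    (hv : ∀ j x, |v j x| ≤ b x) (hs : Summable fun x => (ω.mult x : ℝ) * b x)
    (h : ∀ x, Tendsto (fun j => v j x) atTop (𝓝 (u x))) :
    Tendsto (fun j => ω.prod fun x => 1 + v j x) atTop (𝓝 (ω.prod fun x => 1 + u x)) := by
  have h1 := tendsto_tprod_one_add_of_dominated_convergence (𝓕 := atTop)
    (f := fun j x => (1 + v j x) ^ ω.mult x - 1) (g := fun x => (1 + u x) ^ ω.mult x - 1)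
    (ω.summable_one_add_pow_sub_one (fun x => (abs_nonneg _).trans (hv 0 x)) hs)
    (fun x => (((h x).const_add 1).pow _).sub_const 1)
    (Eventually.of_forall fun j x => abs_one_add_pow_sub_one_le (hv j x) _)
  simpa only [add_sub_cancel, prod] using h1

lemma multipliable_one_add (ω : Configuration X) {u : X → ℝ}
    (hs : Summable fun x => (ω.mult x : ℝ) * |u x|) :
    Multipliable fun x => (1 + u x) ^ ω.mult x := by
  have h1 : Summable fun x => ‖(1 + u x) ^ ω.mult x - 1‖ :=
    Summable.of_nonneg_of_le (fun x => norm_nonneg _)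
      (fun x => abs_one_add_pow_sub_one_le le_rfl _)
      (ω.summable_one_add_pow_sub_one (fun x => abs_nonneg (u x)) hs)
  simpa only [add_sub_cancel] using multipliable_one_add_of_summable h1

lemma abs_prod_le (ω : Configuration X) {u b : X → ℝ} (hu : ∀ x, |u x| ≤ b x)
    (hs : Summable fun x => (ω.mult x : ℝ) * b x) :
    |ω.prod fun x => 1 + u x| ≤ ω.prod fun x => 1 + b x := by
  have hb : ∀ x, 0 ≤ b x := fun x => (abs_nonneg _).trans (hu x)
  have h1 : Multipliable fun x => (1 + u x) ^ ω.mult x := by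
    refine ω.multipliable_one_add (Summable.of_nonneg_of_le (fun x => ?_) (fun x => ?_) hs)
    · positivity
    · exact mul_le_mul_of_nonneg_left (hu x) (Nat.cast_nonneg _)
  have h2 : Multipliable fun x => (1 + b x) ^ ω.mult x := by
    refine ω.multipliable_one_add (hs.congr fun x => ?_)
    rw [abs_of_nonneg (hb x)]
  refine le_of_tendsto_of_tendsto' (h1.hasProd.norm) h2.hasProd fun s => ?_
  refine Finset.prod_le_prod (fun x _ => norm_nonneg _) fun x _ => ?_
  rw [norm_pow]
  refine pow_le_pow_left₀ (norm_nonneg _) ?_ _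
  refine (norm_add_le _ _).trans ?_
  rw [norm_one, Real.norm_eq_abs]
  gcongr
  exact hu x

lemma prod_mul_prod (ω : Configuration X) {u v : X → ℝ}
    (hu : Summable fun x => (ω.mult x : ℝ) * |u x|)
    (hv : Summable fun x => (ω.mult x : ℝ) * |v x|) :
    (ω.prod fun x => 1 + u x) * (ω.prod fun x => 1 + v x) =
      ω.prod fun x => 1 + (u x + v x + u x * v x) := by
  rw [prod, prod, ← (ω.multipliable_one_add hu).tprod_mul (ω.multipliable_one_add hv)]
  refine tprod_congr fun x => ?_
  rw [← mul_pow]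
  congr 1
  ring

open Classical in
/-- The nonzero values of a simple function. -/
def nonzeroRange [MeasurableSpace X] (u : SimpleFunc X ℝ) : Finset ℝ := u.range.filter (· ≠ 0)

open Classical in
-- Points are grouped by the value of `u`. The value zero contributes factors one, so only level
-- sets with finite counts matter.
lemma prod_simpleFunc [MeasurableSpace X] (ω : Configuration X) (u : SimpleFunc X ℝ)
    (hω : ∀ c, c ≠ 0 → ω.count (u ⁻¹' {c}) ≠ ∞) :
    ω.prod (fun x => 1 + u x) = ∏ c ∈ nonzeroRange u, (1 + c) ^ ω.natCount (u ⁻¹' {c}) := by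
  have hfin : ((⋃ c ∈ nonzeroRange u, (u ⁻¹' {c})) ∩ Function.support ω.mult).Finite := by
    rw [Set.iUnion₂_inter]
    refine Set.Finite.biUnion (Finset.finite_toSet _) fun c hc => ?_
    exact ω.finite_support_inter (hω c (Finset.mem_filter.1 hc).2)
  have hZ : ∀ x, u x ≠ 0 → ω.mult x ≠ 0 → x ∈ hfin.toFinset := by
    intro x hx hm
    rw [Set.Finite.mem_toFinset]
    refine ⟨Set.mem_iUnion₂.2 ⟨u x, ?_, rfl⟩, hm⟩
    exact Finset.mem_filter.2 ⟨u.mem_range_self x, hx⟩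
  rw [ω.prod_eq_finsetProd hZ]
  have h1 : ∀ c ∈ nonzeroRange u, (1 + c) ^ ω.natCount (u ⁻¹' {c}) =
      ∏ z ∈ hfin.toFinset with u z = c, (1 + u z) ^ ω.mult z := by
    intro c hc
    rw [ω.natCount_eq_sum (Z := hfin.toFinset), ← Finset.prod_pow_eq_pow_sum]
    · refine Finset.prod_congr (by ext; simp) fun z hz => ?_
      rw [(Finset.mem_filter.1 hz).2]
    · intro x hx hm
      refine hZ x ?_ hm
      rw [show u x = c from hx]
      exact (Finset.mem_filter.1 hc).2
  rw [Finset.prod_congr rfl h1]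
  refine (Finset.prod_fiberwise_of_maps_to (g := fun z => u z) (fun z hz => ?_) _).symm
  rw [Set.Finite.mem_toFinset] at hz
  obtain ⟨c, hc, hz⟩ := Set.mem_iUnion₂.1 hz.1
  rwa [show u z = c from hz]

end Configuration

section Poisson

open GaussPoisson.Configuration

variable {X : Type*} [MeasurableSpace X] {ν : Measure X} {Q : Measure (Configuration X)}

lemma IsPoissonProcess.iIndepFun_natCount (hQ : IsPoissonProcess ν Q) {ι : Type*} [Fintype ι]
    {A : ι → Set X} (hA : ∀ i, MeasurableSet (A i)) (hd : Pairwise (Function.onFun Disjoint A)) :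
    iIndepFun (fun i (ω : Configuration X) => ω.natCount (A i)) Q := by
  let e := Fintype.equivFin ι
  have h1 := (hQ.indep _ (fun k => A (e.symm k)) (fun k => hA _)
    (fun k l hkl => hd (e.symm.injective.ne hkl))).precomp e.injective
  simp only [Equiv.symm_apply_apply] at h1
  exact h1.comp (fun _ c => ⌊c.toReal⌋₊)
    fun _ => Nat.measurable_floor.comp ENNReal.measurable_toReal

variable [IsProbabilityMeasure Q]

lemma IsPoissonProcess.ae_prod_simpleFunc (hQ : IsPoissonProcess ν Q) (u : SimpleFunc X ℝ)
    (hu : Integrable u ν) : ∀ᵐ ω ∂Q, ω.prod (fun x => 1 + u x) =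
      ∏ c : nonzeroRange u,
        (1 + (c : ℝ)) ^ ω.natCount (u ⁻¹' {(c : ℝ)}) := by
  have h1 : ∀ᵐ ω ∂Q, ∀ c : nonzeroRange u,
      ω.count (u ⁻¹' {(c : ℝ)}) ≠ ∞ :=
    ae_all_iff.2 fun c => hQ.ae_count_ne_top (u.measurableSet_preimage _)
      (SimpleFunc.integrable_iff.1 hu c (Finset.mem_filter.1 c.2).2).ne
  filter_upwards [h1] with ω hω
  rw [prod_simpleFunc]
  · rw [← Finset.prod_coe_sort]
  · intro c hc
    by_cases hr : c ∈ u.range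
    · exact hω ⟨c, Finset.mem_filter.2 ⟨hr, hc⟩⟩
    · rw [(SimpleFunc.preimage_eq_empty_iff u c).2 hr]
      simp [count]

lemma IsPoissonProcess.aestronglyMeasurable_prod_simpleFunc (hQ : IsPoissonProcess ν Q)
    (u : SimpleFunc X ℝ) (hu : Integrable u ν) :
    AEStronglyMeasurable (fun ω : Configuration X => ω.prod fun x => 1 + u x) Q := by
  refine AEStronglyMeasurable.congr ?_ (EventuallyEq.symm (hQ.ae_prod_simpleFunc u hu))
  refine Measurable.aestronglyMeasurable (Finset.measurable_prod _ fun c _ => ?_)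
  exact (measurable_from_nat (f := fun k : ℕ => (1 + (c : ℝ)) ^ k)).comp
    (measurable_natCount (u.measurableSet_preimage _))

/-- Counts in disjoint level sets are independent, so the expectation is a product of Poisson
probability generating functions. -/
lemma IsPoissonProcess.integral_prod_simpleFunc (hQ : IsPoissonProcess ν Q)
    (u : SimpleFunc X ℝ) (hu : Integrable u ν) :
    ∫ ω : Configuration X, (ω.prod fun x => 1 + u x) ∂Q = Real.exp (∫ x, u x ∂ν) := by
  rw [integral_congr_ae (hQ.ae_prod_simpleFunc u hu)]
  have hind := hQ.iIndepFun_natCount (A := fun c : nonzeroRange u =>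
    u ⁻¹' {(c : ℝ)}) (fun c => u.measurableSet_preimage _) fun c d hcd =>
      Disjoint.preimage _ (Set.disjoint_singleton.2 fun h => hcd (Subtype.ext h))
  rw [hind.integral_fun_prod_comp (f := fun (c : nonzeroRange u) (k : ℕ) => (1 + (c : ℝ)) ^ k)
    (fun c => (measurable_natCount (u.measurableSet_preimage _)).aemeasurable)
    (fun c => measurable_from_nat.aestronglyMeasurable)]
  have h1 : ∀ c : nonzeroRange u,
      ∫ ω : Configuration X, (1 + (c : ℝ)) ^ ω.natCount (u ⁻¹' {(c : ℝ)}) ∂Q =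
        Real.exp (ν.real (u ⁻¹' {(c : ℝ)}) * c) := fun c =>
    hQ.integral_pow_natCount (u.measurableSet_preimage _)
      (SimpleFunc.integrable_iff.1 hu c (Finset.mem_filter.1 c.2).2).ne _
  simp only [h1]
  rw [← Real.exp_sum, ← SimpleFunc.integral_eq_integral u hu, SimpleFunc.integral_eq_sum_filter]
  simp only [smul_eq_mul]
  rw [Finset.sum_coe_sort (nonzeroRange u) fun c => ν.real (u ⁻¹' {c}) * c, nonzeroRange]

variable [SigmaFinite ν]

/-- The simple functions that approximate an integrable function. -/
def simpleApprox (u : X → ℝ) (hu : Measurable u) (n : ℕ) : SimpleFunc X ℝ :=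
  SimpleFunc.approxOn u hu Set.univ 0 (Set.mem_univ _) n

lemma tendsto_simpleApprox (u : X → ℝ) (hu : Measurable u) (x : X) :
    Tendsto (fun n => simpleApprox u hu n x) atTop (𝓝 (u x)) :=
  SimpleFunc.tendsto_approxOn hu (Set.mem_univ _) (by simp)

lemma abs_simpleApprox_le (u : X → ℝ) (hu : Measurable u) (n : ℕ) (x : X) :
    |simpleApprox u hu n x| ≤ 2 * |u x| := by
  rw [two_mul]
  exact SimpleFunc.norm_approxOn_zero_le hu (Set.mem_univ _) x n

lemma integrable_simpleApprox {ν : Measure X} (u : X → ℝ) (hu : Measurable u) (hi : Integrable u ν) (n : ℕ) :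
    Integrable (simpleApprox u hu n) ν := by
  refine (hi.abs.const_mul 2).mono (SimpleFunc.aestronglyMeasurable _) (ae_of_all _ fun x => ?_)
  rw [Real.norm_eq_abs]
  exact (abs_simpleApprox_le u hu n x).trans (le_abs_self _)

lemma IsPoissonProcess.ae_tendsto_prod (hQ : IsPoissonProcess ν Q) {u : X → ℝ}
    (hu : Measurable u) (hi : Integrable u ν) : ∀ᵐ ω ∂Q,
      Tendsto (fun n => ω.prod fun x => 1 + simpleApprox u hu n x) atTop
        (𝓝 (ω.prod fun x => 1 + u x)) := by
  filter_upwards [hQ.ae_summable hu hi] with ω hω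
  refine ω.tendsto_prod (abs_simpleApprox_le u hu) ?_ (tendsto_simpleApprox u hu)
  refine (hω.mul_left 2).congr fun x => ?_
  ring

lemma IsPoissonProcess.aestronglyMeasurable_prod (hQ : IsPoissonProcess ν Q) {u : X → ℝ}
    (hu : Measurable u) (hi : Integrable u ν) :
    AEStronglyMeasurable (fun ω : Configuration X => ω.prod fun x => 1 + u x) Q :=
  aestronglyMeasurable_of_tendsto_ae atTop
    (fun n => hQ.aestronglyMeasurable_prod_simpleFunc _ (integrable_simpleApprox u hu hi n))
    (hQ.ae_tendsto_prod hu hi)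

lemma IsPoissonProcess.eLpNorm_prod_simpleFunc_le (hQ : IsPoissonProcess ν Q)
    (u : SimpleFunc X ℝ) (hu : Integrable u ν) :
    eLpNorm (fun ω : Configuration X => ω.prod fun x => 1 + u x) 1 Q ≤
      ENNReal.ofReal (Real.exp (∫ x, |u x| ∂ν)) := by
  have hv : Integrable (u.map abs) ν := hu.abs
  have h0 : ∀ᵐ ω ∂Q, |ω.prod fun x => 1 + u x| ≤ ω.prod fun x => 1 + u.map abs x := by
    filter_upwards [hQ.ae_summable u.measurable hu] with ω hω
    exact ω.abs_prod_le (fun x => le_rfl) hω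
  have h1 := hQ.integral_prod_simpleFunc _ hv
  -- A function that is not integrable has integral zero by convention, whereas this integral is an
  -- exponential.
  have h2 : Integrable (fun ω : Configuration X => ω.prod fun x => 1 + u.map abs x) Q := by
    by_contra h
    rw [integral_undef h] at h1
    exact (Real.exp_pos _).ne h1
  rw [show (fun x => |u x|) = fun x => u.map abs x from rfl, ← h1,
    ofReal_integral_eq_lintegral_ofReal h2, eLpNorm_one_eq_lintegral_enorm]
  · refine lintegral_mono_ae ?_
    filter_upwards [h0] with ω hω
    rw [← ofReal_norm]
    exact ENNReal.ofReal_le_ofReal hω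
  · filter_upwards [h0] with ω hω
    exact (abs_nonneg _).trans hω

/-- Fatou's lemma: the simple approximations are dominated by `2 |u|`, which bounds their products
in `L¹` uniformly. -/
lemma IsPoissonProcess.integrable_prod (hQ : IsPoissonProcess ν Q) {u : X → ℝ}
    (hu : Measurable u) (hi : Integrable u ν) :
    Integrable (fun ω : Configuration X => ω.prod fun x => 1 + u x) Q := by
  rw [← memLp_one_iff_integrable]
  refine ⟨hQ.aestronglyMeasurable_prod hu hi, ?_⟩
  refine (Lp.eLpNorm_lim_le_liminf_eLpNorm
    (fun n => hQ.aestronglyMeasurable_prod_simpleFunc _ (integrable_simpleApprox u hu hi n)) _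
    (hQ.ae_tendsto_prod hu hi)).trans_lt ?_
  refine lt_of_le_of_lt (b := ENNReal.ofReal (Real.exp (∫ x, 2 * |u x| ∂ν))) ?_
    ENNReal.ofReal_lt_top
  refine liminf_le_of_le (by isBoundedDefault) fun b hb => ?_
  obtain ⟨n, hn⟩ := hb.exists
  refine hn.trans ((hQ.eLpNorm_prod_simpleFunc_le _ (integrable_simpleApprox u hu hi n)).trans ?_)
  refine ENNReal.ofReal_le_ofReal (Real.exp_le_exp.2 ?_)
  exact integral_mono (integrable_simpleApprox u hu hi n).abs (hi.abs.const_mul 2)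
    (abs_simpleApprox_le u hu n)

/-- The generating functional of the Poisson process. -/
lemma IsPoissonProcess.integral_prod (hQ : IsPoissonProcess ν Q) {u : X → ℝ}
    (hu : Measurable u) (hi : Integrable u ν) :
    ∫ ω : Configuration X, (ω.prod fun x => 1 + u x) ∂Q = Real.exp (∫ x, u x ∂ν) := by
  have hm : Measurable fun x => 2 * |u x| := hu.abs.const_mul 2
  have hi' : Integrable (fun x => 2 * |u x|) ν := hi.abs.const_mul 2
  have h1 : Tendsto (fun n => ∫ ω : Configuration X,
      (ω.prod fun x => 1 + simpleApprox u hu n x) ∂Q) atTop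
      (𝓝 (∫ ω : Configuration X, (ω.prod fun x => 1 + u x) ∂Q)) := by
    -- The dominating product has the same form, with `2 |u|` for `u`, so its integrability is
    -- already known.
    refine tendsto_integral_of_dominated_convergence
      (fun ω : Configuration X => ω.prod fun x => 1 + 2 * |u x|)
      (fun n => hQ.aestronglyMeasurable_prod_simpleFunc _ (integrable_simpleApprox u hu hi n))
      (hQ.integrable_prod hm hi') (fun n => ?_) (hQ.ae_tendsto_prod hu hi)
    filter_upwards [hQ.ae_summable hu hi] with ω hω
    refine ω.abs_prod_le (abs_simpleApprox_le u hu n) ((hω.mul_left 2).congr fun x => ?_)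
    ring
  have h2 : Tendsto (fun n => ∫ x, simpleApprox u hu n x ∂ν) atTop (𝓝 (∫ x, u x ∂ν)) :=
    tendsto_integral_of_dominated_convergence (fun x => 2 * |u x|)
      (fun n => SimpleFunc.aestronglyMeasurable _) hi'
      (fun n => ae_of_all _ (abs_simpleApprox_le u hu n))
      (ae_of_all _ (tendsto_simpleApprox u hu))
  refine tendsto_nhds_unique h1 ?_
  refine ((Real.continuous_exp.tendsto _).comp h2).congr fun n => ?_
  exact (hQ.integral_prod_simpleFunc _ (integrable_simpleApprox u hu hi n)).symm

/-- The exponential functional `∏_{x ∈ ω} (1 + h x) · exp (-∫ h dν)` of the Poisson process. -/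
def poissonExp (ν : Measure X) (h : X → ℝ) (ω : Configuration X) : ℝ :=
  ω.prod (fun x => 1 + h x) * Real.exp (-∫ x, h x ∂ν)

lemma IsPoissonProcess.ae_poissonExp_mul (hQ : IsPoissonProcess ν Q) {g h : X → ℝ}
    (hg : Measurable g) (hgi : Integrable g ν) (hh : Measurable h) (hhi : Integrable h ν) :
    (fun ω => poissonExp ν g ω * poissonExp ν h ω) =ᵐ[Q] fun ω =>
      Real.exp (-∫ x, g x ∂ν) * Real.exp (-∫ x, h x ∂ν) *
        ω.prod fun x => 1 + (g x + h x + g x * h x) := by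
  filter_upwards [hQ.ae_summable hg hgi, hQ.ae_summable hh hhi] with ω h1 h2
  rw [← ω.prod_mul_prod h1 h2, poissonExp, poissonExp]
  ring

/-- Since `(1 + g) (1 + h) = 1 + (g + h + g h)`, the generating functional applies. The linear
integrals cancel against the normalizations and only `∫ g h` remains. -/
lemma IsPoissonProcess.integral_poissonExp_mul (hQ : IsPoissonProcess ν Q) {g h : X → ℝ}
    (hg : Measurable g) (hgi : Integrable g ν) (hg2 : MemLp g 2 ν) (hh : Measurable h)
    (hhi : Integrable h ν) (hh2 : MemLp h 2 ν) :
    ∫ ω, poissonExp ν g ω * poissonExp ν h ω ∂Q = Real.exp (∫ x, g x * h x ∂ν) := by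
  have hgh : Integrable (fun x => g x * h x) ν := hg2.integrable_mul hh2
  rw [integral_congr_ae (hQ.ae_poissonExp_mul hg hgi hh hhi), integral_const_mul,
    hQ.integral_prod (u := fun x => g x + h x + g x * h x) ((hg.add hh).add (hg.mul hh))
      ((hgi.add hhi).add hgh), integral_add (f := fun x => g x + h x) (hgi.add hhi) hgh, integral_add hgi hhi, ← Real.exp_add, ← Real.exp_add]
  congr 1
  ring

lemma IsPoissonProcess.memLp_poissonExp (hQ : IsPoissonProcess ν Q) {h : X → ℝ}
    (hh : Measurable h) (hhi : Integrable h ν) (hh2 : MemLp h 2 ν) :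
    MemLp (poissonExp ν h) 2 Q := by
  have hm : AEStronglyMeasurable (poissonExp ν h) Q :=
    (hQ.aestronglyMeasurable_prod hh hhi).mul_const _
  rw [memLp_two_iff_integrable_sq hm]
  have hgh : Integrable (fun x => h x * h x) ν := hh2.integrable_mul hh2
  refine (((hQ.integrable_prod ((hh.add hh).add (hh.mul hh)) ((hhi.add hhi).add hgh)).const_mul
    (Real.exp (-∫ x, h x ∂ν) * Real.exp (-∫ x, h x ∂ν)))).congr ?_
  filter_upwards [hQ.ae_poissonExp_mul hh hhi hh hhi] with ω hω
  rw [sq, hω]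
  rfl

end Poisson

end GaussPoisson

end

noncomputable section

namespace GaussPoisson

/-! ### Totality of the exponential functionals of the Poisson process -/

section Poisson

open GaussPoisson.Configuration

lemma memLp_of_bound_of_eq_zero {X : Type*} [MeasurableSpace X] {ν : Measure X} {h : X → ℝ}
    (hm : Measurable h) {S : Set X} (hS : MeasurableSet S) (hν : ν S ≠ ∞) {C : ℝ}
    (hC : ∀ x, |h x| ≤ C) (h0 : ∀ x, x ∉ S → h x = 0) (p : ℝ≥0∞) : MemLp h p ν := by
  have h1 : S.indicator h = h := Set.indicator_eq_self.2 fun x hx => by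
    by_contra hxS
    exact hx (h0 x hxS)
  rw [← h1, memLp_indicator_iff_restrict hS]
  have : IsFiniteMeasure (ν.restrict S) := ⟨by simpa using hν.lt_top⟩
  exact MemLp.of_bound hm.aestronglyMeasurable C (ae_of_all _ hC)

lemma measurable_coe_Lp {X : Type*} [MeasurableSpace X] {ν : Measure X} (h : Lp ℝ 2 ν) :
    Measurable h :=
  (Lp.stronglyMeasurable h).measurable

/-- Exponentials of linear combinations of counts are multiplicative functionals, which is how the
determining lemma reaches the Poisson exponentials. -/
lemma Configuration.prod_exp_indicator {X : Type*} (ω : Configuration X) {J : Type*} [Fintype J]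
    {A : J → Set X} (hA : ∀ j, ω.count (A j) ≠ ∞) (θ : J → ℝ) :
    ω.prod (fun x => 1 + (Real.exp (∑ j, θ j * (A j).indicator 1 x) - 1)) =
      Real.exp (∑ j, θ j * (ω.natCount (A j) : ℝ)) := by
  classical
  have hfin : ((⋃ j, A j) ∩ Function.support ω.mult).Finite := by
    rw [Set.iUnion_inter]
    exact Set.finite_iUnion fun j => ω.finite_support_inter (hA j)
  have hZ : ∀ j, ∀ x ∈ A j, ω.mult x ≠ 0 → x ∈ hfin.toFinset := by
    intro j x hx hm
    rw [Set.Finite.mem_toFinset]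
    exact ⟨Set.mem_iUnion.2 ⟨j, hx⟩, hm⟩
  rw [ω.prod_eq_finsetProd (Z := hfin.toFinset)]
  · simp only [add_sub_cancel, ← Real.exp_nat_mul]
    rw [← Real.exp_sum]
    congr 1
    simp only [Finset.mul_sum]
    rw [Finset.sum_comm]
    refine Finset.sum_congr rfl fun j _ => ?_
    rw [ω.natCount_eq_sum (hZ j), Finset.sum_filter]
    push_cast
    rw [Finset.mul_sum]
    refine Finset.sum_congr rfl fun z _ => ?_
    by_cases hz : z ∈ A j <;> simp [hz, mul_comm]
  · intro x hx hm
    by_contra hxZ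
    refine hx ?_
    have h1 : ∀ j, x ∉ A j := fun j hj => hxZ (hZ j x hj hm)
    simp [h1]

variable {X : Type*} [MeasurableSpace X] {ν : Measure X} {Q : Measure (Configuration X)}
  [IsProbabilityMeasure Q] [SigmaFinite ν]

lemma IsPoissonProcess.poissonExp_congr (hQ : IsPoissonProcess ν Q) {g h : X → ℝ}
    (hgh : g =ᵐ[ν] h) : poissonExp ν g =ᵐ[Q] poissonExp ν h := by
  filter_upwards [hQ.ae_forall_mult hgh] with ω hω
  rw [poissonExp, poissonExp, integral_congr_ae hgh]
  congr 1
  exact ω.prod_congr fun x hx => by rw [hω x hx]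

/-- The class of the exponential functional of the Poisson process. -/
def poissonVec (hQ : IsPoissonProcess ν Q) (h : {h : Lp ℝ 2 ν // Integrable h ν}) : Lp ℂ 2 Q :=
  (hQ.memLp_poissonExp (measurable_coe_Lp h.1) h.2 (Lp.memLp h.1)).ofReal.toLp
    fun ω => (poissonExp ν h.1 ω : ℂ)

lemma coe_poissonVec (hQ : IsPoissonProcess ν Q) (h : {h : Lp ℝ 2 ν // Integrable h ν}) :
    poissonVec hQ h =ᵐ[Q] fun ω => ((poissonExp ν h.1 ω : ℝ) : ℂ) :=
  MemLp.coeFn_toLp _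

lemma inner_poissonVec (hQ : IsPoissonProcess ν Q) (g h : {h : Lp ℝ 2 ν // Integrable h ν}) :
    inner ℂ (poissonVec hQ g) (poissonVec hQ h) =
      ((Real.exp (inner ℝ g.1 h.1) : ℝ) : ℂ) := by
  rw [inner_eq_integral_of_ae_eq (coe_poissonVec hQ g) (coe_poissonVec hQ h),
    hQ.integral_poissonExp_mul (measurable_coe_Lp g.1) g.2 (Lp.memLp g.1)
      (measurable_coe_Lp h.1) h.2 (Lp.memLp h.1), L2.inner_def]
  congr 3
  ext x
  simp [mul_comm]

/-- The `σ`-field generated by the counts in sets of finite measure, up to null sets. -/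
lemma IsPoissonProcess.le_eventuallyMeasurableSpace (hQ : IsPoissonProcess ν Q) :
    (inferInstance : MeasurableSpace (Configuration X)) ≤ eventuallyMeasurableSpace
      (⨆ A : {A : Set X // MeasurableSet A ∧ ν A ≠ ∞}, MeasurableSpace.comap
        (fun ω : Configuration X => (ω.natCount A.1 : ℝ)) inferInstance) (ae Q) := by
  set m' : MeasurableSpace (Configuration X) :=
    ⨆ A : {A : Set X // MeasurableSet A ∧ ν A ≠ ∞}, MeasurableSpace.comap
        (fun ω : Configuration X => (ω.natCount A.1 : ℝ)) inferInstance with hm'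
  refine iSup₂_le fun A hA => ?_
  have hAk : ∀ k, MeasurableSet (A ∩ spanningSets ν k) ∧ ν (A ∩ spanningSets ν k) ≠ ∞ :=
    fun k => ⟨hA.inter (measurableSet_spanningSets ν k),
      measure_ne_top_of_subset Set.inter_subset_right (measure_spanningSets_lt_top ν k).ne⟩
  have h1 : Measurable[m'] fun ω : Configuration X =>
      ⨆ k, ENNReal.ofReal (ω.natCount (A ∩ spanningSets ν k) : ℝ) := by
    refine Measurable.iSup fun k => ENNReal.measurable_ofReal.comp ?_
    exact measurable_iff_comap_le.2 (le_iSup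
      (fun A : {A : Set X // MeasurableSet A ∧ ν A ≠ ∞} => MeasurableSpace.comap
        (fun ω : Configuration X => (ω.natCount A.1 : ℝ)) inferInstance) ⟨_, hAk k⟩)
  -- A count is the supremum of counts over an exhaustion. The natural counts agree with these only
  -- almost surely, whence the completion by null sets.
  have h2 : (fun ω : Configuration X => ω.count A) =ᵐ[Q] fun ω : Configuration X =>
      ⨆ k, ENNReal.ofReal (ω.natCount (A ∩ spanningSets ν k) : ℝ) := by
    have h3 : ∀ᵐ ω ∂Q, ∀ k, ω.count (A ∩ spanningSets ν k) ≠ ∞ :=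
      ae_all_iff.2 fun k => hQ.ae_count_ne_top (hAk k).1 (hAk k).2
    filter_upwards [h3] with ω hω
    simp only [ENNReal.ofReal_natCast, coe_natCount ω (hω _)]
    rw [← toMeasure_apply ω hA, show A = ⋃ k, A ∩ spanningSets ν k by
      rw [← Set.inter_iUnion, iUnion_spanningSets, Set.inter_univ]]
    rw [Monotone.measure_iUnion]
    · refine iSup_congr fun k => ?_
      rw [toMeasure_apply ω (hAk k).1, ← Set.inter_iUnion, iUnion_spanningSets, Set.inter_univ]
    · intro i j hij
      exact Set.inter_subset_inter_right _ (monotone_spanningSets ν hij)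
  exact measurable_iff_comap_le.1 (Measurable.eventuallyMeasurable_of_eventuallyEq h1 h2)

lemma IsPoissonProcess.eq_zero_of_integral_mul_poissonExp (hQ : IsPoissonProcess ν Q)
    {F : Configuration X → ℂ} (hF : MemLp F 2 Q)
    (h0 : ∀ h : Lp ℝ 2 ν, Integrable h ν → ∫ ω, F ω * (poissonExp ν h ω : ℂ) ∂Q = 0) :
    F =ᵐ[Q] 0 := by
  set I := {A : Set X // MeasurableSet A ∧ ν A ≠ ∞} with hI
  have hrep : ∀ (J : Finset I) (θ : J → ℝ), ∃ (h : Lp ℝ 2 ν) (c : ℝ), Integrable h ν ∧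
      (fun ω : Configuration X => Real.exp (∑ j, θ j * (ω.natCount j.1.1 : ℝ))) =ᵐ[Q]
        fun ω => c * poissonExp ν h ω := by
    intro J θ
    -- With this `u`, the product of `1 + u` is the exponential in question; `u` is bounded and
    -- vanishes off a set of finite measure, so it lies in `L¹` and `L²`.
    let u : X → ℝ := fun x => Real.exp (∑ j, θ j * (j.1.1 : Set X).indicator 1 x) - 1
    let S : Set X := ⋃ j : J, j.1.1
    have hu : Measurable u := by
      refine (Real.measurable_exp.comp (Finset.measurable_sum _ fun j _ => ?_)).sub_const 1
      exact (measurable_one.indicator j.1.2.1).const_mul _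
    have hS : MeasurableSet S := MeasurableSet.iUnion fun j => j.1.2.1
    have hνS : ν S ≠ ∞ := by
      refine ne_top_of_le_ne_top ?_ (measure_iUnion_fintype_le _ _)
      exact ENNReal.sum_ne_top.2 fun j _ => j.1.2.2
    have hb : ∀ x, |u x| ≤ Real.exp (∑ j, |θ j|) + 1 := by
      intro x
      refine (abs_sub _ _).trans ?_
      rw [abs_one, abs_of_pos (Real.exp_pos _)]
      gcongr with j
      by_cases hx : x ∈ (j.1.1 : Set X) <;> simp [hx, le_abs_self]
    have hz : ∀ x, x ∉ S → u x = 0 := by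
      intro x hx
      have h1 : ∀ j : J, x ∉ (j.1.1 : Set X) := fun j hj => hx (Set.mem_iUnion.2 ⟨j, hj⟩)
      simp [u, h1]
    have hL := memLp_of_bound_of_eq_zero hu hS hνS hb hz
    have hae := MemLp.coeFn_toLp (hL 2)
    refine ⟨(hL 2).toLp u, Real.exp (∫ x, u x ∂ν),
      (memLp_one_iff_integrable.1 (hL 1)).congr hae.symm, ?_⟩
    have hc : ∀ᵐ ω ∂Q, ∀ j : J, ω.count (j.1.1 : Set X) ≠ ∞ :=
      ae_all_iff.2 fun j => hQ.ae_count_ne_top j.1.2.1 j.1.2.2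
    filter_upwards [hc, hQ.poissonExp_congr hae] with ω h1 h2
    rw [h2, poissonExp, ← ω.prod_exp_indicator h1 θ, mul_comm _ (Real.exp _), ← mul_assoc,
      ← Real.exp_add, add_neg_cancel, Real.exp_zero, one_mul]
  have hY : ∀ A : I, Measurable fun ω : Configuration X => (ω.natCount A.1 : ℝ) := fun A =>
    (measurable_from_nat (f := fun k : ℕ => (k : ℝ))).comp (measurable_natCount A.2.1)
  have hset : ∀ S, MeasurableSet[⨆ A : I, MeasurableSpace.comap
      (fun ω : Configuration X => (ω.natCount A.1 : ℝ)) inferInstance] S →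
      ∫ ω in S, F ω ∂Q = 0 := by
    intro S hS
    refine setIntegral_complex_eq_zero_of_integral_mul_exp_eq_zero hF hY
      (fun J θ => ?_) (fun J θ => ?_) hS
    · obtain ⟨h, c, hi, hc⟩ := hrep J θ
      exact MemLp.ae_eq hc.symm ((hQ.memLp_poissonExp (measurable_coe_Lp h) hi
        (Lp.memLp h)).const_mul c)
    · obtain ⟨h, c, hi, hc⟩ := hrep J θ
      have h1 : (fun ω => F ω * ((Real.exp (∑ j, θ j * (ω.natCount j.1.1 : ℝ)) : ℝ) : ℂ)) =ᵐ[Q]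
          fun ω => (c : ℂ) * (F ω * (poissonExp ν h ω : ℂ)) := by
        filter_upwards [hc] with ω hω
        rw [hω]
        push_cast
        ring
      rw [integral_congr_ae h1, integral_const_mul, h0 h hi, mul_zero]
  refine ae_eq_zero_of_forall_setIntegral_eq_of_sigmaFinite
    (fun s _ _ => (hF.integrable one_le_two).integrableOn) fun s hs _ => ?_
  obtain ⟨t, ht, hst⟩ := hQ.le_eventuallyMeasurableSpace s hs
  rw [setIntegral_congr_set hst]
  exact hset t ht

lemma span_poissonVec_topologicalClosure (hQ : IsPoissonProcess ν Q) :
    (Submodule.span ℂ (Set.range (poissonVec hQ))).topologicalClosure = ⊤ := by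
  rw [Submodule.topologicalClosure_eq_top_iff, Submodule.eq_bot_iff]
  intro F hF
  refine (Lp.eq_zero_iff_ae_eq_zero).2
    (hQ.eq_zero_of_integral_mul_poissonExp (Lp.memLp F) fun h hi => ?_)
  have h1 := Submodule.inner_right_of_mem_orthogonal
    (Submodule.subset_span (Set.mem_range_self (⟨h, hi⟩ : {h : Lp ℝ 2 ν // Integrable h ν}))) hF
  rw [L2.inner_def] at h1
  rw [← h1]
  refine integral_congr_ae ?_
  filter_upwards [coe_poissonVec hQ ⟨h, hi⟩] with ω hω
  rw [hω, RCLike.inner_apply, Complex.conj_ofReal]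

end Poisson

end GaussPoisson

end

noncomputable section

namespace GaussPoisson

/-! ### The canonical isomorphism -/

/-! ### Truncation to sets of finite measure -/

section Truncation

variable {X : Type*} [MeasurableSpace X] {ν : Measure X} [SigmaFinite ν]

/-- The restriction of `f ∈ L²(X, ν)` to the `k`th set of an exhaustion of `X` by sets of finite
measure. -/
def truncLp (f : Lp ℝ 2 ν) (k : ℕ) : Lp ℝ 2 ν :=
  ((Lp.memLp f).indicator (measurableSet_spanningSets ν k)).toLp
    ((spanningSets ν k).indicator f)

lemma coe_truncLp (f : Lp ℝ 2 ν) (k : ℕ) :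
    truncLp f k =ᵐ[ν] (spanningSets ν k).indicator f :=
  MemLp.coeFn_toLp _

lemma integrable_of_ae_eq_zero_off {f : Lp ℝ 2 ν} {k : ℕ}
    (hf : ∀ᵐ x ∂ν, x ∉ spanningSets ν k → f x = 0) : Integrable f ν := by
  have h1 : (spanningSets ν k).indicator f =ᵐ[ν] f := by
    filter_upwards [hf] with x hx
    by_cases h : x ∈ spanningSets ν k
    · rw [Set.indicator_of_mem h]
    · rw [Set.indicator_of_notMem h, hx h]
  refine Integrable.congr ?_ h1
  rw [integrable_indicator_iff (measurableSet_spanningSets ν k)]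
  have : IsFiniteMeasure (ν.restrict (spanningSets ν k)) :=
    ⟨by simpa using measure_spanningSets_lt_top ν k⟩
  exact ((Lp.memLp f).restrict _).integrable one_le_two

lemma truncLp_eq_zero_off (f : Lp ℝ 2 ν) (k : ℕ) :
    ∀ᵐ x ∂ν, x ∉ spanningSets ν k → truncLp f k x = 0 := by
  filter_upwards [coe_truncLp f k] with x hx h
  rw [hx, Set.indicator_of_notMem h]

lemma integrable_truncLp (f : Lp ℝ 2 ν) (k : ℕ) : Integrable (truncLp f k) ν :=
  integrable_of_ae_eq_zero_off (truncLp_eq_zero_off f k)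

lemma tendsto_indicator_spanningSets (f : X → ℝ) (x : X) :
    Tendsto (fun k => (spanningSets ν k).indicator f x) atTop (𝓝 (f x)) := by
  refine tendsto_const_nhds.congr' ?_
  have hx : x ∈ ⋃ k, spanningSets ν k := by rw [iUnion_spanningSets]; exact Set.mem_univ x
  obtain ⟨k, hk⟩ := Set.mem_iUnion.1 hx
  filter_upwards [eventually_ge_atTop k] with j hj
  rw [Set.indicator_of_mem (monotone_spanningSets ν hj hk)]

/-- Dominated convergence, with `|f|²` as majorant of the squared difference. -/
lemma tendsto_truncLp (f : Lp ℝ 2 ν) : Tendsto (truncLp f) atTop (𝓝 f) := by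
  rw [Lp.tendsto_Lp_iff_tendsto_eLpNorm']
  have h1 : ∀ k, eLpNorm (⇑(truncLp f k) - ⇑f) 2 ν =
      (∫⁻ x, ‖(spanningSets ν k).indicator f x - f x‖ₑ ^ (2 : ℝ) ∂ν) ^ (1 / (2 : ℝ)) := by
    intro k
    rw [eLpNorm_eq_lintegral_rpow_enorm_toReal (by norm_num) (by norm_num), ENNReal.toReal_ofNat]
    congr 1
    refine lintegral_congr_ae ?_
    filter_upwards [coe_truncLp f k] with x hx
    rw [Pi.sub_apply, hx]
  simp only [h1]
  have h2 : Tendsto (fun k => ∫⁻ x, ‖(spanningSets ν k).indicator f x - f x‖ₑ ^ (2 : ℝ) ∂ν) atTop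
      (𝓝 (∫⁻ _, 0 ∂ν)) := by
    have hm := measurable_coe_Lp f
    refine tendsto_lintegral_of_dominated_convergence (fun x => ‖f x‖ₑ ^ (2 : ℝ))
      (fun k => ?_) (fun k => ae_of_all _ fun x => ?_) ?_ (ae_of_all _ fun x => ?_)
    · exact ((hm.indicator (measurableSet_spanningSets ν k)).sub hm).enorm.pow_const _
    · by_cases hx : x ∈ spanningSets ν k <;> simp [hx]
    · have := (lintegral_rpow_enorm_lt_top_of_eLpNorm_lt_top (by norm_num) (by norm_num)
        (Lp.memLp f).2).ne
      simpa using this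
    · have h3 := ((tendsto_indicator_spanningSets (ν := ν) f x).sub_const (f x)).enorm
      rw [sub_self, enorm_zero] at h3
      have h4 := ((ENNReal.continuous_rpow_const (y := 2)).tendsto 0).comp h3
      simpa [Function.comp_def] using h4
  have h5 := ((ENNReal.continuous_rpow_const (y := 1 / 2)).tendsto _).comp h2
  simpa [Function.comp_def] using h5

end Truncation

/-! ### Existence and uniqueness of the unitary operator -/

section Canonical

variable {X Ω : Type*} [MeasurableSpace X] [MeasurableSpace Ω] {ν : Measure X} [SigmaFinite ν]
  {P : Measure Ω} [IsProbabilityMeasure P] {W : Lp ℝ 2 ν → Ω → ℝ}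
  {Q : Measure (Configuration X)} [IsProbabilityMeasure Q]

/-- Truncations are integrable and converge in `L²`, and `noiseExp` is continuous, so restricting to
integrable `h` loses nothing. -/
lemma span_noiseExp_integrable_topologicalClosure (hW : IsGaussianWhiteNoise ν P W) :
    (Submodule.span ℂ (Set.range fun h : {h : Lp ℝ 2 ν // Integrable h ν} =>
      noiseExp hW h.1)).topologicalClosure = ⊤ := by
  rw [eq_top_iff, ← span_noiseExp_topologicalClosure hW]
  refine Submodule.topologicalClosure_minimal _ (Submodule.span_le.2 ?_)
    (Submodule.isClosed_topologicalClosure _)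
  rintro _ ⟨h, rfl⟩
  refine (Submodule.isClosed_topologicalClosure _).mem_of_tendsto
    (((continuous_noiseExp hW).tendsto h).comp (tendsto_truncLp h)) (Eventually.of_forall fun k => ?_)
  exact Submodule.le_topologicalClosure _ (Submodule.subset_span
    ⟨⟨truncLp h k, integrable_truncLp h k⟩, rfl⟩)

lemma isCanonicalIsomorphism_iff (hW : IsGaussianWhiteNoise ν P W) (hQ : IsPoissonProcess ν Q)
    (Φ : NoiseL2 P W ≃ₗᵢ[ℂ] Lp ℂ 2 Q) : IsCanonicalIsomorphism P W Q Φ ↔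
      ∀ h : {h : Lp ℝ 2 ν // Integrable h ν}, Φ (noiseExp hW h.1) = poissonVec hQ h := by
  constructor
  · rintro hΦ ⟨h, hi⟩
    obtain ⟨F, hF, hΦF⟩ := hΦ h hi
    have h1 : F = noiseExp hW h := Subtype.ext (Lp.ext (hF.trans (coe_noiseExp hW h).symm))
    rw [← h1]
    exact Lp.ext (hΦF.trans (coe_poissonVec hQ ⟨h, hi⟩).symm)
  · intro hΦ h hi
    refine ⟨noiseExp hW h, coe_noiseExp hW h, ?_⟩
    rw [hΦ ⟨h, hi⟩]
    exact coe_poissonVec hQ ⟨h, hi⟩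

lemma existsUnique_isCanonicalIsomorphism (hW : IsGaussianWhiteNoise ν P W)
    (hQ : IsPoissonProcess ν Q) :
    ∃! Φ : NoiseL2 P W ≃ₗᵢ[ℂ] Lp ℂ 2 Q, IsCanonicalIsomorphism P W Q Φ := by
  have := completeSpace_noiseL2 hW
  obtain ⟨Φ, hΦ⟩ := exists_unitary
    (e₁ := fun h : {h : Lp ℝ 2 ν // Integrable h ν} => noiseExp hW h.1) (e₂ := poissonVec hQ)
    (fun g h => (inner_noiseExp hW g.1 h.1).trans (inner_poissonVec hQ g h).symm)
    (span_noiseExp_integrable_topologicalClosure hW) (span_poissonVec_topologicalClosure hQ)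
  refine ⟨Φ, (isCanonicalIsomorphism_iff hW hQ Φ).2 hΦ, fun Ψ hΨ => ?_⟩
  refine unitary_ext (span_noiseExp_integrable_topologicalClosure hW) fun h => ?_
  exact ((isCanonicalIsomorphism_iff hW hQ Ψ).1 hΨ h).trans (hΦ h).symm

end Canonical

end GaussPoisson

end

noncomputable section

namespace GaussPoisson

/-! ### The image of the Hermite functionals of functions with support of finite measure -/

section Image

variable {X Ω : Type*} [MeasurableSpace X] [MeasurableSpace Ω] {ν : Measure X}
  {P : Measure Ω} [IsProbabilityMeasure P] {W : Lp ℝ 2 ν → Ω → ℝ}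
  {Q : Measure (Configuration X)}
  {Φ : NoiseL2 P W ≃ₗᵢ[ℂ] Lp ℂ 2 Q}

/-- An isometry keeps the series normally convergent, so its image also converges pointwise almost
everywhere. -/
lemma ae_hasSum_canonical (hW : IsGaussianWhiteNoise ν P W) (h : Lp ℝ 2 ν) (t : ℝ) :
    ∀ᵐ ω ∂Q, HasSum (fun n : ℕ => Φ (noiseHermiteDiag hW n h) ω * (t : ℂ) ^ n)
      (Φ (noiseExp hW (t • h)) ω) := by
  have h1 : HasSum (fun n : ℕ => ((t : ℂ) ^ n) • Φ (noiseHermiteDiag hW n h))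
      (Φ (noiseExp hW (t • h))) := by
    have := (hasSum_noiseHermiteDiag hW h t).map Φ Φ.continuous
    simpa only [Function.comp_def, map_smul] using this
  have h2 : Summable fun n : ℕ => ‖((t : ℂ) ^ n) • Φ (noiseHermiteDiag hW n h)‖ := by
    refine (summable_norm_smul_noiseHermiteDiag hW h t).congr fun n => ?_
    rw [← map_smul, Φ.norm_map]
  have h3 : ∀ᵐ ω ∂Q, ∀ n : ℕ, (((t : ℂ) ^ n) • Φ (noiseHermiteDiag hW n h) : Lp ℂ 2 Q) ω =
      Φ (noiseHermiteDiag hW n h) ω * (t : ℂ) ^ n := by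
    rw [ae_all_iff]
    intro n
    filter_upwards [Lp.coeFn_smul ((t : ℂ) ^ n) (Φ (noiseHermiteDiag hW n h))] with ω hω
    rw [hω, Pi.smul_apply, smul_eq_mul, mul_comm]
  filter_upwards [ae_hasSum_of_summable_norm h2 h1, h3] with ω h4 h5
  simpa only [h5] using h4

variable [SigmaFinite ν] [IsProbabilityMeasure Q]

lemma ae_poissonVec_smul (hQ : IsPoissonProcess ν Q) {h : Lp ℝ 2 ν} (hi : Integrable h ν) (t : ℝ) :
    ∃ hi' : Integrable (t • h : Lp ℝ 2 ν) ν, poissonVec hQ ⟨t • h, hi'⟩ =ᵐ[Q] fun ω =>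
      ((ω.prod (fun x => 1 + t * h x) * Real.exp (-(t * ∫ x, h x ∂ν)) : ℝ) : ℂ) := by
  have h1 : (t • h : Lp ℝ 2 ν) =ᵐ[ν] fun x => t * h x := Lp.coeFn_smul t h
  refine ⟨(hi.const_mul t).congr h1.symm, ?_⟩
  filter_upwards [coe_poissonVec hQ ⟨t • h, (hi.const_mul t).congr h1.symm⟩,
    hQ.poissonExp_congr h1] with ω h2 h3
  rw [h2, h3, poissonExp, integral_const_mul]

/-- Two power series in `t` with the same values at all `1 / (j + 1)` are compared for fixed `ω`.
The finite set `Z` is quantified inside the almost sure event, since it depends on `ω` and one `Z`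
must later serve several functions. -/
lemma ae_canonical_noiseHermiteDiag (hW : IsGaussianWhiteNoise ν P W) (hQ : IsPoissonProcess ν Q)
    (hΦ : IsCanonicalIsomorphism P W Q Φ) {h : Lp ℝ 2 ν} {k : ℕ}
    (hk : ∀ᵐ x ∂ν, x ∉ spanningSets ν k → h x = 0) :
    ∀ᵐ ω ∂Q, ∀ Z : Finset X, (∀ x ∈ spanningSets ν k, ω.mult x ≠ 0 → x ∈ Z) → ∀ n : ℕ,
      Φ (noiseHermiteDiag hW n h) ω =
        ((charlierSum (fun _ : Fin n => ∑ z ∈ Z, ω.mult z * h z - ∫ x, h x ∂ν)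
          (fun B => ∑ z ∈ Z, ω.mult z * ∏ _i ∈ B, h z) / n.factorial : ℝ) : ℂ) := by
  have hi := integrable_of_ae_eq_zero_off hk
  have h1 : ∀ᵐ ω ∂Q, ∀ j : ℕ,
      HasSum (fun n : ℕ => Φ (noiseHermiteDiag hW n h) ω * (((1 : ℝ) / (j + 1) : ℝ) : ℂ) ^ n)
        ((ω.prod (fun x => 1 + (1 / (j + 1)) * h x) *
          Real.exp (-((1 / (j + 1)) * ∫ x, h x ∂ν)) : ℝ) : ℂ) := by
    rw [ae_all_iff]
    intro j
    obtain ⟨hi', h2⟩ := ae_poissonVec_smul hQ hi (1 / (j + 1))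
    rw [← (isCanonicalIsomorphism_iff hW hQ Φ).1 hΦ] at h2
    filter_upwards [h2, ae_hasSum_canonical (Φ := Φ) hW h (1 / (j + 1))] with ω h3 h4
    rw [← h3]
    exact h4
  filter_upwards [h1, hQ.ae_forall_mult hk] with ω h2 h3 Z hZ n
  refine congrFun (coeff_eq_of_hasSum (G := fun t =>
    ((ω.prod (fun x => 1 + t * h x) * Real.exp (-(t * ∫ x, h x ∂ν)) : ℝ) : ℂ))
    (a := fun n => Φ (noiseHermiteDiag hW n h) ω) (b := fun n =>
    ((charlierSum (fun _ : Fin n => ∑ z ∈ Z, ω.mult z * h z - ∫ x, h x ∂ν)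
          (fun B => ∑ z ∈ Z, ω.mult z * ∏ _i ∈ B, h z) / n.factorial : ℝ) : ℂ))
    h2 fun j => ?_) n
  have h4 := Complex.ofRealCLM.hasSum
    (hasSum_charlierSum Z ω.mult h (∫ x, h x ∂ν) (1 / (j + 1)))
  rw [← ω.prod_eq_finsetProd (Z := Z) (f := fun x => 1 / ((j : ℝ) + 1) * h x)] at h4
  · simpa only [Complex.ofRealCLM_apply, Complex.ofReal_mul, Complex.ofReal_pow] using h4
  · intro x hx hm
    refine hZ x ?_ hm
    by_contra hxk
    exact hx (by rw [h3 x hm hxk, mul_zero])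

lemma ae_eq_zero_off_sum {n : ℕ} {f : Fin n → Lp ℝ 2 ν} {k : ℕ}
    (hk : ∀ i, ∀ᵐ x ∂ν, x ∉ spanningSets ν k → f i x = 0) (s : Finset (Fin n)) :
    ∀ᵐ x ∂ν, x ∉ spanningSets ν k → (∑ i ∈ s, f i : Lp ℝ 2 ν) x = 0 := by
  filter_upwards [Lp.coeFn_fun_finsetSum s f, ae_all_iff.2 hk] with x h1 h2 hx
  rw [h1, Finset.sum_eq_zero fun i _ => h2 i hx]

lemma charlierSum_congr {n : ℕ} {L L' : Fin n → ℝ} {S S' : Finset (Fin n) → ℝ}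
    (hL : ∀ i, L i = L' i) (hS : ∀ B, 2 ≤ B.card → S B = S' B) :
    charlierSum L S = charlierSum L' S' := by
  obtain rfl : L = L' := funext hL
  refine Finset.sum_congr rfl fun g _ => ?_
  congr 1
  refine Finset.prod_congr rfl fun c hc => hS _ ?_
  exact (Equiv.Perm.mem_cycleFactorsFinset_iff.1 hc).1.two_le_card_support

/-- Polarization holds on both sides with the same signs, so the diagonal case suffices. -/
lemma ae_canonical_noiseHermite_of_eq_zero_off (hW : IsGaussianWhiteNoise ν P W)
    (hQ : IsPoissonProcess ν Q) (hΦ : IsCanonicalIsomorphism P W Q Φ) {n : ℕ}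
    {f : Fin n → Lp ℝ 2 ν} {k : ℕ} (hk : ∀ i, ∀ᵐ x ∂ν, x ∉ spanningSets ν k → f i x = 0) :
    ∀ᵐ ω ∂Q, Φ (noiseHermite hW f) ω = ((charlierSum (fun i => centeredSum ν (f i) ω)
      (fun B => ω.sum fun x => ∏ i ∈ B, f i x) : ℝ) : ℂ) := by
  have h1 : Φ (noiseHermite hW f) = ∑ R : Finset (Fin n), ((-1 : ℂ) ^ R.card) •
      Φ (noiseHermiteDiag hW n (∑ i ∈ Rᶜ, f i)) := by
    rw [noiseHermite, map_sum]
    simp only [map_smul]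
  have h2 : ∀ᵐ ω ∂Q, ∀ R : Finset (Fin n),
      (((-1 : ℂ) ^ R.card) • Φ (noiseHermiteDiag hW n (∑ i ∈ Rᶜ, f i)) : Lp ℂ 2 Q) ω =
        (-1 : ℂ) ^ R.card * Φ (noiseHermiteDiag hW n (∑ i ∈ Rᶜ, f i)) ω :=
    ae_all_iff.2 fun R => Lp.coeFn_smul _ _
  have h3 : ∀ᵐ ω ∂Q, ∀ R : Finset (Fin n), ∀ Z : Finset X,
      (∀ x ∈ spanningSets ν k, ω.mult x ≠ 0 → x ∈ Z) → ∀ m : ℕ,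
      Φ (noiseHermiteDiag hW m (∑ i ∈ Rᶜ, f i)) ω =
        ((charlierSum (fun _ : Fin m => ∑ z ∈ Z, ω.mult z * (∑ i ∈ Rᶜ, f i : Lp ℝ 2 ν) z -
            ∫ x, (∑ i ∈ Rᶜ, f i : Lp ℝ 2 ν) x ∂ν)
          (fun B => ∑ z ∈ Z, ω.mult z * ∏ _i ∈ B, (∑ i ∈ Rᶜ, f i : Lp ℝ 2 ν) z) /
            m.factorial : ℝ) : ℂ) :=
    ae_all_iff.2 fun R => ae_canonical_noiseHermiteDiag hW hQ hΦ (ae_eq_zero_off_sum hk Rᶜ)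
  have h4 : ∀ᵐ x ∂ν, ∀ R : Finset (Fin n),
      (∑ i ∈ Rᶜ, f i : Lp ℝ 2 ν) x = ∑ i ∈ Rᶜ, f i x :=
    ae_all_iff.2 fun R => Lp.coeFn_fun_finsetSum Rᶜ f
  have h5 : ∀ R : Finset (Fin n), ∫ x, (∑ i ∈ Rᶜ, f i : Lp ℝ 2 ν) x ∂ν =
      ∑ i ∈ Rᶜ, ∫ x, f i x ∂ν := fun R => by
    rw [integral_congr_ae (Lp.coeFn_fun_finsetSum Rᶜ f)]
    exact integral_finsetSum _ fun i _ => integrable_of_ae_eq_zero_off (hk i)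
  rw [h1]
  filter_upwards [Lp.coeFn_fun_finsetSum Finset.univ (fun R : Finset (Fin n) =>
    ((-1 : ℂ) ^ R.card) • Φ (noiseHermiteDiag hW n (∑ i ∈ Rᶜ, f i))), h2, h3,
    hQ.ae_forall_mult h4, hQ.ae_forall_mult (ae_all_iff.2 hk), hQ.ae_count_spanningSets]
    with ω a1 a2 a3 a4 a5 a6
  -- All points of `Z` belong to `ω`, so the almost everywhere identities for representatives of `∑
  -- f i` hold at each of them.
  set Z : Finset X := (ω.finite_support_inter (a6 k)).toFinset with hZdef
  have hZ : ∀ x ∈ spanningSets ν k, ω.mult x ≠ 0 → x ∈ Z := fun x hx hm => by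
    rw [hZdef, Set.Finite.mem_toFinset]
    exact ⟨hx, hm⟩
  have hZ' : ∀ x ∈ Z, ω.mult x ≠ 0 := fun x hx => by
    rw [hZdef, Set.Finite.mem_toFinset] at hx
    exact hx.2
  have hf : ∀ i x, f i x ≠ 0 → ω.mult x ≠ 0 → x ∈ Z := fun i x hx hm => by
    refine hZ x ?_ hm
    by_contra hxk
    exact hx (a5 x hm i hxk)
  rw [a1]
  have a7 : ∀ R : Finset (Fin n), (charlierSum
      (fun _ : Fin n => ∑ z ∈ Z, ω.mult z * (∑ i ∈ Rᶜ, f i : Lp ℝ 2 ν) z -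
            ∑ i ∈ Rᶜ, ∫ x, f i x ∂ν)
          (fun B => ∑ z ∈ Z, ω.mult z * ∏ _i ∈ B, (∑ i ∈ Rᶜ, f i : Lp ℝ 2 ν) z)) =
      charlierSum (fun _ : Fin n => ∑ z ∈ Z, ω.mult z * (∑ i ∈ Rᶜ, f i z) -
            ∑ i ∈ Rᶜ, ∫ x, f i x ∂ν)
          (fun B => ∑ z ∈ Z, ω.mult z * ∏ _i ∈ B, (∑ i ∈ Rᶜ, f i z)) := by
    intro R
    refine charlierSum_congr (fun i => ?_) fun B _ => ?_
    · congr 1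
      exact Finset.sum_congr rfl fun z hz => by rw [a4 z (hZ' z hz) R]
    · exact Finset.sum_congr rfl fun z hz => by rw [a4 z (hZ' z hz) R]
  have a8 := sum_neg_one_pow_mul_charlierSum Z ω.mult (fun i => f i) fun i => ∫ x, f i x ∂ν
  have a9 : charlierSum (fun i => centeredSum ν (f i) ω) (fun B => ω.sum fun x => ∏ i ∈ B, f i x) =
      charlierSum (fun i => ∑ z ∈ Z, ω.mult z * f i z - ∫ x, f i x ∂ν)
        (fun B => ∑ z ∈ Z, ω.mult z * ∏ i ∈ B, f i z) := by
    refine charlierSum_congr (fun i => ?_) fun B hB => ?_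
    · rw [centeredSum, ω.sum_eq_finsetSum (hf i)]
    · refine ω.sum_eq_finsetSum fun x hx hm => ?_
      obtain ⟨i, hi⟩ : B.Nonempty := Finset.card_pos.1 (by omega)
      exact hf i x (Finset.prod_ne_zero_iff.1 hx i hi) hm
  have hn : (n.factorial : ℝ) ≠ 0 := by positivity
  rw [a9, ← mul_div_cancel_left₀ (charlierSum _ _) hn, ← a8, Finset.sum_div]
  simp only [a2, a3 _ Z hZ n, h5, a7]
  rw [Complex.ofReal_sum]
  refine Finset.sum_congr rfl fun R _ => ?_
  push_cast
  ring

end Image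

end GaussPoisson

end

noncomputable section

namespace GaussPoisson

/-! ### The image of the Hermite functionals -/

lemma exists_strictMono_ae_tendsto {Ω : Type*} [MeasurableSpace Ω] {Q : Measure Ω} {J : Type*}
    [Fintype J] {F : J → ℕ → Lp ℂ 2 Q} {G : J → Lp ℂ 2 Q}
    (h : ∀ j, Tendsto (F j) atTop (𝓝 (G j))) :
    ∃ φ : ℕ → ℕ, StrictMono φ ∧
      ∀ᵐ ω ∂Q, ∀ j, Tendsto (fun k => F j (φ k) ω) atTop (𝓝 (G j ω)) := by
  classical
  suffices key : ∀ s : Finset J, ∃ φ : ℕ → ℕ, StrictMono φ ∧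
      ∀ᵐ ω ∂Q, ∀ j ∈ s, Tendsto (fun k => F j (φ k) ω) atTop (𝓝 (G j ω)) by
    obtain ⟨φ, hφ, hs⟩ := key Finset.univ
    exact ⟨φ, hφ, by simpa using hs⟩
  intro s
  induction s using Finset.induction_on with
  | empty => exact ⟨id, strictMono_id, by simp⟩
  | insert i s _ ih =>
    obtain ⟨φ, hφ, hs⟩ := ih
    obtain ⟨ψ, hψ, hi⟩ := (tendstoInMeasure_of_tendsto_Lp
      ((h i).comp hφ.tendsto_atTop)).exists_seq_tendsto_ae
    refine ⟨φ ∘ ψ, hφ.comp hψ, ?_⟩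
    filter_upwards [hs, hi] with ω h1 h2 j hj
    rcases Finset.mem_insert.1 hj with rfl | hj
    · exact h2
    · exact (h1 j hj).comp hψ.tendsto_atTop

lemma charlierSum_fin_one (L : Fin 1 → ℝ) (S : Finset (Fin 1) → ℝ) : charlierSum L S = L 0 := by
  have h1 : ∀ g : Equiv.Perm (Fin 1), fixedPts g = Finset.univ := fun g =>
    Finset.filter_true_of_mem fun i _ => Subsingleton.elim _ _
  rw [charlierSum, Fintype.sum_unique, h1, show (default : Equiv.Perm (Fin 1)) = 1 from rfl,
    numCycles, h1]
  simp

lemma tendsto_charlierSum {n : ℕ} {L : ℕ → Fin n → ℝ} {S : ℕ → Finset (Fin n) → ℝ}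
    {L' : Fin n → ℝ} {S' : Finset (Fin n) → ℝ}
    (hL : ∀ i, Tendsto (fun k => L k i) atTop (𝓝 (L' i)))
    (hS : ∀ B, 2 ≤ B.card → Tendsto (fun k => S k B) atTop (𝓝 (S' B))) :
    Tendsto (fun k => charlierSum (L k) (S k)) atTop (𝓝 (charlierSum L' S')) := by
  refine tendsto_finsetSum _ fun g _ => ?_
  refine ((tendsto_finsetProd _ fun i _ => hL i).const_mul _).mul (tendsto_finsetProd _ fun c hc => ?_)
  exact hS _ (Equiv.Perm.mem_cycleFactorsFinset_iff.1 hc).1.two_le_card_support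

lemma Configuration.tendsto_sum {X : Type*} (ω : Configuration X) {u : X → ℝ} {v : ℕ → X → ℝ}
    {b : X → ℝ} (hv : ∀ k x, ω.mult x ≠ 0 → |v k x| ≤ b x)
    (hs : Summable fun x => (ω.mult x : ℝ) * b x)
    (h : ∀ x, ω.mult x ≠ 0 → Tendsto (fun k => v k x) atTop (𝓝 (u x))) :
    Tendsto (fun k => ω.sum (v k)) atTop (𝓝 (ω.sum u)) := by
  refine tendsto_tsum_of_dominated_convergence hs (fun x => ?_)
    (Eventually.of_forall fun k x => ?_)
  · by_cases hx : ω.mult x = 0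
    · simp [hx]
    · exact (h x hx).const_mul _
  · by_cases hx : ω.mult x = 0
    · simp [hx]
    · rw [norm_mul, Real.norm_natCast]
      exact mul_le_mul_of_nonneg_left (hv k x hx) (Nat.cast_nonneg _)

/-- With `s = ∑ f i ^ 2`, each factor is at most `√s`. Two factors give `s`; the others are bounded
by a constant because `s` at a point of `ω` is at most the whole sum. -/
lemma Configuration.prod_abs_le {X : Type*} (ω : Configuration X) {n : ℕ} {f : Fin n → X → ℝ}
    (hs : Summable fun x => (ω.mult x : ℝ) * ∑ i, f i x ^ 2) {B : Finset (Fin n)}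
    (hB : 2 ≤ B.card) {x : X} (hx : ω.mult x ≠ 0) :
    ∏ i ∈ B, |f i x| ≤
      Real.sqrt (∑' x, (ω.mult x : ℝ) * ∑ i, f i x ^ 2) ^ (B.card - 2) * ∑ i, f i x ^ 2 := by
  have h0 : ∀ y, 0 ≤ ∑ i, f i y ^ 2 := fun y => Finset.sum_nonneg fun i _ => sq_nonneg _
  have h1 : ∑ i, f i x ^ 2 ≤ ∑' x, (ω.mult x : ℝ) * ∑ i, f i x ^ 2 := by
    refine le_trans ?_ (hs.le_tsum x fun y _ => mul_nonneg (Nat.cast_nonneg _) (h0 y))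
    have : (1 : ℝ) ≤ ω.mult x := by exact_mod_cast Nat.one_le_iff_ne_zero.2 hx
    exact le_mul_of_one_le_left (h0 x) this
  have h2 : ∀ i ∈ B, |f i x| ≤ Real.sqrt (∑ i, f i x ^ 2) := fun i _ => by
    rw [← Real.sqrt_sq_eq_abs]
    exact Real.sqrt_le_sqrt (Finset.single_le_sum (f := fun i => f i x ^ 2)
      (fun j _ => sq_nonneg _) (Finset.mem_univ i))
  calc ∏ i ∈ B, |f i x| ≤ ∏ _i ∈ B, Real.sqrt (∑ i, f i x ^ 2) :=
        Finset.prod_le_prod (fun i _ => abs_nonneg _) h2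
    _ = Real.sqrt (∑ i, f i x ^ 2) ^ (B.card - 2) * Real.sqrt (∑ i, f i x ^ 2) ^ 2 := by
        rw [Finset.prod_const, ← pow_add, Nat.sub_add_cancel hB]
    _ ≤ _ := by
        rw [Real.sq_sqrt (h0 x)]
        exact mul_le_mul_of_nonneg_right (pow_le_pow_left₀ (Real.sqrt_nonneg _)
          (Real.sqrt_le_sqrt h1) _) (h0 x)

lemma abs_indicator_le {X : Type*} (s : Set X) (f : X → ℝ) (x : X) : |s.indicator f x| ≤ |f x| := by
  by_cases hx : x ∈ s <;> simp [hx]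

section Image

variable {X Ω : Type*} [MeasurableSpace X] [MeasurableSpace Ω] {ν : Measure X}
  {P : Measure Ω} [IsProbabilityMeasure P] {W : Lp ℝ 2 ν → Ω → ℝ}
  {Q : Measure (Configuration X)} {Φ : NoiseL2 P W ≃ₗᵢ[ℂ] Lp ℂ 2 Q}

lemma continuous_canonical_linear (hW : IsGaussianWhiteNoise ν P W) :
    Continuous fun f : Lp ℝ 2 ν => Φ (noiseHermite hW fun _ : Fin 1 => f) :=
  Φ.continuous.comp ((continuous_noiseHermite hW 1).comp (by fun_prop))

lemma charlier_eq_charlierSum {n : ℕ} (f : Fin n → Lp ℝ 2 ν) (ω : Configuration X) :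
    charlier Q f ω = charlierSum (fun i => poissonLinear ν Q (f i) ω)
      (fun B => ω.sum fun x => ∏ i ∈ B, f i x) := rfl

variable [SigmaFinite ν] [IsProbabilityMeasure Q]

lemma ae_truncLp_eq (hQ : IsPoissonProcess ν Q) (f : Lp ℝ 2 ν) : ∀ᵐ ω ∂Q, ∀ x, ω.mult x ≠ 0 →
    ∀ k, truncLp f k x = (spanningSets ν k).indicator f x :=
  hQ.ae_forall_mult (ae_all_iff.2 fun k => coe_truncLp f k)

lemma ae_tendsto_centeredSum_truncLp (hQ : IsPoissonProcess ν Q) {f : Lp ℝ 2 ν}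
    (hf : Integrable f ν) : ∀ᵐ ω ∂Q, Tendsto (fun k => centeredSum ν (truncLp f k) ω) atTop
      (𝓝 (centeredSum ν f ω)) := by
  have h1 : Tendsto (fun k => ∫ x, truncLp f k x ∂ν) atTop (𝓝 (∫ x, f x ∂ν)) := by
    refine tendsto_integral_of_dominated_convergence (fun x => |f x|)
      (fun k => (Lp.aestronglyMeasurable _)) hf.abs (fun k => ?_) ?_
    · filter_upwards [coe_truncLp f k] with x hx
      rw [hx]
      exact abs_indicator_le _ _ _
    · filter_upwards [ae_all_iff.2 fun k => coe_truncLp f k] with x hx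
      simp only [hx]
      exact tendsto_indicator_spanningSets _ _
  filter_upwards [ae_truncLp_eq hQ f, hQ.ae_summable (measurable_coe_Lp f) hf] with ω h2 h3
  refine Tendsto.sub (ω.tendsto_sum (fun k x hx => ?_) h3 fun x hx => ?_) h1
  · rw [h2 x hx]
    exact abs_indicator_le _ _ _
  · simp only [h2 x hx]
    exact tendsto_indicator_spanningSets _ _

/-- The truncations converge in `L²` through `Φ`, and pointwise as centered sums because `f` is
integrable; along a subsequence the two limits agree. -/
lemma ae_canonical_linear_of_integrable (hW : IsGaussianWhiteNoise ν P W)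
    (hQ : IsPoissonProcess ν Q) (hΦ : IsCanonicalIsomorphism P W Q Φ) {f : Lp ℝ 2 ν}
    (hf : Integrable f ν) :
    Φ (noiseHermite hW fun _ : Fin 1 => f) =ᵐ[Q] fun ω => ((centeredSum ν f ω : ℝ) : ℂ) := by
  obtain ⟨φ, hφ, h1⟩ := exists_strictMono_ae_tendsto (J := Unit)
    (F := fun _ k => Φ (noiseHermite hW fun _ : Fin 1 => truncLp f k))
    (fun _ => ((continuous_canonical_linear (Φ := Φ) hW).tendsto f).comp (tendsto_truncLp f))
  have h2 : ∀ᵐ ω ∂Q, ∀ k, Φ (noiseHermite hW fun _ : Fin 1 => truncLp f k) ω =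
      ((centeredSum ν (truncLp f k) ω : ℝ) : ℂ) := by
    rw [ae_all_iff]
    intro k
    filter_upwards [ae_canonical_noiseHermite_of_eq_zero_off hW hQ hΦ
      (f := fun _ : Fin 1 => truncLp f k) fun _ => truncLp_eq_zero_off f k] with ω h
    rw [h, charlierSum_fin_one]
  filter_upwards [h1, h2, ae_tendsto_centeredSum_truncLp hQ hf] with ω h3 h4 h5
  have h6 := h3 ()
  simp only [h4] at h6
  exact tendsto_nhds_unique h6
    ((Complex.continuous_ofReal.tendsto _).comp (h5.comp hφ.tendsto_atTop))

lemma IsPoissonProcess.centeredSum_congr (hQ : IsPoissonProcess ν Q) {g h : X → ℝ}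
    (hgh : g =ᵐ[ν] h) : centeredSum ν g =ᵐ[Q] centeredSum ν h := by
  filter_upwards [hQ.ae_forall_mult hgh] with ω hω
  rw [centeredSum, centeredSum, integral_congr_ae hgh, ω.sum_congr hω]

/-- The extension by continuity exists because `Φ` is continuous. The real part is taken since the
vector is complex valued, and it does not increase distances to real functions. -/
lemma isCenteredSumLimit_re (hW : IsGaussianWhiteNoise ν P W)
    (hQ : IsPoissonProcess ν Q) (hΦ : IsCanonicalIsomorphism P W Q Φ) (f : Lp ℝ 2 ν) :
    IsCenteredSumLimit ν Q f fun ω => (Φ (noiseHermite hW fun _ : Fin 1 => f) ω).re := by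
  refine ⟨MemLp.re (Lp.memLp (Φ (noiseHermite hW fun _ : Fin 1 => f))), fun k => truncLp f k,
    fun k => ⟨integrable_truncLp f k, Lp.memLp _⟩, ?_, ?_⟩
  · exact (Lp.tendsto_Lp_iff_tendsto_eLpNorm' _ _).1 (tendsto_truncLp f)
  · refine tendsto_of_tendsto_of_tendsto_of_le_of_le tendsto_const_nhds
      ((Lp.tendsto_Lp_iff_tendsto_eLpNorm' _ _).1
        (((continuous_canonical_linear (Φ := Φ) hW).tendsto f).comp (tendsto_truncLp f)))
      (fun k => zero_le) fun k => ?_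
    refine eLpNorm_mono_ae ?_
    filter_upwards [ae_canonical_linear_of_integrable hW hQ hΦ (integrable_truncLp f k)]
      with ω hω
    rw [Pi.sub_apply, Function.comp_apply, hω, Real.norm_eq_abs]
    refine le_trans (le_of_eq ?_) (Complex.abs_re_le_norm _)
    simp

/-- Any approximating sequence converges in `L²` to `f`, so its centered sums converge to the same
vector; the choice made in `poissonLinear` is immaterial up to null sets. -/
lemma ae_eq_of_isCenteredSumLimit (hW : IsGaussianWhiteNoise ν P W)
    (hQ : IsPoissonProcess ν Q) (hΦ : IsCanonicalIsomorphism P W Q Φ) {f : Lp ℝ 2 ν}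
    {Y : Configuration X → ℝ} (hY : IsCenteredSumLimit ν Q f Y) :
    Φ (noiseHermite hW fun _ : Fin 1 => f) =ᵐ[Q] fun ω => (Y ω : ℂ) := by
  obtain ⟨hYm, g, hg, h1, h2⟩ := hY
  have h3 : Tendsto (fun k => (hg k).2.toLp (g k)) atTop (𝓝 f) := by
    rw [Lp.tendsto_Lp_iff_tendsto_eLpNorm']
    refine h1.congr fun k => eLpNorm_congr_ae ?_
    filter_upwards [(hg k).2.coeFn_toLp] with x hx
    rw [Pi.sub_apply, hx]
  have h4 := ((continuous_canonical_linear (Φ := Φ) hW).tendsto f).comp h3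
  have h5 : Tendsto (fun k => Φ (noiseHermite hW fun _ : Fin 1 => (hg k).2.toLp (g k))) atTop
      (𝓝 (hYm.ofReal.toLp fun ω => (Y ω : ℂ))) := by
    rw [Lp.tendsto_Lp_iff_tendsto_eLpNorm]
    refine h2.congr fun k => eLpNorm_congr_norm_ae ?_
    filter_upwards [ae_canonical_linear_of_integrable hW hQ hΦ
      ((hg k).1.congr (hg k).2.coeFn_toLp.symm), hQ.centeredSum_congr (hg k).2.coeFn_toLp]
      with ω h6 h7
    rw [Pi.sub_apply, h6, h7, ← Complex.ofReal_sub, Complex.norm_real]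
  rw [tendsto_nhds_unique h4 h5]
  exact MemLp.coeFn_toLp _

lemma ae_canonical_linear (hW : IsGaussianWhiteNoise ν P W) (hQ : IsPoissonProcess ν Q)
    (hΦ : IsCanonicalIsomorphism P W Q Φ) (f : Lp ℝ 2 ν) :
    Φ (noiseHermite hW fun _ : Fin 1 => f) =ᵐ[Q] fun ω => ((poissonLinear ν Q f ω : ℝ) : ℂ) := by
  by_cases hf : Integrable f ν
  · simp only [poissonLinear, if_pos hf]
    exact ae_canonical_linear_of_integrable hW hQ hΦ hf
  · have hY : ∃ Y, IsCenteredSumLimit ν Q f Y := ⟨_, isCenteredSumLimit_re hW hQ hΦ f⟩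
    simp only [poissonLinear, if_neg hf, dif_pos hY]
    exact ae_eq_of_isCenteredSumLimit hW hQ hΦ hY.choose_spec

/-- Dominated convergence over the points of `ω`: since the `f i` are in `L²`, the sum of `∑ f i ^
2` over `ω` is almost surely finite. -/
lemma ae_tendsto_sum_truncLp (hQ : IsPoissonProcess ν Q) {n : ℕ} (f : Fin n → Lp ℝ 2 ν) :
    ∀ᵐ ω ∂Q, ∀ B : Finset (Fin n), 2 ≤ B.card →
      Tendsto (fun k => ω.sum fun x => ∏ i ∈ B, truncLp (f i) k x) atTop
        (𝓝 (ω.sum fun x => ∏ i ∈ B, f i x)) := by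
  have hm : Measurable fun x => ∑ i, f i x ^ 2 :=
    Finset.measurable_sum _ fun i _ => (measurable_coe_Lp (f i)).pow_const 2
  have hi : Integrable (fun x => ∑ i, f i x ^ 2) ν :=
    integrable_finsetSum _ fun i _ => (Lp.memLp (f i)).integrable_sq
  filter_upwards [hQ.ae_summable hm hi, ae_all_iff.2 fun i => ae_truncLp_eq hQ (f i)]
    with ω h1 h2 B hB
  have h3 : Summable fun x => (ω.mult x : ℝ) * ∑ i, f i x ^ 2 := by
    refine h1.congr fun x => ?_
    rw [abs_of_nonneg (Finset.sum_nonneg fun i _ => sq_nonneg _)]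
  refine ω.tendsto_sum (b := fun x =>
    Real.sqrt (∑' x, (ω.mult x : ℝ) * ∑ i, f i x ^ 2) ^ (B.card - 2) * ∑ i, f i x ^ 2)
    (fun k x hx => ?_) ?_ fun x hx => ?_
  · rw [Finset.abs_prod]
    refine le_trans (Finset.prod_le_prod (fun i _ => abs_nonneg _) fun i _ => ?_)
      (ω.prod_abs_le h3 hB hx)
    rw [h2 i x hx]
    exact abs_indicator_le _ _ _
  · refine (h3.mul_left (Real.sqrt (∑' x, (ω.mult x : ℝ) * ∑ i, f i x ^ 2) ^
      (B.card - 2))).congr fun x => ?_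
    ring
  · simp only [h2 _ x hx]
    exact tendsto_finsetProd _ fun i _ => tendsto_indicator_spanningSets _ _

/-- The canonical isomorphism sends the Hermite functionals to the Charlier functionals. -/
lemma ae_canonical_noiseHermite (hW : IsGaussianWhiteNoise ν P W) (hQ : IsPoissonProcess ν Q)
    (hΦ : IsCanonicalIsomorphism P W Q Φ) {n : ℕ} (f : Fin n → Lp ℝ 2 ν) :
    Φ (noiseHermite hW f) =ᵐ[Q] fun ω => ((charlier Q f ω : ℝ) : ℂ) := by
  -- One subsequence serves the full functional, indexed by `none`, and the `n` linear terms,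
  -- indexed by `some i`. The linear terms need it because for `f i` outside `L¹` they converge only
  -- in `L²`.
  obtain ⟨φ, hφ, h1⟩ := exists_strictMono_ae_tendsto (J := Option (Fin n))
    (F := fun j k => j.elim (Φ (noiseHermite hW fun i => truncLp (f i) k))
      fun i => Φ (noiseHermite hW fun _ : Fin 1 => truncLp (f i) k))
    (G := fun j => j.elim (Φ (noiseHermite hW f)) fun i => Φ (noiseHermite hW fun _ : Fin 1 => f i))
    (by
      rintro (_ | i)
      · exact ((Φ.continuous.comp (continuous_noiseHermite hW n)).tendsto f).comp
          (tendsto_pi_nhds.2 fun i => tendsto_truncLp (f i))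
      · exact ((continuous_canonical_linear (Φ := Φ) hW).tendsto (f i)).comp
          (tendsto_truncLp (f i)))
  have h2 : ∀ᵐ ω ∂Q, ∀ k, Φ (noiseHermite hW fun i => truncLp (f i) k) ω =
      ((charlierSum (fun i => centeredSum ν (truncLp (f i) k) ω)
        (fun B => ω.sum fun x => ∏ i ∈ B, truncLp (f i) k x) : ℝ) : ℂ) :=
    ae_all_iff.2 fun k => ae_canonical_noiseHermite_of_eq_zero_off hW hQ hΦ
      fun i => truncLp_eq_zero_off (f i) k
  have h3 : ∀ᵐ ω ∂Q, ∀ k i, Φ (noiseHermite hW fun _ : Fin 1 => truncLp (f i) k) ω =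
      ((centeredSum ν (truncLp (f i) k) ω : ℝ) : ℂ) :=
    ae_all_iff.2 fun k => ae_all_iff.2 fun i =>
      ae_canonical_linear_of_integrable hW hQ hΦ (integrable_truncLp (f i) k)
  have h4 : ∀ᵐ ω ∂Q, ∀ i, Φ (noiseHermite hW fun _ : Fin 1 => f i) ω =
      ((poissonLinear ν Q (f i) ω : ℝ) : ℂ) :=
    ae_all_iff.2 fun i => ae_canonical_linear hW hQ hΦ (f i)
  filter_upwards [h1, h2, h3, h4, ae_tendsto_sum_truncLp hQ f] with ω a1 a2 a3 a4 a5
  have a6 := a1 none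
  simp only [Option.elim_none, a2] at a6
  refine tendsto_nhds_unique a6 ((Complex.continuous_ofReal.tendsto _).comp ?_)
  rw [charlier_eq_charlierSum]
  refine tendsto_charlierSum (fun i => ?_) fun B hB => (a5 B hB).comp hφ.tendsto_atTop
  have a7 := a1 (some i)
  simp only [Option.elim_some, a3, a4] at a7
  simpa [Function.comp_def] using (Complex.continuous_re.tendsto _).comp a7

/-- `Φ` matches the generators and, being a linear homeomorphism, commutes with spans and closures.
-/
lemma map_wienerChaos (hW : IsGaussianWhiteNoise ν P W) (hQ : IsPoissonProcess ν Q)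
    (hΦ : IsCanonicalIsomorphism P W Q Φ) (n : ℕ) :
    (wienerChaos P W n).map (Φ.toLinearEquiv : NoiseL2 P W →ₗ[ℂ] Lp ℂ 2 Q) =
      poissonChaos ν Q n := by
  have h1 : {G : Lp ℂ 2 Q | ∃ f : Fin n → Lp ℝ 2 ν,
      G =ᵐ[Q] fun ω => ((charlier Q f ω : ℝ) : ℂ)} =
      Φ '' Set.range fun f : Fin n → Lp ℝ 2 ν => noiseHermite hW f := by
    ext G
    rw [← Set.range_comp]
    refine exists_congr fun f => ⟨fun h => ?_, fun h => ?_⟩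
    · exact Lp.ext ((ae_canonical_noiseHermite hW hQ hΦ f).trans h.symm)
    · rw [← h]
      exact ae_canonical_noiseHermite hW hQ hΦ f
  rw [poissonChaos, h1, wienerChaos_eq hW]
  refine SetLike.coe_injective ?_
  rw [Submodule.map_coe, Submodule.topologicalClosure_coe, Submodule.topologicalClosure_coe]
  refine (Φ.toHomeomorph.image_closure _).trans (congrArg closure ?_)
  have h2 := Submodule.map_span (Φ.toLinearEquiv : NoiseL2 P W →ₗ[ℂ] Lp ℂ 2 Q)
    (Set.range fun f : Fin n → Lp ℝ 2 ν => noiseHermite hW f)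
  exact congrArg (fun S : Submodule ℂ (Lp ℂ 2 Q) => (S : Set (Lp ℂ 2 Q))) h2

end Image

lemma IsOrthogonalDecomposition.map {H₁ H₂ : Type*} [NormedAddCommGroup H₁]
    [InnerProductSpace ℂ H₁] [NormedAddCommGroup H₂] [InnerProductSpace ℂ H₂]
    {V : ℕ → Submodule ℂ H₁} {U : ℕ → Submodule ℂ H₂} (hV : IsOrthogonalDecomposition V)
    (Φ : H₁ ≃ₗᵢ[ℂ] H₂) (hU : ∀ n, (V n).map (Φ.toLinearEquiv : H₁ →ₗ[ℂ] H₂) = U n) :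
    IsOrthogonalDecomposition U := by
  obtain ⟨h1, h2, h3⟩ := hV
  obtain rfl : U = fun n => (V n).map (Φ.toLinearEquiv : H₁ →ₗ[ℂ] H₂) :=
    funext fun n => (hU n).symm
  refine ⟨fun n => ?_, fun m n hmn => ?_, ?_⟩
  · exact Φ.toHomeomorph.isClosedMap _ (h1 n)
  · rw [Submodule.isOrtho_iff_inner_eq]
    rintro _ ⟨x, hx, rfl⟩ _ ⟨y, hy, rfl⟩
    exact (Φ.inner_map_map x y).trans (Submodule.isOrtho_iff_inner_eq.1 (h2 m n hmn) x hx y hy)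
  · rw [← Submodule.map_iSup, ← Submodule.dense_iff_topologicalClosure_eq_top]
    exact Φ.surjective.denseRange.dense_image Φ.continuous
      (Submodule.dense_iff_topologicalClosure_eq_top.2 h3)

end GaussPoisson

end

theorem corollary3p2 {X Ω : Type*} [MeasurableSpace X] [StandardBorelSpace X]
    [MeasurableSpace Ω]
    (ν : Measure X) [SigmaFinite ν] [NullSingletonClass ν]
    (P : Measure Ω) [IsProbabilityMeasure P]
    (W : Lp ℝ 2 ν → Ω → ℝ) (hW : GaussPoisson.IsGaussianWhiteNoise ν P W)
    (Q : Measure (GaussPoisson.Configuration X))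
    [IsProbabilityMeasure Q] (hQ : GaussPoisson.IsPoissonProcess ν Q) :
    (∃! Φ : GaussPoisson.NoiseL2 P W ≃ₗᵢ[ℂ] Lp ℂ 2 Q,
      GaussPoisson.IsCanonicalIsomorphism P W Q Φ) ∧
    GaussPoisson.IsOrthogonalDecomposition (GaussPoisson.wienerChaos P W) ∧
    GaussPoisson.IsOrthogonalDecomposition (GaussPoisson.poissonChaos ν Q) ∧
    ∀ Φ : GaussPoisson.NoiseL2 P W ≃ₗᵢ[ℂ] Lp ℂ 2 Q,
      GaussPoisson.IsCanonicalIsomorphism P W Q Φ →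
        (∀ (n : ℕ) (f : Fin n → Lp ℝ 2 ν), ∃ F : GaussPoisson.NoiseL2 P W,
          ((F : Lp ℂ 2 P) =ᵐ[P]
            fun η => ((GaussPoisson.hermite W f η : ℝ) : ℂ)) ∧
          (Φ F =ᵐ[Q] fun ω => ((GaussPoisson.charlier Q f ω : ℝ) : ℂ))) ∧
        (∀ n : ℕ, (GaussPoisson.wienerChaos P W n).map
            (Φ.toLinearEquiv : GaussPoisson.NoiseL2 P W →ₗ[ℂ] Lp ℂ 2 Q) =
          GaussPoisson.poissonChaos ν Q n) := by
  obtain ⟨Φ₀, hΦ₀, huniq⟩ := GaussPoisson.existsUnique_isCanonicalIsomorphism hW hQ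
  have hG := GaussPoisson.isOrthogonalDecomposition_wienerChaos hW
  -- The Poisson chaos decomposition is the image under `Φ₀` of the Wiener one.
  refine ⟨⟨Φ₀, hΦ₀, huniq⟩, hG, hG.map Φ₀ (GaussPoisson.map_wienerChaos hW hQ hΦ₀),
    fun Φ hΦ => ⟨fun n f => ?_, GaussPoisson.map_wienerChaos hW hQ hΦ⟩⟩
  exact ⟨GaussPoisson.noiseHermite hW f, GaussPoisson.coe_noiseHermite hW f,
    GaussPoisson.ae_canonical_noiseHermite hW hQ hΦ f⟩
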